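/- **Model.** A consumer lives in periods $t=0,1,2,\dots$. With trips $o_t,b_t,n_t\ge 0$ (outside option, integrated bundle, new mode) she obtains transportation services $\tau_t=o_t+\gamma A^{\phi}b_t+A\,n_t$, where $\gamma\in\mathbb R$, $\phi\in(0,1)$, and the quality $A\ge 0$ is an unknown random variable with $\mathbb E[A^2]<\infty$. Utility in period $t$ is $c_t-\frac{\lambda}{2}(\tau_t-\tau^*_t)^2$, with $\lambda>0$, other consumption $c_t\ge 0$ and targets $\tau_t^*\ge 0$; the discount factor is $\beta\in(0,1)$. The budget is $p_{o,t}o_t+p_{b,t}b_t+p_{n,t}n_t+c_t+a_{t+1}\le(1+i_t)a_t+w_t$ with $a_{t+1}\ge\underline a_{t+1}$, where prices and gross interest rates $1+i_t$ are positive and all of these sequences are deterministic. The choices of period $t$ are made on the information $\mathcal H_t$. Then the signal $Z_t=\psi(A)+V_t/\bar h(b_t,n_t)$ is observed and $\mathcal H_{t+1}=\sigma(\mathcal H_t,Z_t)$. Here $\psi$ is one-to-one and bimeasurable on a measurable set carrying $A$; $\bar h\ge0$ is nondecreasing and smooth; at zero precision the signal is pure noise. The noise $V_t$ is independent of $(\mathcal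 F_1,A,V_0,\dots,V_{t-1})$ and its law $F$ is stable (if $Z,Z'$ are independent with law $F$, then for all $c,c'$ there is $c''$ with $cZ+c'Z'\overset d=c''Z$) with mean zero and variance one. The value $V_t(a\mid\mathcal H)$ is the essential supremum, over feasible plans from $t$ on that start with wealth $a$ and information $\mathcal H$, of conditional expected discounted utility; a plan is optimal if it attains it. $\mathcal H_{t+1}(h)=\sigma(\mathcal H_t,\psi(A)+V_t/h)$. **Assumptions.** The initial information is $\mathcal F_1$, initial wealth is a constant $a_0\ge\underline a_0$, $(w_t)$ and $(\tau^*_t)$ are bounded, and $\beta(1+i_t)\le1$ for all $t$. If the natural debt limit $-\sum_{k\ge 0} w_{t+k}/\prod_{r=0}^{k}(1+i_{t+r})$ is finite, then $\underline a_t$ is at least that limit for every $t$; if the series does not converge absolutely, then $\sum_t\beta^t\max(-\underline a_t,0)<\infty$. **Proposition.** 1. For every feasible plan (in particular an optimal one) with wealth $a_{t+1}$ and information $\mathcal H_t$, every $t$, and all $h'<h''$ in $\operatorname{Im}\bar h$, the values below are well defined and integrable, and almost surely $$\mathbb E[V_{t+1}(a_{t+1}\mid\mathcal H_{t+1}(h''))\mid\mathcal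 H_t]\ \ge\ \mathbb E[V_{t+1}(a_{t+1}\mid\mathcal H_{t+1}(h'))\mid\mathcal H_t].$$ 2. If along a feasible plan (in particular an optimal one) $\limsup_{N}N/\sum_{j<N}\bar h(b_j,n_j)<\infty$ almost surely, then for every measurable $g$ with $\mathbb E|g(A)|<\infty$, $\mathbb E[g(A)\mid\mathcal H_N]\to g(A)$ almost surely and in $L^1$. 3. Let $x$ be an optimal plan, and let the price $p_{b,t}$ of the bundle in one period $t$ be changed, unanticipated, to $p_{b,t}+\Delta p$, where $\Delta p\neq 0$ and the new price is positive. (a) There are functions $\Phi_1,\Phi_2,\Phi_3:\mathbb R\times\mathbb R^5\to\mathbb R^3$, the same for all models, such that the following holds. Let $\tilde x$ be optimal from period $t$ on at the new price, with the same $a_t,\mathcal H_t$. Almost surely, if $o_t,b_t,n_t,c_t>0$ under both plans, if the derivative of the expected continuation value $\mathbb E[V_{t+1}(a_{t+1}\mid\mathcal H_{t+1}(h))\mid\mathcal H_t]$ in $h$ exists at the chosen precision under both, and if the matrix of conditional second moments of $(1,\gamma A^\phi,A)$ given $\mathcal H_t$ is invertible, then $$\frac{1}{\Delta p}\begin{bmatrix}\Delta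 o_t\\ \Delta b_t\\ \Delta n_t\end{bmatrix}=\frac{\boldsymbol\phi_{1,t}}{\lambda}+\frac{\boldsymbol\phi_{2,t}}{\lambda}\frac{\Delta M^b_t}{\Delta p}+\frac{\boldsymbol\phi_{3,t}}{\lambda}\frac{\Delta M^n_t}{\Delta p}.$$ Here $\Delta$ is the difference between the two plans, $M^b_t=\beta\,\frac{\partial\mathbb E[V_{t+1}\mid\mathcal H_t]}{\partial h}\frac{\partial\bar h}{\partial b}$ and $M^n_t=\beta\,\frac{\partial\mathbb E[V_{t+1}\mid\mathcal H_t]}{\partial h}\frac{\partial\bar h}{\partial n}$ are the marginal values of learning, and $\boldsymbol\phi_{k,t}=\Phi_k\big(\gamma,(\mathbb E[A^s\mid\mathcal H_t])_{s\in\{\phi,1,2\phi,\phi+1,2\}}\big)$. (b) Suppose that the price change leads to wealth $\tilde a_{t+1}$ instead of $a_{t+1}$, while the information set $\mathcal H_{t+1}$ stays that of $x$, and let $z$ be an optimal plan from $t+1$ on given $(\tilde a_{t+1},\mathcal H_{t+1})$. Let the change be small in the sense that, under each of $x$ and $z$, consumption $c_{t+1}$ remains nonnegative if it absorbs the wealth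 difference $(1+i_{t+1})(\tilde a_{t+1}-a_{t+1})$. Then the transportation demands $(o_s,b_s,n_s)_{s>t}$ of $x$ are still optimal given $(\tilde a_{t+1},\mathcal H_{t+1})$ after the change, and those of $z$ are optimal given $(a_{t+1},\mathcal H_{t+1})$ without it. In particular, if optimal transportation demands from $t+1$ on without the change are almost surely unique, then those of $z$ and $x$ agree almost surely in all periods $s>t$. -/

import Mathlib

open MeasureTheory ProbabilityTheory Filter Topology
open scoped ENNReal

noncomputable section

/-- The deterministic primitives of the consumer's problem. Period `0` is the initial period.
`hbar b n` is the precision of the signal after consuming `b` integrated trips and `n` trips with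
the new mode; `alow t` is the borrowing limit at `t`; `target t` is the transportation target. -/
structure Economy where
  β : ℝ
  lam : ℝ
  γ : ℝ
  φ : ℝ
  hbar : ℝ → ℝ → ℝ
  i : ℕ → ℝ
  w : ℕ → ℝ
  target : ℕ → ℝ
  alow : ℕ → ℝ
  po : ℕ → ℝ
  pb : ℕ → ℝ
  pn : ℕ → ℝ

namespace Economy

/-- The standing restrictions on the primitives. Smoothness and monotonicity of `hbar` are only
asked for on the quadrant of nonnegative consumption; its values elsewhere play no role. -/
structure Standing (E : Economy) : Prop where
  β_pos : 0 < E.β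
  β_lt : E.β < 1
  lam_pos : 0 < E.lam
  φ_pos : 0 < E.φ
  φ_lt : E.φ < 1
  hbar_measurable : Measurable fun q : ℝ × ℝ => E.hbar q.1 q.2
  hbar_nonneg : ∀ b n, 0 ≤ b → 0 ≤ n → 0 ≤ E.hbar b n
  hbar_mono : ∀ b n b' n', 0 ≤ b → 0 ≤ n → b ≤ b' → n ≤ n' → E.hbar b n ≤ E.hbar b' n'
  hbar_cont : ContinuousOn (fun q : ℝ × ℝ => E.hbar q.1 q.2) (Set.Ici 0 ×ˢ Set.Ici 0)
  hbar_smooth : ContDiffOn ℝ ((⊤ : ℕ∞) : WithTop ℕ∞) (fun q : ℝ × ℝ => E.hbar q.1 q.2) (Set.Ioi 0 ×ˢ Set.Ioi 0)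
  target_nonneg : ∀ t, 0 ≤ E.target t
  po_pos : ∀ t, 0 < E.po t
  pb_pos : ∀ t, 0 < E.pb t
  pn_pos : ∀ t, 0 < E.pn t
  gross_interest_pos : ∀ t, 0 < 1 + E.i t

/-- `Im hbar`: the precisions that can be attained. -/
def precisions (E : Economy) : Set ℝ :=
  {h | ∃ b n, 0 ≤ b ∧ 0 ≤ n ∧ E.hbar b n = h}

/-- Income of period `t + k`, discounted to the beginning of period `t`. -/
def discountedIncome (E : Economy) (t k : ℕ) : ℝ :=
  E.w (t + k) / ∏ r ∈ Finset.range (k + 1), (1 + E.i (t + r))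

/-- The natural debt limit at `t` (when the present value of income is finite). -/
def naturalDebtLimit (E : Economy) (t : ℕ) : ℝ :=
  -∑' k, E.discountedIncome t k

/-- The borrowing limits are not below the natural debt limit. If the present value of income is
infinite, the natural debt limit is `-∞` and restricts nothing; then the borrowing limits are only
asked not to leave room for Ponzi schemes of infinite value. -/
def DebtLimits (E : Economy) : Prop :=
  (∀ t, Summable (E.discountedIncome t) → E.naturalDebtLimit t ≤ E.alow t) ∧
  (¬ Summable (E.discountedIncome 0) → Summable fun t => E.β ^ t * max (-E.alow t) 0)

/-- The same economy with price `q` for integrated trips in period `t` (and only there). -/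
def withBundlePrice (E : Economy) (t : ℕ) (q : ℝ) : Economy :=
  { E with pb := Function.update E.pb t q }

end Economy

/-- Stability of a law on `ℝ`: for independent copies `Z, Z'`, every `c Z + c' Z'` is distributed
as some `c'' Z`. -/
def IsStableLaw (F : Measure ℝ) : Prop :=
  ∀ c c' : ℝ, ∃ c'' : ℝ,
    (F.prod F).map (fun z => c * z.1 + c' * z.2) = F.map (fun z => c'' * z)

/-- A stable distribution with zero mean and unit variance. -/
structure IsStandardStable (F : Measure ℝ) : Prop where
  prob : IsProbabilityMeasure F
  memLp : MemLp id 2 F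
  mean : ∫ z, z ∂F = 0
  variance : ∫ z, z ^ 2 ∂F = 1
  stable : IsStableLaw F

/-- The uncertain objects: quality `A` with values in the set `supp`, the map `ψ`, the noise `V t`
in the signal of period `t`, and the law `F` of the noise. -/
structure Uncertainty (Ω : Type*) where
  A : Ω → ℝ
  supp : Set ℝ
  ψ : ℝ → ℝ
  V : ℕ → Ω → ℝ
  F : Measure ℝ

namespace Uncertainty

variable {Ω : Type*}

/-- `A ≥ 0` is a square-integrable random variable, `ψ` is one-to-one and bimeasurable on the set
of possible qualities, and, given initial information, quality and all past noise, the noise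
`V t` is distributed as `F`. -/
structure Standing (U : Uncertainty Ω) (F₁ : MeasurableSpace Ω) {mΩ : MeasurableSpace Ω}
    (P : Measure Ω) : Prop where
  A_measurable : Measurable[mΩ] U.A
  A_mem : ∀ ω, U.A ω ∈ U.supp
  A_sq : MemLp U.A 2 P
  supp_measurable : MeasurableSet U.supp
  supp_nonneg : ∀ y ∈ U.supp, 0 ≤ y
  ψ_measurable : Measurable U.ψ
  ψ_embedding : MeasurableEmbedding fun y : U.supp => U.ψ y
  F_stable : IsStandardStable U.F
  V_measurable : ∀ t, Measurable[mΩ] (U.V t)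
  V_law : ∀ t, P.map (U.V t) = U.F
  V_indep : ∀ t, Indep (MeasurableSpace.comap (U.V t) inferInstance)
    (F₁ ⊔ MeasurableSpace.comap U.A inferInstance ⊔
      ⨆ s : {s : ℕ // s < t}, MeasurableSpace.comap (U.V s) inferInstance) P

/-- The signal of period `t` under precision `η`: `ψ(A) + V_t / η`; at precision zero it is
uninformative noise. -/
def signal (U : Uncertainty Ω) (t : ℕ) (η : Ω → ℝ) : Ω → ℝ :=
  fun ω => if η ω = 0 then U.V t ω else U.ψ (U.A ω) + 1 / η ω * U.V t ω

/-- `H_{t+1}(η) = σ(H_t, Z_t(η))`. -/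
@[reducible] def learn (U : Uncertainty Ω) (t : ℕ) (H : MeasurableSpace Ω) (η : Ω → ℝ) : MeasurableSpace Ω :=
  H ⊔ MeasurableSpace.comap (U.signal t η) inferInstance

end Uncertainty

/-- A state-contingent plan: trips with the outside option, integrated trips, trips with the new
mode, other consumption, and wealth at the beginning of each period. -/
structure Plan (Ω : Type*) where
  o : ℕ → Ω → ℝ
  b : ℕ → Ω → ℝ
  n : ℕ → Ω → ℝ
  c : ℕ → Ω → ℝ
  a : ℕ → Ω → ℝ

section Model

variable {Ω : Type*}

/-- Precision of the signal of period `s` under the plan `x`. -/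
def precision (E : Economy) (x : Plan Ω) (s : ℕ) : Ω → ℝ :=
  fun ω => E.hbar (x.b s ω) (x.n s ω)

/-- Total transportation services `o + γ A^φ b + A n` of period `s`. -/
def transport (E : Economy) (U : Uncertainty Ω) (x : Plan Ω) (s : ℕ) : Ω → ℝ :=
  fun ω => x.o s ω + E.γ * U.A ω ^ E.φ * x.b s ω + U.A ω * x.n s ω

/-- Realised utility of period `s`. -/
def utility (E : Economy) (U : Uncertainty Ω) (x : Plan Ω) (s : ℕ) : Ω → ℝ :=
  fun ω => x.c s ω - E.lam / 2 * (transport E U x s ω - E.target s) ^ 2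

/-- Discounted utility from period `t` on. -/
def lifetime (E : Economy) (U : Uncertainty Ω) (x : Plan Ω) (t : ℕ) : Ω → ℝ :=
  fun ω => ∑' k, E.β ^ k * utility E U x (t + k) ω

/-- The information set at the beginning of period `s` when the plan `x` is followed from period
`t` on, starting with the information set `H` (for `s ≤ t` it is `H`). -/
@[reducible] def info (E : Economy) (U : Uncertainty Ω) (x : Plan Ω) (t : ℕ) (H : MeasurableSpace Ω) :
    ℕ → MeasurableSpace Ω
  | 0 => H
  | s + 1 => if s < t then H else U.learn s (info E U x t H s) (precision E x s)

variable {mΩ : MeasurableSpace Ω}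

/-- `x` is a feasible plan from period `t` on, with wealth `a₀` and information `H` at the beginning
of period `t`: the choices of each period are made on the information of that period, are
nonnegative, and respect the budget and the borrowing limit. -/
structure Feasible (E : Economy) (U : Uncertainty Ω) (P : Measure Ω) (t : ℕ) (a₀ : Ω → ℝ)
    (H : MeasurableSpace Ω) (x : Plan Ω) : Prop where
  start : x.a t = a₀
  o_adapted : ∀ s, t ≤ s → Measurable[info E U x t H s] (x.o s)
  b_adapted : ∀ s, t ≤ s → Measurable[info E U x t H s] (x.b s)
  n_adapted : ∀ s, t ≤ s → Measurable[info E U x t H s] (x.n s)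
  c_adapted : ∀ s, t ≤ s → Measurable[info E U x t H s] (x.c s)
  a_adapted : ∀ s, t ≤ s → Measurable[info E U x t H s] (x.a (s + 1))
  nonneg : ∀ s, t ≤ s → ∀ᵐ ω ∂P, 0 ≤ x.o s ω ∧ 0 ≤ x.b s ω ∧ 0 ≤ x.n s ω ∧ 0 ≤ x.c s ω
  borrowing : ∀ s, t ≤ s → ∀ᵐ ω ∂P, E.alow (s + 1) ≤ x.a (s + 1) ω
  budget : ∀ s, t ≤ s → ∀ᵐ ω ∂P,
    E.po s * x.o s ω + E.pb s * x.b s ω + E.pn s * x.n s ω + x.c s ω + x.a (s + 1) ω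
      ≤ (1 + E.i s) * x.a s ω + E.w s

/-- The expected discounted utility from `t` on is finite (for a feasible plan it could otherwise
only be `-∞`). -/
def FiniteUtility (E : Economy) (U : Uncertainty Ω) (P : Measure Ω) (t : ℕ) (x : Plan Ω) : Prop :=
  (∀ s, t ≤ s → Integrable (utility E U x s) P) ∧
  Summable fun k => E.β ^ k * ∫ ω, |utility E U x (t + k) ω| ∂P

/-- The conditional expected discounted utilities that can be attained from `t` on. -/
def attainable (E : Economy) (U : Uncertainty Ω) (P : Measure Ω) (t : ℕ) (a₀ : Ω → ℝ)
    (H : MeasurableSpace Ω) : Set (Ω → ℝ) :=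
  {f | ∃ x, Feasible E U P t a₀ H x ∧ FiniteUtility E U P t x ∧ f = P[lifetime E U x t | H]}

/-- `v` is the essential supremum of the family `S` of `H`-measurable functions. -/
def IsEssentialSup (P : Measure Ω) (H : MeasurableSpace Ω) (S : Set (Ω → ℝ)) (v : Ω → ℝ) : Prop :=
  Measurable[H] v ∧ (∀ f ∈ S, f ≤ᵐ[P] v) ∧
    ∀ w : Ω → ℝ, Measurable[H] w → (∀ f ∈ S, f ≤ᵐ[P] w) → v ≤ᵐ[P] w

open Classical in
/-- The value `V_t(a₀ | H)`: the essential supremum of conditional expected discounted utility over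
feasible plans (almost surely unique; `0` if there is none with real values). -/
def value (E : Economy) (U : Uncertainty Ω) (P : Measure Ω) (t : ℕ) (a₀ : Ω → ℝ)
    (H : MeasurableSpace Ω) : Ω → ℝ :=
  if h : ∃ v, IsEssentialSup P H (attainable E U P t a₀ H) v then h.choose else 0

/-- `x` is an optimal plan from period `t` on. -/
def Optimal (E : Economy) (U : Uncertainty Ω) (P : Measure Ω) (t : ℕ) (a₀ : Ω → ℝ)
    (H : MeasurableSpace Ω) (x : Plan Ω) : Prop :=
  Feasible E U P t a₀ H x ∧ FiniteUtility E U P t x ∧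
    IsEssentialSup P H (attainable E U P t a₀ H) (value E U P t a₀ H) ∧
    P[lifetime E U x t | H] =ᵐ[P] value E U P t a₀ H

/-- All goods are consumed in positive quantity in period `t` in the state `ω`. -/
def InteriorAt (x : Plan Ω) (t : ℕ) (ω : Ω) : Prop :=
  0 < x.o t ω ∧ 0 < x.b t ω ∧ 0 < x.n t ω ∧ 0 < x.c t ω

/-- `W h ω` is a version of the expected continuation value `E[V_{t+1}(a' | H_{t+1}(h)) | H_t](ω)`
as a function of the precision `h`, simultaneously for all precisions chosen on the information
`H = H_t`. -/
def IsContinuationValue (E : Economy) (U : Uncertainty Ω) (P : Measure Ω) (t : ℕ)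
    (H : MeasurableSpace Ω) (anext : Ω → ℝ) (W : ℝ → Ω → ℝ) : Prop :=
  ∀ η : Ω → ℝ, Measurable[H] η → (∀ᵐ ω ∂P, η ω ∈ E.precisions) →
    P[value E U P (t + 1) anext (U.learn t H η) | H] =ᵐ[P] fun ω => W (η ω) ω

/-- `D` is, in the state `ω`, the derivative of the expected continuation value with respect to
precision, at the precision chosen by `x` in period `t`. -/
def HasMarginalValue (E : Economy) (x : Plan Ω) (t : ℕ) (W : ℝ → Ω → ℝ) (D : ℝ) (ω : Ω) : Prop :=
  HasDerivWithinAt (fun h => W h ω) D E.precisions (precision E x t ω)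

/-- Marginal value of learning from integrated trips: `β · ∂E[V_{t+1}|H_t]/∂h · ∂h/∂b`. -/
def marginalLearningB (E : Economy) (x : Plan Ω) (t : ℕ) (D : ℝ) (ω : Ω) : ℝ :=
  E.β * D * deriv (fun y => E.hbar y (x.n t ω)) (x.b t ω)

/-- Marginal value of learning from the new mode: `β · ∂E[V_{t+1}|H_t]/∂h · ∂h/∂n`. -/
def marginalLearningN (E : Economy) (x : Plan Ω) (t : ℕ) (D : ℝ) (ω : Ω) : ℝ :=
  E.β * D * deriv (fun y => E.hbar (x.b t ω) y) (x.n t ω)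

/-- The demand `(o_t, b_t, n_t)` for the modes of transportation in the state `ω`. -/
def demand (x : Plan Ω) (t : ℕ) (ω : Ω) : Fin 3 → ℝ :=
  ![x.o t ω, x.b t ω, x.n t ω]

/-- The conditional moments `E[A^s | H]`, `s = φ, 1, 2φ, φ + 1, 2`. -/
def moments (E : Economy) (U : Uncertainty Ω) (P : Measure Ω) (H : MeasurableSpace Ω) (ω : Ω) :
    Fin 5 → ℝ :=
  ![(P[fun ω => U.A ω ^ E.φ | H]) ω, (P[U.A | H]) ω, (P[fun ω => U.A ω ^ (2 * E.φ) | H]) ω,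
    (P[fun ω => U.A ω ^ (E.φ + 1) | H]) ω, (P[fun ω => U.A ω ^ 2 | H]) ω]

/-- The conditional second-moment matrix of `(1, γ A^φ, A)`. -/
def momentMatrix (γ : ℝ) (m : Fin 5 → ℝ) : Matrix (Fin 3) (Fin 3) ℝ :=
  !![1, γ * m 0, m 1;
     γ * m 0, γ ^ 2 * m 2, γ * m 3;
     m 1, γ * m 3, m 4]

end Model

end

/-! The value of a problem is an essential supremum over plans. Plans can be pasted along events
known at the start, so the attainable conditional utilities are directed. They are bounded above
because utility is at most consumption, and the debt limits together with `β (1 + i) ≤ 1` bound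
discounted consumption (`exists_sum_consumption_le`). A monotone sequence of attainable utilities
therefore converges to the value (`exists_seq_isEssentialSup`), and every inequality for the value
reduces to integrals of single plans over known events.

Monotonicity in precision is Blackwell's theorem. A stable law with unit variance is the standard
Gaussian (`IsStandardStable.eq_gaussianReal`), so `r V + s e` has the law of `V` whenever `r ^ 2 + s
^ 2 = 1` and `e` is an independent copy. With `r = h' / h''` the signal of precision `h'` driven by
the noise `r V + s e` is a function of the signal of precision `h''` and `e`. For almost every fixed
`e`, a better informed consumer can thus imitate any plan of a less informed one. Averaging over `e`
gives the inequality (`GarblingModel.setIntegral_value_le`). A plan is re-run with other noise by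
factoring it through a space where the noise of period `t` is a free coordinate (`liftPlan`).

For asymptotic learning, the precision-weighted average of signals is `ψ(A)` plus a sum of
uncorrelated noises divided by total precision. The noise sum is of smaller order than `N` along
squares, whereas total precision grows at least linearly, so `ψ(A)`, and hence `A`, is known in the
limit. Lévy's upward theorem then gives convergence of beliefs.

For the contemporaneous effect, expected utility is quadratic in the trips with the conditional
moments as coefficients. One-period deviations that leave next wealth unchanged give linear
first-order conditions (`Best.ae_foc`); subtracting them for the two plans and inverting the moment
matrix gives the formula. For later effects, utility is linear in consumption, so a wealth
difference absorbed by consumption changes all relevant payoffs by the same amount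
(`Best.shiftWealth`). -/

noncomputable section

/-! ### Essential suprema of directed families -/

section Families

variable {Ω : Type*} {H mΩ : MeasurableSpace Ω} {P : Measure Ω} {S : Set (Ω → ℝ)}

theorem IsEssentialSup.ae_eq {v w : Ω → ℝ} (hv : IsEssentialSup P H S v)
    (hw : IsEssentialSup P H S w) : v =ᵐ[P] w :=
  (hv.2.2 w hw.1 hw.2.1).antisymm (hw.2.2 v hv.1 hv.2.1)

/-- The essential supremum of a bounded directed family is the limit of a monotone sequence in the
family. -/
theorem exists_seq_isEssentialSup [IsProbabilityMeasure P] (hne : S.Nonempty)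
    (hS : ∀ f ∈ S, Measurable[H] f ∧ Integrable f P)
    (hdir : ∀ f ∈ S, ∀ g ∈ S, ∃ k ∈ S, f ≤ᵐ[P] k ∧ g ≤ᵐ[P] k) {C : ℝ}
    (hC : ∀ f ∈ S, ∀ᵐ ω ∂P, f ω ≤ C) :
    ∃ (f : ℕ → Ω → ℝ) (w : Ω → ℝ), (∀ n, f n ∈ S) ∧ (∀ᵐ ω ∂P, Monotone fun n => f n ω) ∧
      IsEssentialSup P H S w ∧ Integrable w P ∧
      ∀ᵐ ω ∂P, Tendsto (fun n => f n ω) atTop (𝓝 (w ω)) := by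
  classical
  have hbdd : ∀ f ∈ S, ∫ ω, f ω ∂P ≤ C := fun f hf => by
    have := integral_mono_ae (hS f hf).2 (integrable_const C) (hC f hf)
    simpa using this
  set T : Set ℝ := (fun f : Ω → ℝ => ∫ ω, f ω ∂P) '' S
  have hTne : T.Nonempty := hne.image _
  have hTb : BddAbove T := ⟨C, by rintro _ ⟨f, hf, rfl⟩; exact hbdd f hf⟩
  have hle : ∀ f ∈ S, ∫ ω, f ω ∂P ≤ sSup T := fun f hf => le_csSup hTb ⟨f, hf, rfl⟩
  have hg : ∀ n : ℕ, ∃ g ∈ S, sSup T - 1 / ((n : ℝ) + 1) < ∫ ω, g ω ∂P := by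
    intro n
    obtain ⟨_, ⟨g, hg, rfl⟩, h⟩ := exists_lt_of_lt_csSup hTne
      (sub_lt_self (sSup T) (Nat.one_div_pos_of_nat (α := ℝ) (n := n)))
    exact ⟨g, hg, h⟩
  choose g hgS hgI using hg
  choose! k hkS hk1 hk2 using hdir
  let f : ℕ → Ω → ℝ := fun n => Nat.rec (g 0) (fun n fn => k fn (g (n + 1))) n
  have fsucc : ∀ n, f (n + 1) = k (f n) (g (n + 1)) := fun n => rfl
  have fS : ∀ n, f n ∈ S := by
    intro n
    induction n with
    | zero => exact hgS 0
    | succ n ih => rw [fsucc]; exact hkS _ ih _ (hgS _)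
  have fg : ∀ n, g n ≤ᵐ[P] f n := by
    intro n
    cases n with
    | zero => exact EventuallyLE.refl _ _
    | succ n => rw [fsucc]; exact hk2 _ (fS n) _ (hgS _)
  have fmono : ∀ᵐ ω ∂P, Monotone fun n => f n ω := by
    have : ∀ᵐ ω ∂P, ∀ n, f n ω ≤ f (n + 1) ω :=
      ae_all_iff.2 fun n => by rw [fsucc]; exact hk1 _ (fS n) _ (hgS _)
    filter_upwards [this] with ω hω using monotone_nat_of_le_succ hω
  have fC : ∀ᵐ ω ∂P, ∀ n, f n ω ≤ C := ae_all_iff.2 fun n => hC _ (fS n)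
  set w : Ω → ℝ := fun ω => ⨆ n, f n ω
  have wm : Measurable[H] w := Measurable.iSup fun n => (hS _ (fS n)).1
  have hlim : ∀ᵐ ω ∂P, Tendsto (fun n => f n ω) atTop (𝓝 (w ω)) := by
    filter_upwards [fmono, fC] with ω h1 h2
    exact tendsto_atTop_ciSup h1 ⟨C, by rintro _ ⟨n, rfl⟩; exact h2 n⟩
  have wC : ∀ᵐ ω ∂P, w ω ≤ C := by
    filter_upwards [fC] with ω h using ciSup_le h
  have fw : ∀ᵐ ω ∂P, ∀ n, f n ω ≤ w ω := by
    filter_upwards [fC] with ω h n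
    exact le_ciSup (f := fun n => f n ω) ⟨C, by rintro _ ⟨n, rfl⟩; exact h n⟩ n
  have waem : AEStronglyMeasurable w P :=
    aestronglyMeasurable_of_tendsto_ae atTop (fun n => (hS _ (fS n)).2.1) hlim
  have wint : Integrable w P := by
    refine ((hS _ (fS 0)).2.abs.add (integrable_const |C|)).mono' waem ?_
    filter_upwards [fw, wC] with ω h1 h2
    have h1 := h1 0
    simp only [Pi.add_apply, Real.norm_eq_abs]
    rw [abs_le]
    constructor
    · linarith [neg_abs_le (f 0 ω), abs_nonneg C]
    · linarith [le_abs_self C, abs_nonneg (f 0 ω)]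
  have hI : ∫ ω, w ω ∂P = sSup T := by
    have h1 := integral_tendsto_of_tendsto_of_monotone (fun n => (hS _ (fS n)).2) wint fmono hlim
    refine tendsto_nhds_unique h1 ?_
    have h0 : Tendsto (fun n : ℕ => sSup T - 1 / ((n : ℝ) + 1)) atTop (𝓝 (sSup T)) := by
      simpa using tendsto_const_nhds.sub (tendsto_one_div_add_atTop_nhds_zero_nat (𝕜 := ℝ))
    refine tendsto_of_tendsto_of_tendsto_of_le_of_le h0 tendsto_const_nhds (fun n => ?_)
      fun n => hle _ (fS n)
    exact (hgI n).le.trans (integral_mono_ae (hS _ (hgS n)).2 (hS _ (fS n)).2 (fg n))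
  refine ⟨f, w, fS, fmono, ⟨wm, fun φ hφ => ?_, fun u _ hu => ?_⟩, wint, hlim⟩
  -- By directedness `φ ⊔ f n` lies below a member of `S`, so the integral of `φ ⊔ w` is at most
  -- `sSup T`, the integral of `w`. As `φ ⊔ w` dominates `w`, the two agree almost surely.
  · have hφi := (hS φ hφ).2
    have h1 : Tendsto (fun n => ∫ ω, (φ ⊔ f n) ω ∂P) atTop (𝓝 (∫ ω, (φ ⊔ w) ω ∂P)) := by
      refine integral_tendsto_of_tendsto_of_monotone (fun n => hφi.sup (hS _ (fS n)).2)
        (hφi.sup wint) ?_ ?_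
      · filter_upwards [fmono] with ω h m n hmn
        exact sup_le_sup_left (h hmn) _
      · filter_upwards [hlim] with ω h
        exact (continuous_const.max continuous_id).continuousAt.tendsto.comp h
    have h2 : ∫ ω, (φ ⊔ w) ω ∂P ≤ ∫ ω, w ω ∂P := by
      rw [hI]
      refine le_of_tendsto' h1 fun n => ?_
      refine le_trans (integral_mono_ae (hφi.sup (hS _ (fS n)).2)
        (hS _ (hkS _ hφ _ (fS n))).2 ?_) (hle _ (hkS _ hφ _ (fS n)))
      filter_upwards [hk1 _ hφ _ (fS n), hk2 _ hφ _ (fS n)] with ω ha hb using sup_le ha hb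
    have h3 : ∫ ω, ((φ ⊔ w) ω - w ω) ∂P = 0 := by
      refine le_antisymm ?_ (integral_nonneg fun ω => ?_)
      · rw [integral_sub (hφi.sup wint) wint]; linarith
      · exact sub_nonneg.2 le_sup_right
    have h4 := (integral_eq_zero_iff_of_nonneg (fun ω => sub_nonneg.2 le_sup_right)
      ((hφi.sup wint).sub wint)).1 h3
    filter_upwards [h4] with ω h
    have h' : max (φ ω) (w ω) - w ω = 0 := h
    linarith [le_max_left (φ ω) (w ω)]
  · have : ∀ᵐ ω ∂P, ∀ n, f n ω ≤ u ω := ae_all_iff.2 fun n => hu _ (fS n)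
    filter_upwards [this] with ω h using ciSup_le h

/-- Monotone convergence along the sequence from `exists_seq_isEssentialSup`. This replaces any
measurable selection of nearly optimal plans. -/
theorem IsEssentialSup.setIntegral_le [IsProbabilityMeasure P] (hne : S.Nonempty)
    (hS : ∀ f ∈ S, Measurable[H] f ∧ Integrable f P)
    (hdir : ∀ f ∈ S, ∀ g ∈ S, ∃ k ∈ S, f ≤ᵐ[P] k ∧ g ≤ᵐ[P] k) {C : ℝ}
    (hC : ∀ f ∈ S, ∀ᵐ ω ∂P, f ω ≤ C) {v : Ω → ℝ} (hv : IsEssentialSup P H S v) {B : Set Ω} {D : ℝ}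
    (hD : ∀ f ∈ S, ∫ ω in B, f ω ∂P ≤ D) : ∫ ω in B, v ω ∂P ≤ D := by
  obtain ⟨f, w, fS, fm, hw, wi, hl⟩ := exists_seq_isEssentialSup hne hS hdir hC
  rw [integral_congr_ae (ae_restrict_of_ae (hv.ae_eq hw))]
  exact le_of_tendsto' (integral_tendsto_of_tendsto_of_monotone
    (fun n => (hS _ (fS n)).2.integrableOn) wi.integrableOn (ae_restrict_of_ae fm)
    (ae_restrict_of_ae hl)) fun n => hD _ (fS n)

/-- An integral inequality on all sets of a sub-σ-algebra. -/
theorem ae_le_of_setIntegral_le_of_measurable [IsFiniteMeasure P] (hH : H ≤ mΩ) {f g : Ω → ℝ}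
    (hf : Measurable[H] f) (hg : Measurable[H] g) (hfi : Integrable f P) (hgi : Integrable g P)
    (h : ∀ B, MeasurableSet[H] B → ∫ ω in B, f ω ∂P ≤ ∫ ω in B, g ω ∂P) : f ≤ᵐ[P] g := by
  refine ae_le_of_ae_le_trim (hm := hH) ?_
  refine ae_le_of_forall_setIntegral_le (hfi.trim hH hf.stronglyMeasurable)
    (hgi.trim hH hg.stronglyMeasurable) fun B hB _ => ?_
  rw [← setIntegral_trim hH hf.stronglyMeasurable hB,
    ← setIntegral_trim hH hg.stronglyMeasurable hB]
  exact h B hB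

end Families

/-- Tonelli: a series with finite total expected absolute value converges absolutely almost surely.
It serves for lifetime utility, for plans at a frozen value of extra noise, and for the strong law
along squares. -/
theorem ae_summable_of_summable_integral_abs {Ω : Type*} {mΩ : MeasurableSpace Ω} {P : Measure Ω}
    {u : ℕ → Ω → ℝ} (hu : ∀ k, Integrable (u k) P) (hs : Summable fun k => ∫ ω, |u k ω| ∂P) :
    (∀ᵐ ω ∂P, Summable fun k => |u k ω|) ∧ Integrable (fun ω => ∑' k, u k ω) P := by
  have key : ∑' k, ∫⁻ ω, ‖u k ω‖ₑ ∂P ≠ ⊤ := by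
    have : ∀ k, ∫⁻ ω, ‖u k ω‖ₑ ∂P = ENNReal.ofReal (∫ ω, |u k ω| ∂P) := fun k =>
      (ofReal_integral_norm_eq_lintegral_enorm (hu k)).symm
    simp_rw [this]
    exact hs.tsum_ofReal_ne_top
  have hm : ∀ k, AEMeasurable (fun ω => ‖u k ω‖ₑ) P := fun k => (hu k).1.enorm
  rw [← lintegral_tsum hm] at key
  have hae : ∀ᵐ ω ∂P, Summable fun k => |u k ω| := by
    filter_upwards [ae_lt_top' (AEMeasurable.tsum hm) key] with ω h
    have h' : Summable fun k => ‖u k ω‖₊ := ENNReal.tsum_coe_ne_top_iff_summable.mp h.ne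
    exact NNReal.summable_coe.2 h'
  refine ⟨hae, ?_, ?_⟩
  · refine aestronglyMeasurable_of_tendsto_ae atTop
      (f := fun n ω => ∑ k ∈ Finset.range n, u k ω)
      (fun n => (integrable_finsetSum _ fun k _ => hu k).1) ?_
    filter_upwards [hae] with ω h using (summable_abs_iff.1 h).hasSum.tendsto_sum_nat
  · refine lt_of_le_of_lt (lintegral_mono_ae ?_) key.lt_top
    filter_upwards [hae] with ω h
    exact enorm_tsum_le_tsum_enorm

/-! ### Stable laws with finite variance are Gaussian -/

section Gaussian

/-- Stability with `c = c' = 1` gives a scale `k`, and comparing variances gives `k ^ 2 = 2`. The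
scale is written as an inverse square root of a power of `4` to match the normalization in the
central limit theorem. -/
theorem IsStandardStable.charFun_eq {F : Measure ℝ} (hF : IsStandardStable F) (t : ℝ) :
    charFun F t = (charFun F ((√((4 ^ 1 : ℕ) : ℝ))⁻¹ * t)) ^ 4 := by
  have := hF.prob
  obtain ⟨k, hk⟩ := hF.stable 1 1
  simp only [one_mul] at hk
  have hid : Integrable (fun z : ℝ => z) F := hF.memLp.integrable (by norm_num)
  have hsq : Integrable (fun z : ℝ => z ^ 2) F := hF.memLp.integrable_sq
  have hk2 : k ^ 2 = 2 := by
    have h1 : ∫ z, z ^ 2 ∂((F.prod F).map fun z => z.1 + z.2) = 2 := by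
      rw [integral_map (by fun_prop) (by fun_prop)]
      have : ∀ z : ℝ × ℝ, (z.1 + z.2) ^ 2 = z.1 ^ 2 * 1 + 2 * (z.1 * z.2) + 1 * z.2 ^ 2 := by
        intro z; ring
      simp_rw [this]
      have i1 : Integrable (fun z : ℝ × ℝ => z.1 ^ 2 * 1) (F.prod F) :=
        hsq.mul_prod (integrable_const 1)
      have i2 : Integrable (fun z : ℝ × ℝ => z.1 * z.2) (F.prod F) := hid.mul_prod hid
      have i3 : Integrable (fun z : ℝ × ℝ => 1 * z.2 ^ 2) (F.prod F) :=
        (integrable_const 1).mul_prod hsq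
      have i12 : Integrable (fun z : ℝ × ℝ => z.1 ^ 2 * 1 + 2 * (z.1 * z.2)) (F.prod F) :=
        i1.add (i2.const_mul 2)
      rw [integral_add i12 i3, integral_add i1 (i2.const_mul 2), integral_const_mul,
        integral_prod_mul (fun z : ℝ => z ^ 2) (fun _ => (1 : ℝ)),
        integral_prod_mul (fun z : ℝ => z) (fun z => z),
        integral_prod_mul (fun _ : ℝ => (1 : ℝ)) (fun z => z ^ 2), hF.variance, hF.mean]
      norm_num
    have h2 : ∫ z, z ^ 2 ∂(F.map fun z => k * z) = k ^ 2 := by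
      rw [integral_map (by fun_prop) (by fun_prop)]
      simp_rw [mul_pow]
      rw [integral_const_mul, hF.variance, mul_one]
    rw [← h1, hk, h2]
  have h : ∀ s, charFun F s ^ 2 = charFun F (k * s) := by
    intro s
    have := congrFun (charFun_map_add_prod_eq_mul (μ := F) (ν := F)) s
    rw [hk, charFun_map_mul] at this
    rw [this, Pi.mul_apply, sq]
  have h4 : √((4 ^ 1 : ℕ) : ℝ) = 2 := by
    rw [show (((4 ^ 1 : ℕ) : ℝ)) = 2 ^ 2 by norm_num]
    exact Real.sqrt_sq (by norm_num)
  -- Using the squaring relation twice produces the scale `k ^ 2 = 2`, so the unknown sign of `k`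
  -- drops out.
  rw [h4, show (4 : ℕ) = 2 * 2 from rfl, pow_mul, h, h]
  congr 1
  linear_combination (-(2⁻¹ * t)) * hk2

/-- Iterating `charFun_eq` expresses the characteristic function at `t` as that of a normalized sum
of `4 ^ n` independent copies. This is constant in `n`, while the central limit theorem sends it to
`exp (-t ^ 2 / 2)`. -/
theorem IsStandardStable.eq_gaussianReal {F : Measure ℝ} (hF : IsStandardStable F) :
    F = gaussianReal 0 1 := by
  have := hF.prob
  have hn : ∀ (n : ℕ) (t : ℝ), charFun F t = (charFun F ((√((4 ^ n : ℕ) : ℝ))⁻¹ * t)) ^ (4 ^ n) := by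
    intro n
    induction n with
    | zero => intro t; simp
    | succ n ih =>
      intro t
      rw [hF.charFun_eq t, ih ((√((4 ^ 1 : ℕ) : ℝ))⁻¹ * t), ← pow_mul, ← pow_succ, ← mul_assoc]
      congr 3
      rw [← mul_inv, ← Real.sqrt_mul (by positivity)]
      push_cast
      ring_nf
  refine Measure.ext_of_charFun ?_
  ext t
  rw [charFun_gaussianReal]
  have h1 := tendsto_charFun_inv_sqrt_mul_pow (P := F) (X := id) aemeasurable_id
    (by simpa using hF.mean) (by simpa using hF.variance) t
  have h2 := h1.comp (tendsto_pow_atTop_atTop_of_one_lt (r := 4) (by norm_num))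
  have h3 : Tendsto (fun _ : ℕ => charFun F t) atTop (𝓝 (Complex.exp (-t ^ 2 / 2))) := by
    refine h2.congr fun n => ?_
    simp only [Function.comp, Measure.map_id]
    exact (hn n t).symm
  rw [tendsto_nhds_unique tendsto_const_nhds h3]
  congr 1
  simp [neg_div]

/-- This invariance is all that the comparison of signals needs from stability: noise can be scaled
down and topped up with fresh noise without changing its law. -/
theorem IsStandardStable.map_rotate {F : Measure ℝ} (hF : IsStandardStable F) {r s : ℝ}
    (h : r ^ 2 + s ^ 2 = 1) : (F.prod F).map (fun z => r * z.1 + s * z.2) = F := by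
  have := hF.prob
  rw [hF.eq_gaussianReal]
  have h1 : (fun z : ℝ × ℝ => r * z.1 + s * z.2) =
      (fun p : ℝ × ℝ => p.1 + p.2) ∘ Prod.map (fun z => r * z) fun z => s * z := rfl
  rw [h1, ← Measure.map_map (by fun_prop) (by fun_prop),
    ← Measure.map_prod_map _ _ (by fun_prop) (by fun_prop), gaussianReal_map_const_mul,
    gaussianReal_map_const_mul]
  refine Eq.trans (gaussianReal_conv_gaussianReal) ?_
  congr 1
  · simp
  · ext
    push_cast
    simpa using h

end Gaussian

/-! ### Independence and replacement of noise -/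

section Independence

variable {Ω : Type*} {mΩ : MeasurableSpace Ω} {P : Measure Ω}

/-- On the π-system of intersections `b ∩ c`, split off `c` first from `a ∩ b` and then separate `a`
from `b`. -/
theorem Indep.sup_right_of_indep_sup [IsProbabilityMeasure P] {m₁ m₂ m₃ : MeasurableSpace Ω}
    (h₁ : m₁ ≤ mΩ) (h₂ : m₂ ≤ mΩ) (h₃ : m₃ ≤ mΩ) (h12 : Indep m₁ m₂ P)
    (h : Indep m₃ (m₁ ⊔ m₂) P) : Indep m₁ (m₂ ⊔ m₃) P := by
  have gen' : m₂ ⊔ m₃ ≤ MeasurableSpace.generateFrom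
      (Set.image2 (· ∩ ·) {s | MeasurableSet[m₂] s} {s | MeasurableSet[m₃] s}) := by
    refine sup_le (fun s hs => ?_) fun s hs => ?_
    · exact MeasurableSpace.measurableSet_generateFrom
        ⟨s, hs, Set.univ, @MeasurableSet.univ _ m₃, Set.inter_univ s⟩
    · exact MeasurableSpace.measurableSet_generateFrom
        ⟨Set.univ, @MeasurableSet.univ _ m₂, s, hs, Set.univ_inter s⟩
  have gen : m₂ ⊔ m₃ = MeasurableSpace.generateFrom
      (Set.image2 (· ∩ ·) {s | MeasurableSet[m₂] s} {s | MeasurableSet[m₃] s}) :=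
    le_antisymm gen' <| MeasurableSpace.generateFrom_le <| by
      rintro _ ⟨a, ha, b, hb, rfl⟩
      exact @MeasurableSet.inter _ (m₂ ⊔ m₃) _ _ ((le_sup_left : m₂ ≤ m₂ ⊔ m₃) _ ha)
        ((le_sup_right : m₃ ≤ m₂ ⊔ m₃) _ hb)
  refine IndepSets.indep h₁ (sup_le h₂ h₃) (@MeasurableSpace.isPiSystem_measurableSet _ m₁) ?_
    (@MeasurableSpace.generateFrom_measurableSet _ m₁).symm gen ?_
  · rintro _ ⟨a, ha, b, hb, rfl⟩ _ ⟨a', ha', b', hb', rfl⟩ _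
    exact ⟨a ∩ a', @MeasurableSet.inter _ m₂ _ _ ha ha', b ∩ b', @MeasurableSet.inter _ m₃ _ _ hb hb',
      Set.inter_inter_inter_comm _ _ _ _⟩
  · rw [IndepSets_iff]
    rintro a _ ha ⟨b, hb, c, hc, rfl⟩
    rw [Indep_iff] at h h12
    have hb' : MeasurableSet[m₁ ⊔ m₂] b := (le_sup_right : m₂ ≤ m₁ ⊔ m₂) _ hb
    have ha' : MeasurableSet[m₁ ⊔ m₂] a := (le_sup_left : m₁ ≤ m₁ ⊔ m₂) _ ha
    have e1 := h c (a ∩ b) hc (@MeasurableSet.inter _ (m₁ ⊔ m₂) _ _ ha' hb')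
    have e2 := h c b hc hb'
    have e3 := h12 a b ha hb
    simp only
    rw [show a ∩ (b ∩ c) = c ∩ (a ∩ b) by ac_rfl, e1, e3, Set.inter_comm b c, e2]
    ring

/-- Under sequential independence, each `m t` is independent of all the others together. -/
theorem indep_others_of_indep_past [IsProbabilityMeasure P] {G : MeasurableSpace Ω}
    {m : ℕ → MeasurableSpace Ω} (hG : G ≤ mΩ) (hm : ∀ t, m t ≤ mΩ)
    (h : ∀ t, Indep (m t) (G ⊔ ⨆ s : {s : ℕ // s < t}, m s) P) (t : ℕ) :
    Indep (m t) (G ⊔ ⨆ s : {s : ℕ // s ≠ t}, m s) P := by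
  set K : ℕ → MeasurableSpace Ω := fun N => G ⊔ ⨆ s : {s : ℕ // s < t + N ∧ s ≠ t}, m s
  have hK : ∀ N, K N ≤ mΩ := fun N => sup_le hG (iSup_le fun s => hm _)
  have ind : ∀ N, Indep (K N) (m t) P := by
    intro N
    induction N with
    | zero =>
      refine indep_of_indep_of_le_left (h t).symm ?_
      refine sup_le_sup_left (iSup_le fun s => ?_) _
      exact le_iSup (fun s : {s : ℕ // s < t} => m s) ⟨s.1, s.2.1⟩
    | succ N ih =>
      -- For `N = 0` the new index `t + N` is the excluded index `t`, so nothing is added.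
      rcases Nat.eq_zero_or_pos N with rfl | hN
      · refine indep_of_indep_of_le_left ih (sup_le_sup_left (iSup_le fun s => ?_) _)
        exact le_iSup (fun s : {s : ℕ // s < t + 0 ∧ s ≠ t} => m s)
          ⟨s.1, by have := s.2; omega, s.2.2⟩
      · have h3 : Indep (m (t + N)) (m t ⊔ K N) P := by
          refine indep_of_indep_of_le_right (h (t + N)) ?_
          refine sup_le ?_ (sup_le_sup_left (iSup_le fun s => ?_) _)
          · exact (le_iSup (fun s : {s : ℕ // s < t + N} => m s) ⟨t, by omega⟩).trans le_sup_right
          · exact le_iSup (fun s : {s : ℕ // s < t + N} => m s) ⟨s.1, s.2.1⟩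
        refine indep_of_indep_of_le_left
          (Indep.sup_right_of_indep_sup (hm t) (hK N) (hm _) ih.symm h3).symm ?_
        refine sup_le (le_sup_left.trans le_sup_left) (iSup_le fun s => ?_)
        by_cases hs : s.1 = t + N
        · rw [hs]; exact le_sup_right
        · refine le_trans ?_ (le_sup_left.trans' le_sup_right)
          exact le_iSup (fun s : {s : ℕ // s < t + N ∧ s ≠ t} => m s)
            ⟨s.1, by have := s.2; omega, s.2.2⟩
  have hmono : Monotone K := by
    intro M N hMN
    refine sup_le_sup_left (iSup_le fun s => ?_) _
    exact le_iSup (fun s : {s : ℕ // s < t + N ∧ s ≠ t} => m s)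
      ⟨s.1, by have := s.2; omega, s.2.2⟩
  have := indep_iSup_of_directed_le ind hK (hm t) hmono.directed_le
  refine (indep_of_indep_of_le_left this ?_).symm
  refine sup_le (le_iSup_of_le 0 le_sup_left) (iSup_le fun s => ?_)
  refine le_iSup_of_le (s.1 + 1) (le_trans ?_ le_sup_right)
  exact le_iSup (fun s' : {s' : ℕ // s' < t + (s.1 + 1) ∧ s' ≠ t} => m s') ⟨s.1, by omega, s.2⟩

/-- If `V` is independent of `π` and its law is invariant under adding independent noise in the
proportions `r : s`, the noisier copy of `V` has the same joint law with `π`. -/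
theorem map_prodMk_eq_map_garbled {Ω₀ : Type*} {m₀ : MeasurableSpace Ω₀} [IsProbabilityMeasure P]
    {π : Ω → Ω₀} {V : Ω → ℝ} {F : Measure ℝ} [IsProbabilityMeasure F] (hπ : Measurable π)
    (hV : Measurable V) (hVF : P.map V = F) (hind : IndepFun π V P) {r s : ℝ}
    (hrs : (F.prod F).map (fun z => r * z.1 + s * z.2) = F) :
    P.map (fun ω => (π ω, V ω)) =
      (F.prod P).map fun p : ℝ × Ω => (π p.2, r * V p.2 + s * p.1) := by
  have : IsProbabilityMeasure (P.map π) := Measure.isProbabilityMeasure_map hπ.aemeasurable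
  have h1 : P.map (fun ω => (π ω, V ω)) = (P.map π).prod F := by
    rw [← hVF]
    exact (indepFun_iff_map_prod_eq_prod_map_map hπ.aemeasurable hV.aemeasurable).1 hind
  -- The garbled pair is built by pairing the state with its noise, reassociating so that the old
  -- and the fresh noise stand together, and mixing them. Since `(π, V)` has a product law, the
  -- mixing acts on `F.prod F` alone.
  have e : (fun p : ℝ × Ω => (π p.2, r * V p.2 + s * p.1)) =
      (Prod.map id fun z : ℝ × ℝ => r * z.1 + s * z.2) ∘
      (fun q : (Ω₀ × ℝ) × ℝ => (q.1.1, (q.1.2, q.2))) ∘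
      (Prod.map (fun ω => (π ω, V ω)) id) ∘ (Prod.swap : ℝ × Ω → Ω × ℝ) := rfl
  have hassoc : (((P.map π).prod F).prod F).map
      (fun q : (Ω₀ × ℝ) × ℝ => (q.1.1, (q.1.2, q.2))) = (P.map π).prod (F.prod F) :=
    (measurePreserving_prodAssoc (P.map π) F F).map_eq
  rw [e, ← Measure.map_map (by fun_prop) (by fun_prop),
    ← Measure.map_map (by fun_prop) (by fun_prop), ← Measure.map_map (by fun_prop) (by fun_prop),
    Measure.prod_swap, ← Measure.map_prod_map _ _ (by fun_prop) (by fun_prop), h1, Measure.map_id,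
    hassoc, ← Measure.map_prod_map _ _ (by fun_prop) (by fun_prop), hrs, Measure.map_id]

end Independence

/-! ### Measurability on a piece of the state space -/

section LocalSpace

variable {Ω : Type*}

/-- The sets whose trace on `B` is measurable. -/
@[reducible] def traceSpace (m : MeasurableSpace Ω) (B : Set Ω) (hB : MeasurableSet[m] B) :
    MeasurableSpace Ω where
  MeasurableSet' S := MeasurableSet[m] (S ∩ B)
  measurableSet_empty := by simp
  measurableSet_compl S hS := by
    have : Sᶜ ∩ B = B \ (S ∩ B) := by ext; simp; tauto
    rw [this]
    exact hB.diff hS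
  measurableSet_iUnion f hf := by
    rw [Set.iUnion_inter]
    exact MeasurableSet.iUnion hf

open Classical in
theorem measurable_piecewise_of_le_traceSpace {m m₁ m₂ : MeasurableSpace Ω} {B : Set Ω}
    (hB : MeasurableSet[m] B) (h₁ : m₁ ≤ traceSpace m B hB) (h₂ : m₂ ≤ traceSpace m Bᶜ hB.compl)
    {f g : Ω → ℝ} (hf : Measurable[m₁] f) (hg : Measurable[m₂] g) :
    Measurable[m] (B.piecewise f g) := by
  intro C hC
  rw [Set.piecewise_preimage]
  have e : B.ite (f ⁻¹' C) (g ⁻¹' C) = (f ⁻¹' C ∩ B) ∪ (g ⁻¹' C ∩ Bᶜ) := by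
    rw [Set.ite, Set.sdiff_eq]
  rw [e]
  exact MeasurableSet.union (h₁ _ (hf hC)) (h₂ _ (hg hC))

end LocalSpace

/-! ### Information generated by a plan -/

section Information

variable {Ω : Type*} {E : Economy} {U : Uncertainty Ω} {x y : Plan Ω} {t s : ℕ}
  {H : MeasurableSpace Ω}

theorem info_of_le (h : s ≤ t) : info E U x t H s = H := by
  cases s with
  | zero => rfl
  | succ s => exact if_pos (Nat.lt_of_succ_le h)

theorem info_self : info E U x t H t = H := info_of_le le_rfl

theorem info_succ (h : t ≤ s) :
    info E U x t H (s + 1) = U.learn s (info E U x t H s) (precision E x s) :=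
  if_neg (not_lt.2 h)

theorem info_le_info_succ (s : ℕ) : info E U x t H s ≤ info E U x t H (s + 1) := by
  rcases le_or_gt t s with h | h
  · rw [info_succ h]; exact le_sup_left
  · rw [info_of_le h.le, info_of_le (Nat.succ_le_of_lt h)]

theorem info_mono : Monotone (info E U x t H) := monotone_nat_of_le_succ info_le_info_succ

theorem le_info (s : ℕ) : H ≤ info E U x t H s := by
  have := info_mono (E := E) (U := U) (x := x) (t := t) (H := H) (Nat.zero_le s)
  exact this

/-- Information depends on the economy only through `hbar` and on the plan only through past `b` and
`n`. Hence changes of prices, consumption or wealth alone leave it untouched. -/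
theorem info_congr {E' : Economy} (hE : E.hbar = E'.hbar)
    (h : ∀ r, t ≤ r → r < s → x.b r = y.b r ∧ x.n r = y.n r) :
    info E U x t H s = info E' U y t H s := by
  induction s with
  | zero => rfl
  | succ s ih =>
    rcases le_or_gt t s with hs | hs
    · rw [info_succ hs, info_succ hs, ih fun r h1 h2 => h r h1 (h2.trans (Nat.lt_succ_self s))]
      obtain ⟨hb, hn⟩ := h s hs (Nat.lt_succ_self s)
      have : precision E x s = precision E' y s := by
        unfold precision; rw [hb, hn, hE]
      rw [this]
    · rw [info_of_le (Nat.succ_le_of_lt hs), info_of_le (Nat.succ_le_of_lt hs)]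

theorem info_restart {T : ℕ} (ht : t ≤ T) (hs : T ≤ s) :
    info E U x T (info E U x t H T) s = info E U x t H s := by
  induction s, hs using Nat.le_induction with
  | base => exact info_self
  | succ s hs ih => rw [info_succ hs, info_succ (ht.trans hs), ih]

theorem info_mono_left {H' : MeasurableSpace Ω} (hH : H ≤ H') (s : ℕ) :
    info E U x t H s ≤ info E U x t H' s := by
  induction s with
  | zero => exact hH
  | succ s ih =>
    rcases le_or_gt t s with hs | hs
    · rw [info_succ hs, info_succ hs]; exact sup_le_sup_right ih _
    · rwa [info_of_le (Nat.succ_le_of_lt hs), info_of_le (Nat.succ_le_of_lt hs)]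

theorem Uncertainty.signal_congr {η η' : Ω → ℝ} {ω : Ω} (h : η ω = η' ω) :
    U.signal s η ω = U.signal s η' ω := by
  by_cases h' : η' ω = 0
  · simp [Uncertainty.signal, h, h']
  · simp [Uncertainty.signal, h, h']

theorem Uncertainty.measurable_signal {m : MeasurableSpace Ω} {η : Ω → ℝ}
    (hψ : Measurable U.ψ) (hA : Measurable[m] U.A) (hV : Measurable[m] (U.V s))
    (hη : Measurable[m] η) : Measurable[m] (U.signal s η) := by
  unfold Uncertainty.signal
  refine Measurable.ite ?_ hV ?_
  · exact hη (measurableSet_singleton 0)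
  · exact (hψ.comp hA).add ((measurable_const.div hη).mul hV)

theorem Uncertainty.learn_le {m : MeasurableSpace Ω} {η : Ω → ℝ}
    (hψ : Measurable U.ψ) (hA : Measurable[m] U.A) (hV : Measurable[m] (U.V s))
    (hη : Measurable[m] η) (hH : H ≤ m) : U.learn s H η ≤ m :=
  sup_le hH (U.measurable_signal hψ hA hV hη).comap_le

theorem measurable_precision (hE : Measurable fun q : ℝ × ℝ => E.hbar q.1 q.2)
    {m : MeasurableSpace Ω} (hb : Measurable[m] (x.b s)) (hn : Measurable[m] (x.n s)) :
    Measurable[m] (precision E x s) :=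
  hE.comp (hb.prodMk hn)

theorem info_le (hE : Measurable fun q : ℝ × ℝ => E.hbar q.1 q.2)
    (hb : ∀ s, t ≤ s → Measurable[info E U x t H s] (x.b s))
    (hn : ∀ s, t ≤ s → Measurable[info E U x t H s] (x.n s))
    {m : MeasurableSpace Ω} (hψ : Measurable U.ψ) (hA : Measurable[m] U.A)
    (hV : ∀ r, t ≤ r → r < s → Measurable[m] (U.V r)) (hH : H ≤ m) : info E U x t H s ≤ m := by
  induction s with
  | zero => exact hH
  | succ s ih =>
    rcases le_or_gt t s with hs | hs
    · have ih' := ih fun r h1 h2 => hV r h1 (h2.trans (Nat.lt_succ_self s))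
      rw [info_succ hs]
      exact U.learn_le hψ hA (hV s hs (Nat.lt_succ_self s))
        (measurable_precision hE ((hb s hs).mono ih' le_rfl) ((hn s hs).mono ih' le_rfl)) ih'
    · rwa [info_of_le (Nat.succ_le_of_lt hs)]

/-- Plans that agree on a known event receive the same signals there. Off the event the signals may
differ, so only traces on `B` can be compared. -/
theorem info_le_traceSpace {B : Set Ω} (hB : MeasurableSet[H] B)
    (hb : ∀ r, t ≤ r → ∀ ω ∈ B, x.b r ω = y.b r ω) (hn : ∀ r, t ≤ r → ∀ ω ∈ B, x.n r ω = y.n r ω)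
    (s : ℕ) : info E U x t H s ≤ traceSpace (info E U y t H s) B (le_info s _ hB) := by
  induction s with
  | zero => exact fun S hS => @MeasurableSet.inter _ H _ _ hS hB
  | succ s ih =>
    rcases le_or_gt t s with hs | hs
    · rw [info_succ hs]
      refine sup_le (fun S hS => info_le_info_succ s _ (ih S hS)) ?_
      rintro _ ⟨C, hC, rfl⟩
      have e : U.signal s (precision E x s) ⁻¹' C ∩ B =
          U.signal s (precision E y s) ⁻¹' C ∩ B := by
        ext ω
        simp only [Set.mem_inter_iff, Set.mem_preimage, and_congr_left_iff]
        intro hω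
        rw [U.signal_congr (η' := precision E y s)]
        simp only [precision, hb s hs ω hω, hn s hs ω hω]
      change MeasurableSet[info E U y t H (s + 1)] _
      rw [e]
      refine @MeasurableSet.inter _ (info E U y t H (s + 1)) _ _ ?_ (le_info _ _ hB)
      rw [info_succ hs]
      exact (le_sup_right : _ ≤ U.learn s (info E U y t H s) (precision E y s)) _ ⟨C, hC, rfl⟩
    · intro S hS
      rw [info_of_le (Nat.succ_le_of_lt hs)] at hS
      exact le_info _ _ (@MeasurableSet.inter _ H _ _ hS hB)

end Information

/-! ### Pasting, concatenating and restarting plans -/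

section Plans

variable {Ω : Type*}

/-- The measurability requirements on a feasible plan. -/
structure AdaptedPlan (E : Economy) (U : Uncertainty Ω) (t : ℕ) (a₀ : Ω → ℝ) (H : MeasurableSpace Ω)
    (x : Plan Ω) : Prop where
  start : x.a t = a₀
  o : ∀ s, t ≤ s → Measurable[info E U x t H s] (x.o s)
  b : ∀ s, t ≤ s → Measurable[info E U x t H s] (x.b s)
  n : ∀ s, t ≤ s → Measurable[info E U x t H s] (x.n s)
  c : ∀ s, t ≤ s → Measurable[info E U x t H s] (x.c s)
  a : ∀ s, t ≤ s → Measurable[info E U x t H s] (x.a (s + 1))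

/-- The nonnegativity, borrowing and budget constraints of period `s` in the state `ω`. -/
structure Admissible (E : Economy) (x : Plan Ω) (s : ℕ) (ω : Ω) : Prop where
  o : 0 ≤ x.o s ω
  b : 0 ≤ x.b s ω
  n : 0 ≤ x.n s ω
  c : 0 ≤ x.c s ω
  borrowing : E.alow (s + 1) ≤ x.a (s + 1) ω
  budget : E.po s * x.o s ω + E.pb s * x.b s ω + E.pn s * x.n s ω + x.c s ω + x.a (s + 1) ω
      ≤ (1 + E.i s) * x.a s ω + E.w s

variable {E : Economy} {U : Uncertainty Ω} {mΩ : MeasurableSpace Ω} {P : Measure Ω} {t T : ℕ}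
  {a₀ : Ω → ℝ} {H : MeasurableSpace Ω} {x y z : Plan Ω}

theorem feasible_iff : Feasible E U P t a₀ H x ↔
    AdaptedPlan E U t a₀ H x ∧ ∀ s, t ≤ s → ∀ᵐ ω ∂P, Admissible E x s ω := by
  constructor
  · rintro ⟨h1, h2, h3, h4, h5, h6, h7, h8, h9⟩
    refine ⟨⟨h1, h2, h3, h4, h5, h6⟩, fun s hs => ?_⟩
    filter_upwards [h7 s hs, h8 s hs, h9 s hs] with ω k1 k2 k3
    exact ⟨k1.1, k1.2.1, k1.2.2.1, k1.2.2.2, k2, k3⟩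
  · rintro ⟨⟨h1, h2, h3, h4, h5, h6⟩, h⟩
    exact ⟨h1, h2, h3, h4, h5, h6, fun s hs => (h s hs).mono fun ω k => ⟨k.1, k.2, k.3, k.4⟩,
      fun s hs => (h s hs).mono fun ω k => k.5, fun s hs => (h s hs).mono fun ω k => k.6⟩

theorem Feasible.adapted (h : Feasible E U P t a₀ H x) : AdaptedPlan E U t a₀ H x :=
  (feasible_iff.1 h).1

theorem Feasible.admissible (h : Feasible E U P t a₀ H x) {s : ℕ} (hs : t ≤ s) :
    ∀ᵐ ω ∂P, Admissible E x s ω :=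
  (feasible_iff.1 h).2 s hs

theorem AdaptedPlan.info_le (h : AdaptedPlan E U t a₀ H x) {s : ℕ}
    (hE : Measurable fun q : ℝ × ℝ => E.hbar q.1 q.2)
    {m : MeasurableSpace Ω} (hψ : Measurable U.ψ) (hA : Measurable[m] U.A)
    (hV : ∀ r, t ≤ r → r < s → Measurable[m] (U.V r)) (hH : H ≤ m) : info E U x t H s ≤ m :=
  _root_.info_le hE h.b h.n hψ hA hV hH

theorem AdaptedPlan.mono_left {H' : MeasurableSpace Ω} (h : AdaptedPlan E U t a₀ H x)
    (hH : H ≤ H') :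
    AdaptedPlan E U t a₀ H' x where
  start := h.start
  o s hs := (h.o s hs).mono (info_mono_left hH s) le_rfl
  b s hs := (h.b s hs).mono (info_mono_left hH s) le_rfl
  n s hs := (h.n s hs).mono (info_mono_left hH s) le_rfl
  c s hs := (h.c s hs).mono (info_mono_left hH s) le_rfl
  a s hs := (h.a s hs).mono (info_mono_left hH s) le_rfl

/-- A feasible plan remains feasible when restarted in a later period. -/
theorem AdaptedPlan.tail (h : AdaptedPlan E U t a₀ H x) (hT : t ≤ T) :
    AdaptedPlan E U T (x.a T) (info E U x t H T) x where
  start := rfl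
  o s hs := by rw [info_restart hT hs]; exact h.o s (hT.trans hs)
  b s hs := by rw [info_restart hT hs]; exact h.b s (hT.trans hs)
  n s hs := by rw [info_restart hT hs]; exact h.n s (hT.trans hs)
  c s hs := by rw [info_restart hT hs]; exact h.c s (hT.trans hs)
  a s hs := by rw [info_restart hT hs]; exact h.a s (hT.trans hs)

theorem Feasible.tail (h : Feasible E U P t a₀ H x) (hT : t ≤ T) :
    Feasible E U P T (x.a T) (info E U x t H T) x :=
  feasible_iff.2 ⟨h.adapted.tail hT, fun _ hs => h.admissible (hT.trans hs)⟩

theorem Feasible.mono_left {H' : MeasurableSpace Ω} (h : Feasible E U P t a₀ H x) (hH : H ≤ H') :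
    Feasible E U P t a₀ H' x :=
  feasible_iff.2 ⟨h.adapted.mono_left hH, fun _ hs => h.admissible hs⟩

open Classical in
/-- Follow `y` on `B` and `x` elsewhere. -/
def Plan.piecewise (B : Set Ω) (y x : Plan Ω) : Plan Ω where
  o s := B.piecewise (y.o s) (x.o s)
  b s := B.piecewise (y.b s) (x.b s)
  n s := B.piecewise (y.n s) (x.n s)
  c s := B.piecewise (y.c s) (x.c s)
  a s := B.piecewise (y.a s) (x.a s)

/-- Follow `x` before period `T` and `z` from then on. -/
def Plan.concat (T : ℕ) (x z : Plan Ω) : Plan Ω where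
  o s := if s < T then x.o s else z.o s
  b s := if s < T then x.b s else z.b s
  n s := if s < T then x.n s else z.n s
  c s := if s < T then x.c s else z.c s
  a s := if s < T then x.a s else z.a s

/-- On `B` the pasted plan generates at least the information of `y`, and on the complement at least
that of `x`. Each branch is therefore adapted on its own piece. -/
theorem AdaptedPlan.piecewise (hy : AdaptedPlan E U t a₀ H y) (hx : AdaptedPlan E U t a₀ H x)
    {B : Set Ω} (hB : MeasurableSet[H] B) : AdaptedPlan E U t a₀ H (Plan.piecewise B y x) := by
  classical
  have h1 : ∀ s, info E U y t H s ≤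
      traceSpace (info E U (Plan.piecewise B y x) t H s) B (le_info s _ hB) :=
    info_le_traceSpace hB (fun r _ ω hω => by simp [Plan.piecewise, hω])
      fun r _ ω hω => by simp [Plan.piecewise, hω]
  have h2 : ∀ s, info E U x t H s ≤
      traceSpace (info E U (Plan.piecewise B y x) t H s) Bᶜ (le_info s _ hB.compl) :=
    info_le_traceSpace hB.compl (fun r _ ω hω => by
      have : ω ∉ B := hω
      simp [Plan.piecewise, this])
      fun r _ ω hω => by
      have : ω ∉ B := hω
      simp [Plan.piecewise, this]
  refine ⟨?_, fun s hs => ?_, fun s hs => ?_, fun s hs => ?_, fun s hs => ?_, fun s hs => ?_⟩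
  · simp [Plan.piecewise, hy.start, hx.start]
  · exact measurable_piecewise_of_le_traceSpace _ (h1 s) (h2 s) (hy.o s hs) (hx.o s hs)
  · exact measurable_piecewise_of_le_traceSpace _ (h1 s) (h2 s) (hy.b s hs) (hx.b s hs)
  · exact measurable_piecewise_of_le_traceSpace _ (h1 s) (h2 s) (hy.n s hs) (hx.n s hs)
  · exact measurable_piecewise_of_le_traceSpace _ (h1 s) (h2 s) (hy.c s hs) (hx.c s hs)
  · exact measurable_piecewise_of_le_traceSpace _ (h1 s) (h2 s) (hy.a s hs) (hx.a s hs)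

theorem Feasible.piecewise (hy : Feasible E U P t a₀ H y) (hx : Feasible E U P t a₀ H x)
    {B : Set Ω} (hB : MeasurableSet[H] B) : Feasible E U P t a₀ H (Plan.piecewise B y x) := by
  refine feasible_iff.2 ⟨hy.adapted.piecewise hx.adapted hB, fun s hs => ?_⟩
  filter_upwards [hy.admissible hs, hx.admissible hs] with ω h1 h2
  by_cases hω : ω ∈ B
  · constructor <;> simp only [Plan.piecewise, hω, Set.piecewise_eq_of_mem]
    exacts [h1.1, h1.2, h1.3, h1.4, h1.5, h1.6]
  · constructor <;> simp only [Plan.piecewise, hω, not_false_eq_true, Set.piecewise_eq_of_notMem]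
    exacts [h2.1, h2.2, h2.3, h2.4, h2.5, h2.6]

theorem info_concat_left {s : ℕ} (hs : s ≤ T) :
    info E U (Plan.concat T x z) t H s = info E U x t H s :=
  info_congr rfl fun r _ hr => by simp [Plan.concat, hr.trans_le hs]

theorem info_concat_right {s : ℕ} (hT : t ≤ T) (hs : T ≤ s) :
    info E U (Plan.concat T x z) t H s = info E U z T (info E U x t H T) s := by
  rw [← info_restart hT hs, info_concat_left le_rfl]
  exact info_congr rfl fun r hr _ => by simp [Plan.concat, not_lt.2 hr]

theorem Plan.concat_a_of_le (h : z.a T = x.a T) {s : ℕ} (hs : s ≤ T) :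
    (Plan.concat T x z).a s = x.a s := by
  rcases hs.lt_or_eq with h' | rfl
  · simp [Plan.concat, h']
  · simp [Plan.concat, h]

theorem AdaptedPlan.concat (hx : AdaptedPlan E U t a₀ H x)
    (hz : AdaptedPlan E U T (x.a T) (info E U x t H T) z) (hT : t ≤ T) :
    AdaptedPlan E U t a₀ H (Plan.concat T x z) := by
  have key : ∀ (f g : Ω → ℝ) (s : ℕ), t ≤ s → (s < T → Measurable[info E U x t H s] f) →
      (T ≤ s → Measurable[info E U z T (info E U x t H T) s] g) →
      Measurable[info E U (Plan.concat T x z) t H s] (if s < T then f else g) := by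
    intro f g s hs hf hg
    split_ifs with h
    · rw [info_concat_left h.le]; exact hf h
    · rw [info_concat_right hT (not_lt.1 h)]; exact hg (not_lt.1 h)
  refine ⟨?_, fun s hs => ?_, fun s hs => ?_, fun s hs => ?_, fun s hs => ?_, fun s hs => ?_⟩
  · rw [Plan.concat_a_of_le hz.start hT, hx.start]
  · exact key _ _ s hs (fun _ => hx.o s hs) fun h => hz.o s h
  · exact key _ _ s hs (fun _ => hx.b s hs) fun h => hz.b s h
  · exact key _ _ s hs (fun _ => hx.n s hs) fun h => hz.n s h
  · exact key _ _ s hs (fun _ => hx.c s hs) fun h => hz.c s h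
  · rcases lt_or_ge s T with h | h
    · rw [info_concat_left h.le, Plan.concat_a_of_le hz.start h]
      exact hx.a s hs
    · rw [info_concat_right hT h]
      simpa [Plan.concat, not_lt.2 (h.trans (Nat.le_succ s))] using hz.a s h

theorem Feasible.concat (hx : AdaptedPlan E U t a₀ H x)
    (hx' : ∀ s, t ≤ s → s < T → ∀ᵐ ω ∂P, Admissible E x s ω)
    (hz : Feasible E U P T (x.a T) (info E U x t H T) z) (hT : t ≤ T) :
    Feasible E U P t a₀ H (Plan.concat T x z) := by
  refine feasible_iff.2 ⟨hx.concat hz.adapted hT, fun s hs => ?_⟩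
  rcases lt_or_ge s T with h | h
  · filter_upwards [hx' s hs h] with ω k
    constructor <;> try simp only [Plan.concat_a_of_le hz.start h, Plan.concat_a_of_le hz.start h.le]
    all_goals try simp only [Plan.concat, h, if_true]
    exacts [k.1, k.2, k.3, k.4, k.5, k.6]
  · filter_upwards [hz.admissible h] with ω k
    have h' := not_lt.2 (h.trans (Nat.le_succ s))
    constructor <;> simp only [Plan.concat, not_lt.2 h, h', if_false]
    exacts [k.1, k.2, k.3, k.4, k.5, k.6]

theorem utility_piecewise_of_mem {B : Set Ω} {ω : Ω} (hω : ω ∈ B) (s : ℕ) :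
    utility E U (Plan.piecewise B y x) s ω = utility E U y s ω := by
  simp [utility, transport, Plan.piecewise, hω]

theorem utility_piecewise_of_notMem {B : Set Ω} {ω : Ω} (hω : ω ∉ B) (s : ℕ) :
    utility E U (Plan.piecewise B y x) s ω = utility E U x s ω := by
  simp [utility, transport, Plan.piecewise, hω]

theorem utility_concat_of_lt {s : ℕ} (h : s < T) :
    utility E U (Plan.concat T x z) s = utility E U x s := by
  ext; simp [utility, transport, Plan.concat, h]

theorem utility_concat_of_le {s : ℕ} (h : T ≤ s) :
    utility E U (Plan.concat T x z) s = utility E U z s := by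
  ext; simp [utility, transport, Plan.concat, not_lt.2 h]

theorem lifetime_concat : lifetime E U (Plan.concat T x z) T = lifetime E U z T := by
  ext; simp [lifetime, utility_concat_of_le]

open Classical in
theorem lifetime_piecewise (B : Set Ω) :
    lifetime E U (Plan.piecewise B y x) t = B.piecewise (lifetime E U y t) (lifetime E U x t) := by
  ext ω
  by_cases hω : ω ∈ B
  · simp [lifetime, utility_piecewise_of_mem hω, hω]
  · simp [lifetime, utility_piecewise_of_notMem hω, hω]

theorem finiteUtility_congr (h : ∀ s, t ≤ s → utility E U x s = utility E U y s) :
    FiniteUtility E U P t x ↔ FiniteUtility E U P t y := by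
  have h1 : (∀ s, t ≤ s → Integrable (utility E U x s) P) ↔
      ∀ s, t ≤ s → Integrable (utility E U y s) P :=
    forall₂_congr fun s hs => by rw [h s hs]
  have h2 : (fun k => E.β ^ k * ∫ ω, |utility E U x (t + k) ω| ∂P) =
      fun k => E.β ^ k * ∫ ω, |utility E U y (t + k) ω| ∂P := by
    ext k; rw [h _ (Nat.le_add_right t k)]
  unfold FiniteUtility
  rw [h1, h2]

theorem finiteUtility_iff_tail (hβ : E.β ≠ 0) (hT : t ≤ T) :
    FiniteUtility E U P t x ↔
      (∀ s, t ≤ s → s < T → Integrable (utility E U x s) P) ∧ FiniteUtility E U P T x := by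
  obtain ⟨N, rfl⟩ := Nat.exists_eq_add_of_le hT
  have e : (Summable fun k => E.β ^ k * ∫ ω, |utility E U x (t + k) ω| ∂P) ↔
      Summable fun k => E.β ^ k * ∫ ω, |utility E U x (t + N + k) ω| ∂P := by
    rw [← summable_nat_add_iff N]
    have : (fun k => E.β ^ (k + N) * ∫ ω, |utility E U x (t + (k + N)) ω| ∂P) =
        fun k => E.β ^ N * (E.β ^ k * ∫ ω, |utility E U x (t + N + k) ω| ∂P) := by
      ext k
      rw [show t + (k + N) = t + N + k by omega, pow_add]
      ring
    rw [this, summable_mul_left_iff (pow_ne_zero N hβ)]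
  unfold FiniteUtility
  rw [e]
  constructor
  · rintro ⟨h1, h2⟩
    exact ⟨fun s hs _ => h1 s hs, fun s hs => h1 s (hT.trans hs), h2⟩
  · rintro ⟨h1, h2, h3⟩
    exact ⟨fun s hs => (lt_or_ge s (t + N)).elim (h1 s hs) (h2 s), h3⟩

theorem FiniteUtility.tail (hβ : E.β ≠ 0) (h : FiniteUtility E U P t x) (hT : t ≤ T) :
    FiniteUtility E U P T x :=
  ((finiteUtility_iff_tail hβ hT).1 h).2

theorem FiniteUtility.concat (hβ : E.β ≠ 0) (hT : t ≤ T)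
    (hx : ∀ s, t ≤ s → s < T → Integrable (utility E U x s) P) (hz : FiniteUtility E U P T z) :
    FiniteUtility E U P t (Plan.concat T x z) := by
  rw [finiteUtility_iff_tail hβ hT, finiteUtility_congr (y := z) fun s hs => utility_concat_of_le hs]
  exact ⟨fun s h1 h2 => by rw [utility_concat_of_lt h2]; exact hx s h1 h2, hz⟩

theorem FiniteUtility.ae_summable (hβ : 0 ≤ E.β) (h : FiniteUtility E U P t x) :
    (∀ᵐ ω ∂P, Summable fun k => E.β ^ k * utility E U x (t + k) ω) ∧
      Integrable (lifetime E U x t) P := by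
  have h1 : ∀ k, Integrable (fun ω => E.β ^ k * utility E U x (t + k) ω) P :=
    fun k => (h.1 _ (Nat.le_add_right t k)).const_mul _
  have h2 : Summable fun k => ∫ ω, |E.β ^ k * utility E U x (t + k) ω| ∂P := by
    refine h.2.congr fun k => ?_
    simp_rw [abs_mul, abs_of_nonneg (pow_nonneg hβ k)]
    rw [integral_const_mul]
  obtain ⟨h3, h4⟩ := ae_summable_of_summable_integral_abs h1 h2
  exact ⟨h3.mono fun ω hω => summable_abs_iff.1 hω, h4⟩

theorem FiniteUtility.integrable (hβ : 0 ≤ E.β) (h : FiniteUtility E U P t x) :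
    Integrable (lifetime E U x t) P :=
  (h.ae_summable hβ).2

theorem FiniteUtility.lifetime_eq (hβ : 0 ≤ E.β) (h : FiniteUtility E U P t x) (N : ℕ) :
    ∀ᵐ ω ∂P, lifetime E U x t ω =
      ∑ k ∈ Finset.range N, E.β ^ k * utility E U x (t + k) ω
        + E.β ^ N * lifetime E U x (t + N) ω := by
  filter_upwards [(h.ae_summable hβ).1] with ω hω
  unfold lifetime
  rw [← hω.sum_add_tsum_nat_add N, ← tsum_mul_left]
  congr 2
  ext k
  rw [show t + (k + N) = t + N + k by omega, pow_add]
  ring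

open Classical in
theorem FiniteUtility.piecewise {B : Set Ω} (hβ : 0 ≤ E.β) (hB : MeasurableSet[mΩ] B)
    (hy : FiniteUtility E U P t y) (hx : FiniteUtility E U P t x) :
    FiniteUtility E U P t (Plan.piecewise B y x) := by
  have e : ∀ s, utility E U (Plan.piecewise B y x) s =
      B.piecewise (utility E U y s) (utility E U x s) := by
    intro s; ext ω
    by_cases hω : ω ∈ B
    · simp [utility_piecewise_of_mem hω, hω]
    · simp [utility_piecewise_of_notMem hω, hω]
  have hi : ∀ s, t ≤ s → Integrable (utility E U (Plan.piecewise B y x) s) P := fun s hs => by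
    rw [e]
    exact Integrable.piecewise hB (hy.1 s hs).integrableOn (hx.1 s hs).integrableOn
  refine ⟨hi, (hy.2.add hx.2).of_nonneg_of_le (fun k => ?_) fun k => ?_⟩
  · exact mul_nonneg (pow_nonneg hβ k) (integral_nonneg fun ω => abs_nonneg _)
  · rw [← mul_add]
    refine mul_le_mul_of_nonneg_left ?_ (pow_nonneg hβ k)
    have hyk := (hy.1 (t + k) (Nat.le_add_right t k)).abs
    have hxk := (hx.1 (t + k) (Nat.le_add_right t k)).abs
    rw [← integral_add hyk hxk]
    refine integral_mono (hi _ (Nat.le_add_right t k)).abs (hyk.add hxk) fun ω => ?_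
    by_cases hω : ω ∈ B
    · simp only [utility_piecewise_of_mem hω]
      exact le_add_of_nonneg_right (abs_nonneg _)
    · simp only [utility_piecewise_of_notMem hω]
      exact le_add_of_nonneg_left (abs_nonneg _)

/-- No plan does better than `x` from period `t` on. -/
structure Best (E : Economy) (U : Uncertainty Ω) {mΩ : MeasurableSpace Ω} (P : Measure Ω)
    (t : ℕ) (a₀ : Ω → ℝ) (H : MeasurableSpace Ω) (x : Plan Ω) : Prop where
  feasible : Feasible E U P t a₀ H x
  finite : FiniteUtility E U P t x
  le : ∀ y, Feasible E U P t a₀ H y → FiniteUtility E U P t y →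
    P[lifetime E U y t | H] ≤ᵐ[P] P[lifetime E U x t | H]

/-- A best plan is itself the largest attainable utility, so the essential supremum exists and the
default branch of `value` is not used. `Best` avoids `value` altogether. -/
theorem optimal_iff_best : Optimal E U P t a₀ H x ↔ Best E U P t a₀ H x := by
  constructor
  · rintro ⟨h1, h2, h3, h4⟩
    exact ⟨h1, h2, fun y hy hy' => (h3.2.1 _ ⟨y, hy, hy', rfl⟩).trans h4.symm.le⟩
  · rintro ⟨h1, h2, h3⟩
    have hs : IsEssentialSup P H (attainable E U P t a₀ H) (P[lifetime E U x t | H]) := by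
      refine ⟨stronglyMeasurable_condExp.measurable, ?_, fun w _ hw => hw _ ⟨x, h1, h2, rfl⟩⟩
      rintro _ ⟨y, hy, hy', rfl⟩
      exact h3 y hy hy'
    have hex : ∃ v, IsEssentialSup P H (attainable E U P t a₀ H) v := ⟨_, hs⟩
    have hv : IsEssentialSup P H (attainable E U P t a₀ H) (value E U P t a₀ H) := by
      rw [value, dif_pos hex]; exact hex.choose_spec
    exact ⟨h1, h2, hv, hs.ae_eq hv⟩

/-- The remainder of an optimal plan is optimal. -/
theorem Best.tail [IsProbabilityMeasure P] (hβ : 0 < E.β) (h : Best E U P t a₀ H x) (hT : t ≤ T)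
    (hH : H ≤ mΩ) (hm : info E U x t H T ≤ mΩ) :
    Best E U P T (x.a T) (info E U x t H T) x := by
  classical
  refine ⟨h.feasible.tail hT, h.finite.tail hβ.ne' hT, fun y hy hy' => ?_⟩
  have hxT := h.finite.tail hβ.ne' hT
  have hyi := hy'.integrable hβ.le
  have hxi := hxT.integrable hβ.le
  refine ae_le_of_setIntegral_le_of_measurable hm stronglyMeasurable_condExp.measurable
    stronglyMeasurable_condExp.measurable integrable_condExp integrable_condExp fun B hB => ?_
  rw [setIntegral_condExp hm hyi hB, setIntegral_condExp hm hxi hB]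
  -- Dynamic consistency: follow `x` until `T`, and then `y` exactly on `B`. Comparing this plan
  -- with `x` in expectation, the contributions before `T` and outside `B` cancel.
  set z := Plan.piecewise B y x
  have hz : Feasible E U P T (x.a T) (info E U x t H T) z := hy.piecewise (h.feasible.tail hT) hB
  have hz' : FiniteUtility E U P T z := hy'.piecewise hβ.le (hm _ hB) hxT
  have hc := Feasible.concat h.feasible.adapted (fun s hs _ => h.feasible.admissible hs) hz hT
  have hc' : FiniteUtility E U P t (Plan.concat T x z) :=
    FiniteUtility.concat hβ.ne' hT (fun s hs _ => h.finite.1 s hs) hz'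
  have hle := integral_mono_ae integrable_condExp integrable_condExp (h.le _ hc hc')
  rw [integral_condExp hH, integral_condExp hH] at hle
  obtain ⟨N, rfl⟩ := Nat.exists_eq_add_of_le hT
  have e1 := hc'.lifetime_eq hβ.le N
  have e2 := h.finite.lifetime_eq hβ.le N
  have e3 : ∀ k ∈ Finset.range N, utility E U (Plan.concat (t + N) x z) (t + k) =
      utility E U x (t + k) := fun k hk =>
    utility_concat_of_lt (Nat.add_lt_add_left (Finset.mem_range.1 hk) t)
  have hsum : Integrable (fun ω => ∑ k ∈ Finset.range N, E.β ^ k * utility E U x (t + k) ω) P :=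
    integrable_finsetSum _ fun k _ => (h.finite.1 _ (Nat.le_add_right t k)).const_mul _
  have e1' : ∀ᵐ ω ∂P, lifetime E U (Plan.concat (t + N) x z) t ω =
      ∑ k ∈ Finset.range N, E.β ^ k * utility E U x (t + k) ω
        + E.β ^ N * lifetime E U z (t + N) ω := by
    filter_upwards [e1] with ω hω
    rw [hω, lifetime_concat, Finset.sum_congr rfl fun k hk => by rw [e3 k hk]]
  have hzi := hz'.integrable hβ.le
  rw [integral_congr_ae e1', integral_congr_ae e2, integral_add hsum (hzi.const_mul _),
    integral_add hsum (hxi.const_mul _), integral_const_mul, integral_const_mul] at hle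
  have hle' := le_of_mul_le_mul_left (le_of_add_le_add_left hle) (pow_pos hβ N)
  rw [← integral_add_compl (hm _ hB) hzi, ← integral_add_compl (hm _ hB) hxi] at hle'
  have f1 : ∫ ω in B, lifetime E U z (t + N) ω ∂P = ∫ ω in B, lifetime E U y (t + N) ω ∂P :=
    setIntegral_congr_fun (hm _ hB) fun ω hω => by
      rw [lifetime_piecewise, Set.piecewise_eq_of_mem _ _ _ hω]
  have f2 : ∫ ω in Bᶜ, lifetime E U z (t + N) ω ∂P = ∫ ω in Bᶜ, lifetime E U x (t + N) ω ∂P :=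
    setIntegral_congr_fun (hm _ hB).compl fun ω hω => by
      rw [lifetime_piecewise, Set.piecewise_eq_of_notMem _ _ _ hω]
  rw [f1, f2] at hle'
  exact le_of_add_le_add_right hle'

/-- The attainable conditional utilities are directed. -/
theorem attainable_directed [IsProbabilityMeasure P] (hβ : 0 ≤ E.β) (hH : H ≤ mΩ) :
    ∀ f ∈ attainable E U P t a₀ H, ∀ g ∈ attainable E U P t a₀ H,
      ∃ k ∈ attainable E U P t a₀ H, f ≤ᵐ[P] k ∧ g ≤ᵐ[P] k := by
  classical
  rintro _ ⟨y, hy, hy', rfl⟩ _ ⟨x, hx, hx', rfl⟩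
  set f := P[lifetime E U y t | H]
  set g := P[lifetime E U x t | H]
  have hf : StronglyMeasurable[H] f := stronglyMeasurable_condExp
  have hg : StronglyMeasurable[H] g := stronglyMeasurable_condExp
  -- The better of the two plans is known at the start; following `y` here and `x` elsewhere attains
  -- the pointwise maximum.
  set B : Set Ω := {ω | g ω ≤ f ω}
  have hB : MeasurableSet[H] B := hg.measurableSet_le hf
  refine ⟨_, ⟨Plan.piecewise B y x, hy.piecewise hx hB, hy'.piecewise hβ (hH _ hB) hx', rfl⟩, ?_⟩
  have e : lifetime E U (Plan.piecewise B y x) t =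
      B.indicator (lifetime E U y t) + Bᶜ.indicator (lifetime E U x t) := by
    ext ω
    by_cases hω : ω ∈ B <;> simp [lifetime_piecewise, hω]
  have hyi := hy'.integrable hβ
  have hxi := hx'.integrable hβ
  have e1 := condExp_add (hyi.indicator (hH _ hB)) (hxi.indicator (hH _ hB).compl) H
  rw [← e] at e1
  have e2 := condExp_indicator hyi hB
  have e3 := condExp_indicator hxi hB.compl
  have key : ∀ᵐ ω ∂P, (P[lifetime E U (Plan.piecewise B y x) t | H]) ω = max (f ω) (g ω) := by
    filter_upwards [e1, e2, e3] with ω h1 h2 h3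
    rw [h1, Pi.add_apply, h2, h3]
    by_cases hω : ω ∈ B
    · have : g ω ≤ f ω := hω
      simp [hω, f, max_eq_left this]
    · have : f ω ≤ g ω := (not_le.1 hω).le
      simp [hω, g, max_eq_right this]
  constructor
  · filter_upwards [key] with ω h; rw [h]; exact le_max_left _ _
  · filter_upwards [key] with ω h; rw [h]; exact le_max_right _ _

end Plans

/-! ### Interest, debt limits and bounded discounted consumption -/

/-- The assumptions on the deterministic primitives. -/
structure Economy.Regular (E : Economy) : Prop where
  standing : E.Standing
  w_bdd : ∃ C, ∀ t, |E.w t| ≤ C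
  target_bdd : ∃ C, ∀ t, |E.target t| ≤ C
  discount : ∀ t, E.β * (1 + E.i t) ≤ 1
  debt : E.DebtLimits

namespace Economy

/-- The compound interest factor from period `t` to period `t + k`. -/
def compound (E : Economy) (t k : ℕ) : ℝ := ∏ r ∈ Finset.range k, (1 + E.i (t + r))

variable {E : Economy}

theorem Standing.compound_pos (hE : E.Standing) (t k : ℕ) : 0 < E.compound t k :=
  Finset.prod_pos fun _ _ => hE.gross_interest_pos _

theorem compound_succ (t k : ℕ) :
    E.compound t (k + 1) = E.compound t k * (1 + E.i (t + k)) := Finset.prod_range_succ _ _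

theorem compound_add (t N k : ℕ) :
    E.compound t (N + k) = E.compound t N * E.compound (t + N) k := by
  unfold compound
  rw [Finset.prod_range_add]
  simp [add_assoc]

theorem discountedIncome_eq (t k : ℕ) :
    E.discountedIncome t k = E.w (t + k) / E.compound t (k + 1) := rfl

theorem discountedIncome_add (t N k : ℕ) :
    E.discountedIncome t (k + N) = (E.compound t N)⁻¹ * E.discountedIncome (t + N) k := by
  rw [discountedIncome_eq, discountedIncome_eq, show k + N + 1 = N + (k + 1) by omega,
    compound_add, show t + (k + N) = t + N + k by omega, div_mul_eq_div_div_swap, inv_mul_eq_div]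

theorem Standing.summable_discountedIncome (hE : E.Standing)
    (h : Summable (E.discountedIncome 0)) (t : ℕ) : Summable (E.discountedIncome t) := by
  have h1 := (summable_nat_add_iff t).2 h
  simp_rw [discountedIncome_add] at h1
  rw [summable_mul_left_iff (inv_ne_zero (hE.compound_pos 0 t).ne'), Nat.zero_add] at h1
  exact h1

theorem Regular.pow_mul_compound_le_one (hE : E.Regular) (t k : ℕ) :
    E.β ^ k * E.compound t k ≤ 1 := by
  have hβ := hE.standing.β_pos
  induction k with
  | zero => simp [compound]
  | succ k ih =>
    rw [compound_succ, pow_succ]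
    calc E.β ^ k * E.β * (E.compound t k * (1 + E.i (t + k)))
        = (E.β ^ k * E.compound t k) * (E.β * (1 + E.i (t + k))) := by ring
      _ ≤ 1 * 1 := mul_le_mul ih (hE.discount _)
          (mul_nonneg hβ.le (hE.standing.gross_interest_pos _).le) zero_le_one
      _ = 1 := one_mul 1

/-- Discounted consumption along any path that respects budgets and borrowing limits is bounded. -/
theorem Regular.exists_sum_consumption_le (hE : E.Regular) (t : ℕ) (C₀ : ℝ) :
    ∃ C, ∀ a c : ℕ → ℝ, |a 0| ≤ C₀ → (∀ k, 0 ≤ c k) → (∀ k, E.alow (t + k + 1) ≤ a (k + 1)) →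
      (∀ k, c k + a (k + 1) ≤ (1 + E.i (t + k)) * a k + E.w (t + k)) →
      ∀ K, ∑ k ∈ Finset.range K, E.β ^ k * c k ≤ C := by
  have hβ := hE.standing.β_pos
  by_cases hs : Summable (E.discountedIncome 0)
  -- Finite present value of income: dividing the budgets by compound interest makes them telescope,
  -- and the natural debt limit bounds terminal debt by the present value of the remaining income.
  · have hsum := hE.standing.summable_discountedIncome hs
    set S := ∑' k, E.discountedIncome t k
    -- The maximum with `0` covers `K = 0`: the sum is then empty, and no borrowing limit is imposed
    -- on `a 0`.
    refine ⟨max ((C₀ + S) / E.β) 0, fun a c ha hc hlow hbud K => ?_⟩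
    rcases Nat.eq_zero_or_pos K with rfl | hK
    · simp
    refine le_max_of_le_left ?_
    have ind : ∀ K, ∑ k ∈ Finset.range K, c k / E.compound t (k + 1) + a K / E.compound t K ≤
        a 0 + ∑ k ∈ Finset.range K, E.discountedIncome t k := by
      intro K
      induction K with
      | zero => simp [compound]
      | succ K ih =>
        have hD := hE.standing.compound_pos t (K + 1)
        have hD' := hE.standing.compound_pos t K
        rw [Finset.sum_range_succ, Finset.sum_range_succ, discountedIncome_eq]
        have h1 : c K / E.compound t (K + 1) + a (K + 1) / E.compound t (K + 1) ≤
            a K / E.compound t K + E.w (t + K) / E.compound t (K + 1) := by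
          have h2 : a K / E.compound t K = (1 + E.i (t + K)) * a K / E.compound t (K + 1) := by
            rw [compound_succ]
            have := (hE.standing.gross_interest_pos (t + K)).ne'
            field_simp
          rw [h2, ← add_div, ← add_div]
          exact div_le_div_of_nonneg_right (hbud K) hD.le
        linarith
    have hdebt : -(∑' k, E.discountedIncome t (k + K)) ≤ a K / E.compound t K := by
      have hD := hE.standing.compound_pos t K
      simp_rw [discountedIncome_add]
      rw [tsum_mul_left, ← mul_neg, div_eq_inv_mul]
      refine mul_le_mul_of_nonneg_left ?_ (inv_nonneg.2 hD.le)
      obtain ⟨K', rfl⟩ : ∃ K', K = K' + 1 := ⟨K - 1, by omega⟩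
      exact (hE.debt.1 (t + (K' + 1)) (hsum _)).trans (hlow K')
    have h1 := ind K
    have h2 := (hsum t).sum_add_tsum_nat_add K
    have h3 : ∑ k ∈ Finset.range K, c k / E.compound t (k + 1) ≤ C₀ + S := by
      have := (abs_le.1 ha).2
      linarith
    rw [le_div_iff₀ hβ, Finset.sum_mul]
    refine le_trans (Finset.sum_le_sum fun k _ => ?_) h3
    have hD := hE.standing.compound_pos t (k + 1)
    rw [le_div_iff₀ hD]
    calc E.β ^ k * c k * E.β * E.compound t (k + 1)
        = c k * (E.β ^ (k + 1) * E.compound t (k + 1)) := by ring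
      _ ≤ c k * 1 := mul_le_mul_of_nonneg_left (hE.pow_mul_compound_le_one t (k + 1)) (hc k)
      _ = c k := mul_one _
  -- Without a finite present value, discount by powers of `β` instead. Bounded income and the
  -- summable discounted debt limits then play the role of the natural debt limit.
  · obtain ⟨Cw, hCw⟩ := hE.w_bdd
    have hCw0 : 0 ≤ Cw := (abs_nonneg _).trans (hCw 0)
    set m : ℕ → ℝ := fun k => E.β ^ k * max (-E.alow (t + k)) 0
    have hm0 : ∀ k, 0 ≤ m k := fun k => mul_nonneg (pow_nonneg hβ.le k) (le_max_right _ _)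
    have hm : Summable m := by
      have h1 := (summable_nat_add_iff t).2 (hE.debt.2 hs)
      have h2 : (fun k => E.β ^ (k + t) * max (-E.alow (k + t)) 0) = fun k => E.β ^ t * m k := by
        ext k; simp only [m]; rw [pow_add, add_comm k t]; ring
      rw [h2, summable_mul_left_iff (pow_ne_zero t hβ.ne')] at h1
      exact h1
    have hg : Summable fun k => E.β ^ k * Cw :=
      (summable_geometric_of_lt_one hβ.le hE.standing.β_lt).mul_right Cw
    set M := ∑' k, m k
    set G := ∑' k, E.β ^ k * Cw
    -- One `C₀` is initial wealth, `M + C₀ + G` bounds the sums on the right of `ind`, and `M + C₀`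
    -- bounds terminal debt. Division by `β` undoes the shifted exponent in `ind`.
    refine ⟨(3 * C₀ + 2 * M + G) / E.β, fun a c ha hc hlow hbud K => ?_⟩
    have hC₀ : 0 ≤ C₀ := (abs_nonneg _).trans ha
    have hneg : ∀ k, -(E.β ^ k * a k) ≤ m k + if k = 0 then C₀ else 0 := by
      intro k
      rcases k with _ | k
      · have := (abs_le.1 ha).1
        have := hm0 0
        simp only [pow_zero, one_mul, if_true]
        linarith
      · rw [if_neg (Nat.succ_ne_zero k), add_zero, ← mul_neg]
        refine mul_le_mul_of_nonneg_left (le_max_of_le_left ?_) (pow_nonneg hβ.le _)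
        have := hlow k
        rw [show t + (k + 1) = t + k + 1 by omega]
        linarith
    have ind : ∀ K, ∑ k ∈ Finset.range K, E.β ^ (k + 1) * c k + E.β ^ K * a K ≤
        C₀ + ∑ k ∈ Finset.range K, (m k + (if k = 0 then C₀ else 0) + E.β ^ k * Cw) := by
      intro K
      induction K with
      | zero => simpa using (abs_le.1 ha).2
      | succ K ih =>
        rw [Finset.sum_range_succ, Finset.sum_range_succ]
        have h1 : E.β ^ (K + 1) * (c K + a (K + 1)) ≤
            E.β ^ (K + 1) * ((1 + E.i (t + K)) * a K + E.w (t + K)) :=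
          mul_le_mul_of_nonneg_left (hbud K) (pow_nonneg hβ.le _)
        -- When discounting outweighs interest, discounted debt shrinks by the fraction `θ`. This
        -- apparent gain is controlled by the bound `hneg` on debt.
        set θ := 1 - E.β * (1 + E.i (t + K))
        have hθ0 : 0 ≤ θ := sub_nonneg.2 (hE.discount _)
        have hθ1 : θ ≤ 1 :=
          sub_le_self _ (mul_nonneg hβ.le (hE.standing.gross_interest_pos _).le)
        have h2 : E.β ^ (K + 1) * ((1 + E.i (t + K)) * a K + E.w (t + K)) =
            E.β ^ K * a K + θ * -(E.β ^ K * a K) + E.β ^ (K + 1) * E.w (t + K) := by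
          simp only [θ]; ring
        have h3 : E.β ^ (K + 1) * E.w (t + K) ≤ E.β ^ K * Cw :=
          (mul_le_mul_of_nonneg_left ((le_abs_self _).trans (hCw (t + K)))
            (pow_nonneg hβ.le (K + 1))).trans (mul_le_mul_of_nonneg_right
              (pow_le_pow_of_le_one hβ.le hE.standing.β_lt.le (Nat.le_succ K)) hCw0)
        have h4 : θ * -(E.β ^ K * a K) ≤ m K + if K = 0 then C₀ else 0 := by
          have hnn : 0 ≤ m K + if K = 0 then C₀ else 0 := by
            have := hm0 K
            split_ifs <;> linarith
          calc θ * -(E.β ^ K * a K) ≤ θ * (m K + if K = 0 then C₀ else 0) :=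
                mul_le_mul_of_nonneg_left (hneg K) hθ0
            _ ≤ 1 * (m K + if K = 0 then C₀ else 0) := mul_le_mul_of_nonneg_right hθ1 hnn
            _ = _ := one_mul _
        linarith
    have h1 := ind K
    have h2 := hneg K
    have h3 : ∑ k ∈ Finset.range K, m k ≤ M := hm.sum_le_tsum _ fun k _ => hm0 k
    have h4 : ∑ k ∈ Finset.range K, E.β ^ k * Cw ≤ G :=
      hg.sum_le_tsum _ fun k _ => mul_nonneg (pow_nonneg hβ.le k) hCw0
    have h5 : m K ≤ M := hm.le_tsum K fun k _ => hm0 k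
    have h6 : ∑ k ∈ Finset.range K, (if k = 0 then C₀ else 0) ≤ C₀ := by
      rw [Finset.sum_ite_eq']
      split_ifs <;> linarith
    have h7 : (if K = 0 then C₀ else 0) ≤ C₀ := by split_ifs <;> linarith
    rw [Finset.sum_add_distrib, Finset.sum_add_distrib] at h1
    rw [le_div_iff₀ hβ, Finset.sum_mul]
    have h8 : ∑ k ∈ Finset.range K, E.β ^ k * c k * E.β =
        ∑ k ∈ Finset.range K, E.β ^ (k + 1) * c k :=
      Finset.sum_congr rfl fun k _ => by rw [pow_succ]; ring
    linarith

/-- Wealth at `s` when nothing is spent from period `t` on. -/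
def savedWealth (E : Economy) (t : ℕ) (a : ℝ) : ℕ → ℝ
  | 0 => a
  | s + 1 => if s < t then a else (1 + E.i s) * savedWealth E t a s + E.w s

theorem savedWealth_of_le {t s : ℕ} {a : ℝ} (h : s ≤ t) : E.savedWealth t a s = a := by
  cases s with
  | zero => rfl
  | succ s => exact if_pos (Nat.lt_of_succ_le h)

theorem savedWealth_succ {t s : ℕ} {a : ℝ} (h : t ≤ s) :
    E.savedWealth t a (s + 1) = (1 + E.i s) * E.savedWealth t a s + E.w s :=
  if_neg (not_lt.2 h)

theorem measurable_savedWealth (t s : ℕ) : Measurable fun a => E.savedWealth t a s := by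
  induction s with
  | zero => exact measurable_id
  | succ s ih =>
    rcases le_or_gt t s with h | h
    · simp_rw [savedWealth_succ h]
      exact (ih.const_mul _).add_const _
    · simp_rw [savedWealth_of_le (Nat.succ_le_of_lt h)]
      exact measurable_id

end Economy

/-! ### Boundedness of plans and existence of the value -/

section Bounds

variable {Ω : Type*} {E : Economy} {U : Uncertainty Ω} {mΩ : MeasurableSpace Ω} {P : Measure Ω}
  {t s : ℕ} {a₀ : Ω → ℝ} {H : MeasurableSpace Ω} {x : Plan Ω}

/-- Spend nothing. -/
def savingPlan (E : Economy) (t : ℕ) (a₀ : Ω → ℝ) : Plan Ω where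
  o _ _ := 0
  b _ _ := 0
  n _ _ := 0
  c _ _ := 0
  a s ω := E.savedWealth t (a₀ ω) s

/-- Expenditure is nonnegative and gross interest positive, so spending nothing leaves the largest
wealth. -/
theorem Feasible.ae_le_savedWealth (hE : E.Standing) (hx : Feasible E U P t a₀ H x) (hs : t ≤ s) :
    ∀ᵐ ω ∂P, x.a s ω ≤ E.savedWealth t (a₀ ω) s := by
  induction s, hs using Nat.le_induction with
  | base =>
    refine ae_of_all _ fun ω => ?_
    rw [Economy.savedWealth_of_le le_rfl, hx.start]
  | succ s hs ih =>
    filter_upwards [ih, hx.admissible hs] with ω h1 h2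
    rw [Economy.savedWealth_succ hs]
    have := mul_le_mul_of_nonneg_left h1 (hE.gross_interest_pos s).le
    have := mul_nonneg (hE.po_pos s).le h2.o
    have := mul_nonneg (hE.pb_pos s).le h2.b
    have := mul_nonneg (hE.pn_pos s).le h2.n
    linarith [h2.c, h2.budget]

/-- Saving everything is feasible whenever anything is. -/
theorem Feasible.savingPlan {H' : MeasurableSpace Ω} (hE : E.Standing)
    (hx : Feasible E U P t a₀ H x) (ha : Measurable[H'] a₀) :
    Feasible E U P t a₀ H' (savingPlan E t a₀) := by
  refine feasible_iff.2 ⟨⟨?_, fun s _ => measurable_const, fun s _ => measurable_const,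
    fun s _ => measurable_const, fun s _ => measurable_const, fun s _ => ?_⟩, fun s hs => ?_⟩
  · ext ω; exact Economy.savedWealth_of_le le_rfl
  · exact ((Economy.measurable_savedWealth t (s + 1)).comp ha).mono (le_info s) le_rfl
  · filter_upwards [hx.ae_le_savedWealth hE (hs.trans (Nat.le_succ s)), hx.admissible hs]
      with ω h1 h2
    refine ⟨le_rfl, le_rfl, le_rfl, le_rfl, h2.borrowing.trans h1, ?_⟩
    simp only [_root_.savingPlan, Economy.savedWealth_succ hs]
    linarith

theorem finiteUtility_savingPlan [IsProbabilityMeasure P] (hE : E.Regular) :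
    FiniteUtility E U P t (savingPlan E t a₀) := by
  obtain ⟨C, hC⟩ := hE.target_bdd
  have hu : ∀ s, utility E U (savingPlan E t a₀) s =
      fun _ => -(E.lam / 2 * E.target s ^ 2) := fun s => by
    ext ω; simp [utility, transport, savingPlan]
  have hl := hE.standing.lam_pos
  have hβ := hE.standing.β_pos
  refine ⟨fun s _ => by rw [hu]; exact integrable_const _, ?_⟩
  refine ((summable_geometric_of_lt_one hβ.le hE.standing.β_lt).mul_right
    (E.lam / 2 * C ^ 2)).of_nonneg_of_le (fun k => ?_) fun k => ?_
  · exact mul_nonneg (pow_nonneg hβ.le k) (integral_nonneg fun ω => abs_nonneg _)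
  · refine mul_le_mul_of_nonneg_left ?_ (pow_nonneg hβ.le k)
    rw [hu]
    simp only [integral_const, probReal_univ, one_smul, abs_neg]
    rw [abs_of_nonneg (by positivity)]
    refine mul_le_mul_of_nonneg_left ?_ (by positivity)
    exact sq_le_sq' (by linarith [(abs_le.1 (hC (t + k))).1]) (abs_le.1 (hC (t + k))).2

/-- Wealth lies between the borrowing limit and fully saved wealth. At the starting date the bound
on initial wealth replaces the borrowing limit. -/
theorem Feasible.exists_wealth_bound (hE : E.Standing) (hx : Feasible E U P t a₀ H x)
    (ha : ∃ C, ∀ᵐ ω ∂P, |a₀ ω| ≤ C) (hs : t ≤ s) : ∃ C, ∀ᵐ ω ∂P, |x.a s ω| ≤ C := by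
  have hsaved : ∀ s, t ≤ s → ∃ C, ∀ᵐ ω ∂P, |E.savedWealth t (a₀ ω) s| ≤ C := by
    intro s hs
    induction s, hs using Nat.le_induction with
    | base => simpa only [Economy.savedWealth_of_le le_rfl] using ha
    | succ s hs ih =>
      obtain ⟨C, hC⟩ := ih
      refine ⟨|1 + E.i s| * C + |E.w s|, ?_⟩
      filter_upwards [hC] with ω h
      rw [Economy.savedWealth_succ hs]
      refine (abs_add_le _ _).trans (add_le_add_left ?_ _)
      rw [abs_mul]
      exact mul_le_mul_of_nonneg_left h (abs_nonneg _)
  rcases hs.eq_or_lt with rfl | hs'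
  · rw [hx.start]; exact ha
  · obtain ⟨C, hC⟩ := hsaved s hs
    obtain ⟨r, rfl⟩ := Nat.exists_eq_succ_of_ne_zero (Nat.ne_zero_of_lt hs')
    refine ⟨max C |E.alow (r + 1)|, ?_⟩
    filter_upwards [hC, hx.ae_le_savedWealth hE hs, hx.admissible (Nat.le_of_lt_succ hs')]
      with ω h1 h2 h3
    rw [abs_le]
    constructor
    · have := h3.borrowing
      have := neg_abs_le (E.alow (r + 1))
      have := le_max_right C |E.alow (r + 1)|
      rw [Nat.succ_eq_add_one]
      linarith
    · exact (h2.trans (le_abs_self _)).trans (h1.trans (le_max_left _ _))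

theorem Feasible.exists_consumption_bound (hE : E.Standing) (hx : Feasible E U P t a₀ H x)
    (ha : ∃ C, ∀ᵐ ω ∂P, |a₀ ω| ≤ C) (hs : t ≤ s) :
    ∃ C, ∀ᵐ ω ∂P, |x.o s ω| ≤ C ∧ |x.b s ω| ≤ C ∧ |x.n s ω| ≤ C ∧ |x.c s ω| ≤ C := by
  obtain ⟨C, hC⟩ := hx.exists_wealth_bound hE ha hs
  set D := (1 + E.i s) * C + |E.w s| + |E.alow (s + 1)|
  have hpo := hE.po_pos s
  have hpb := hE.pb_pos s
  have hpn := hE.pn_pos s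
  refine ⟨max (max (D / E.po s) (D / E.pb s)) (max (D / E.pn s) D), ?_⟩
  filter_upwards [hC, hx.admissible hs] with ω h1 h2
  have h3 : (1 + E.i s) * x.a s ω ≤ (1 + E.i s) * C :=
    mul_le_mul_of_nonneg_left ((le_abs_self _).trans h1) (hE.gross_interest_pos s).le
  have k1 := mul_nonneg hpo.le h2.o
  have k2 := mul_nonneg hpb.le h2.b
  have k3 := mul_nonneg hpn.le h2.n
  have k4 := h2.c
  have k5 := h2.budget
  have k6 := h2.borrowing
  have k7 := neg_abs_le (E.alow (s + 1))
  have k8 := le_abs_self (E.w s)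
  rw [abs_of_nonneg h2.o, abs_of_nonneg h2.b, abs_of_nonneg h2.n, abs_of_nonneg h2.c]
  refine ⟨le_max_of_le_left (le_max_of_le_left ?_), le_max_of_le_left (le_max_of_le_right ?_),
    le_max_of_le_right (le_max_of_le_left ?_), le_max_of_le_right (le_max_of_le_right ?_)⟩
  · rw [le_div_iff₀ hpo]; simp only [D]; linarith
  · rw [le_div_iff₀ hpb]; simp only [D]; linarith
  · rw [le_div_iff₀ hpn]; simp only [D]; linarith
  · simp only [D]; linarith

/-- The transportation loss is never a gain, so lifetime utility is at most discounted consumption.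
The bound is uniform over plans, information and initial wealth bounded by `C₀`, as an essential
supremum requires. -/
theorem exists_lifetime_bound (hE : E.Regular) (t : ℕ) (C₀ : ℝ) :
    ∃ C, ∀ (a₀ : Ω → ℝ) (H : MeasurableSpace Ω) (x : Plan Ω), (∀ᵐ ω ∂P, |a₀ ω| ≤ C₀) →
      Feasible E U P t a₀ H x → FiniteUtility E U P t x → ∀ᵐ ω ∂P, lifetime E U x t ω ≤ C := by
  obtain ⟨C, hC⟩ := hE.exists_sum_consumption_le t C₀
  refine ⟨C, fun a₀ H x ha hx hx' => ?_⟩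
  have hadm : ∀ᵐ ω ∂P, ∀ k, Admissible E x (t + k) ω :=
    ae_all_iff.2 fun k => hx.admissible (Nat.le_add_right t k)
  have hβ := hE.standing.β_pos
  filter_upwards [ha, hadm, (hx'.ae_summable hβ.le).1] with ω h1 h2 h3
  refine le_of_tendsto' h3.hasSum.tendsto_sum_nat fun K => ?_
  refine le_trans (Finset.sum_le_sum fun k _ => ?_)
    (hC (fun k => x.a (t + k) ω) (fun k => x.c (t + k) ω) (by simpa [hx.start] using h1)
      (fun k => (h2 k).c) (fun k => (h2 k).borrowing) (fun k => ?_) K)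
  · refine mul_le_mul_of_nonneg_left ?_ (pow_nonneg hβ.le k)
    have := mul_nonneg hE.standing.lam_pos.le
      (sq_nonneg (transport E U x (t + k) ω - E.target (t + k)))
    simp only [utility]
    linarith
  · have k1 := mul_nonneg (hE.standing.po_pos (t + k)).le (h2 k).o
    have k2 := mul_nonneg (hE.standing.pb_pos (t + k)).le (h2 k).b
    have k3 := mul_nonneg (hE.standing.pn_pos (t + k)).le (h2 k).n
    have k4 := (h2 k).budget
    rw [← add_assoc]
    linarith

/-- The conditions under which the value is well defined. -/
structure WellPosed (E : Economy) (U : Uncertainty Ω) {mΩ : MeasurableSpace Ω} (P : Measure Ω)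
    (t : ℕ) (a₀ : Ω → ℝ) (H : MeasurableSpace Ω) : Prop where
  le : H ≤ mΩ
  bdd : ∃ C, ∀ᵐ ω ∂P, |a₀ ω| ≤ C
  nonempty : (attainable E U P t a₀ H).Nonempty

/-- Saving everything only requires knowing one's wealth, so `H'` need not be the information of the
given plan. The same wealth can thus be valued after signals of different precision. -/
theorem Feasible.wellPosed [IsProbabilityMeasure P] {H' : MeasurableSpace Ω} (hE : E.Regular)
    (hx : Feasible E U P t a₀ H x) (ha : ∃ C, ∀ᵐ ω ∂P, |a₀ ω| ≤ C) (hm : Measurable[H'] a₀)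
    (hH : H' ≤ mΩ) : WellPosed E U P t a₀ H' :=
  ⟨hH, ha, _, _, hx.savingPlan hE.standing hm, finiteUtility_savingPlan hE, rfl⟩

theorem WellPosed.exists_bound (h : WellPosed E U P t a₀ H) [IsProbabilityMeasure P]
    (hE : E.Regular) : ∃ C, ∀ f ∈ attainable E U P t a₀ H, ∀ᵐ ω ∂P, f ω ≤ C := by
  obtain ⟨C₀, hC₀⟩ := h.bdd
  obtain ⟨C, hC⟩ := exists_lifetime_bound (U := U) (P := P) hE t C₀
  refine ⟨C, ?_⟩
  rintro _ ⟨x, hx, hx', rfl⟩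
  have h1 := condExp_mono (m := H) (hx'.integrable hE.standing.β_pos.le) (integrable_const C)
    (hC a₀ H x hC₀ hx hx')
  rw [condExp_const h.le] at h1
  exact h1

theorem attainable_measurable : ∀ f ∈ attainable E U P t a₀ H, Measurable[H] f ∧ Integrable f P := by
  rintro _ ⟨x, -, -, rfl⟩
  exact ⟨stronglyMeasurable_condExp.measurable, integrable_condExp⟩

theorem WellPosed.value_spec [IsProbabilityMeasure P] (h : WellPosed E U P t a₀ H)
    (hE : E.Regular) :
    IsEssentialSup P H (attainable E U P t a₀ H) (value E U P t a₀ H) ∧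
      Integrable (value E U P t a₀ H) P := by
  obtain ⟨C, hC⟩ := h.exists_bound hE
  obtain ⟨_, w, -, -, hw, hwi, -⟩ := exists_seq_isEssentialSup h.nonempty attainable_measurable
    (attainable_directed hE.standing.β_pos.le h.le) hC
  have hex : ∃ v, IsEssentialSup P H (attainable E U P t a₀ H) v := ⟨w, hw⟩
  have hv : IsEssentialSup P H (attainable E U P t a₀ H) (value E U P t a₀ H) := by
    rw [value, dif_pos hex]; exact hex.choose_spec
  exact ⟨hv, hwi.congr (hw.ae_eq hv)⟩

/-- To bound the value on a known event it suffices to bound each plan there. This is the form in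
which optimal continuation is used below. -/
theorem WellPosed.setIntegral_value_le [IsProbabilityMeasure P] (h : WellPosed E U P t a₀ H)
    (hE : E.Regular) {B : Set Ω} (hB : MeasurableSet[H] B) {D : ℝ}
    (hD : ∀ x, Feasible E U P t a₀ H x → FiniteUtility E U P t x →
      ∫ ω in B, lifetime E U x t ω ∂P ≤ D) :
    ∫ ω in B, value E U P t a₀ H ω ∂P ≤ D := by
  obtain ⟨C, hC⟩ := h.exists_bound hE
  refine (h.value_spec hE).1.setIntegral_le h.nonempty attainable_measurable
    (attainable_directed hE.standing.β_pos.le h.le) hC ?_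
  rintro _ ⟨x, hx, hx', rfl⟩
  rw [setIntegral_condExp h.le (hx'.integrable hE.standing.β_pos.le) hB]
  exact hD x hx hx'

theorem WellPosed.setIntegral_lifetime_le [IsProbabilityMeasure P] (h : WellPosed E U P t a₀ H)
    (hE : E.Regular) (hx : Feasible E U P t a₀ H x) (hx' : FiniteUtility E U P t x) {B : Set Ω}
    (hB : MeasurableSet[H] B) :
    ∫ ω in B, lifetime E U x t ω ∂P ≤ ∫ ω in B, value E U P t a₀ H ω ∂P := by
  rw [← setIntegral_condExp h.le (hx'.integrable hE.standing.β_pos.le) hB]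
  exact setIntegral_mono_ae integrable_condExp.integrableOn (h.value_spec hE).2.integrableOn
    ((h.value_spec hE).1.2.1 _ ⟨x, hx, hx', rfl⟩)

end Bounds

/-! ### Transport of plans along a map of states -/

section Lift

variable {Ω Ω' : Type*}

/-- The plan that follows `x` along the map `θ` of states. -/
def Plan.comp (x : Plan Ω') (θ : Ω → Ω') : Plan Ω where
  o s := x.o s ∘ θ
  b s := x.b s ∘ θ
  n s := x.n s ∘ θ
  c s := x.c s ∘ θ
  a s := x.a s ∘ θ

/-- From period `T` on, the uncertainty `U` is `U'` seen through `θ`. -/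
structure Uncertainty.IsPullback (U : Uncertainty Ω) (U' : Uncertainty Ω') (θ : Ω → Ω') (T : ℕ) :
    Prop where
  A : U.A = U'.A ∘ θ
  ψ : U.ψ = U'.ψ
  V : ∀ s, T ≤ s → U.V s = U'.V s ∘ θ

variable {E : Economy} {U : Uncertainty Ω} {U' : Uncertainty Ω'} {θ : Ω → Ω'} {T : ℕ}
  {H' : MeasurableSpace Ω'} {a' : Ω' → ℝ}

theorem Uncertainty.IsPullback.signal (h : U.IsPullback U' θ T) {s : ℕ} (hs : T ≤ s)
    (η : Ω' → ℝ) : U.signal s (η ∘ θ) = U'.signal s η ∘ θ := by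
  ext ω
  simp [Uncertainty.signal, h.A, h.ψ, h.V s hs]

theorem Uncertainty.IsPullback.learn (h : U.IsPullback U' θ T) {s : ℕ} (hs : T ≤ s)
    (m : MeasurableSpace Ω') (η : Ω' → ℝ) :
    U.learn s (m.comap θ) (η ∘ θ) = (U'.learn s m η).comap θ := by
  rw [Uncertainty.learn, Uncertainty.learn, h.signal hs, MeasurableSpace.comap_sup,
    MeasurableSpace.comap_comp]

theorem info_comp (h : U.IsPullback U' θ T) (x : Plan Ω') (s : ℕ) :
    info E U (x.comp θ) T (H'.comap θ) s = (info E U' x T H' s).comap θ := by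
  induction s with
  | zero => rfl
  | succ s ih =>
    rcases le_or_gt T s with hs | hs
    · rw [info_succ hs, info_succ hs, ih, ← h.learn hs]
      rfl
    · rw [info_of_le (Nat.succ_le_of_lt hs), info_of_le (Nat.succ_le_of_lt hs)]

theorem measurable_comp_of_comap {m : MeasurableSpace Ω'} {f : Ω' → ℝ} (hf : Measurable[m] f)
    (θ : Ω → Ω') : Measurable[m.comap θ] (f ∘ θ) :=
  fun C hC => ⟨f ⁻¹' C, hf hC, rfl⟩

theorem AdaptedPlan.comp {x : Plan Ω'} (hx : AdaptedPlan E U' T a' H' x)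
    (h : U.IsPullback U' θ T) : AdaptedPlan E U T (a' ∘ θ) (H'.comap θ) (x.comp θ) where
  start := by rw [← hx.start]; rfl
  o s hs := by rw [info_comp h]; exact measurable_comp_of_comap (hx.o s hs) θ
  b s hs := by rw [info_comp h]; exact measurable_comp_of_comap (hx.b s hs) θ
  n s hs := by rw [info_comp h]; exact measurable_comp_of_comap (hx.n s hs) θ
  c s hs := by rw [info_comp h]; exact measurable_comp_of_comap (hx.c s hs) θ
  a s hs := by rw [info_comp h]; exact measurable_comp_of_comap (hx.a s hs) θ

open Classical in
/-- A measurable factor of `f` through `θ`, if there is one. -/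
def factorThrough (θ : Ω → Ω') (m : MeasurableSpace Ω') (f : Ω → ℝ) : Ω' → ℝ :=
  if h : ∃ g, Measurable[m] g ∧ f = g ∘ θ then h.choose else 0

theorem measurable_factorThrough (m : MeasurableSpace Ω') (f : Ω → ℝ) :
    Measurable[m] (factorThrough θ m f) := by
  unfold factorThrough
  split_ifs with h
  · exact h.choose_spec.1
  · exact measurable_const

theorem factorThrough_comp {m : MeasurableSpace Ω'} {f : Ω → ℝ} (hf : Measurable[m.comap θ] f) :
    f = factorThrough θ m f ∘ θ := by
  have h : ∃ g, Measurable[m] g ∧ f = g ∘ θ := hf.exists_eq_measurable_comp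
  rw [factorThrough, dif_pos h]
  exact h.choose_spec.2

/-- The information of the factored plan `liftPlan`. -/
@[reducible] def liftInfo (E : Economy) (U' : Uncertainty Ω') (θ : Ω → Ω') (T : ℕ)
    (H' : MeasurableSpace Ω') (x : Plan Ω) : ℕ → MeasurableSpace Ω'
  | 0 => H'
  | s + 1 => if s < T then H' else U'.learn s (liftInfo E U' θ T H' x s) fun ω =>
      E.hbar (factorThrough θ (liftInfo E U' θ T H' x s) (x.b s) ω)
        (factorThrough θ (liftInfo E U' θ T H' x s) (x.n s) ω)

/-- A plan on `Ω'` from which `x` is obtained along `θ`. -/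
def liftPlan (E : Economy) (U' : Uncertainty Ω') (θ : Ω → Ω') (T : ℕ) (a' : Ω' → ℝ)
    (H' : MeasurableSpace Ω') (x : Plan Ω) : Plan Ω' where
  o s := factorThrough θ (liftInfo E U' θ T H' x s) (x.o s)
  b s := factorThrough θ (liftInfo E U' θ T H' x s) (x.b s)
  n s := factorThrough θ (liftInfo E U' θ T H' x s) (x.n s)
  c s := factorThrough θ (liftInfo E U' θ T H' x s) (x.c s)
  -- Wealth of period `s > T` is chosen on the information of `s - 1`, so it is factored one period
  -- earlier than the other choices.
  a s := if s ≤ T then a' else factorThrough θ (liftInfo E U' θ T H' x (s - 1)) (x.a s)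

theorem info_liftPlan (x : Plan Ω) (s : ℕ) :
    info E U' (liftPlan E U' θ T a' H' x) T H' s = liftInfo E U' θ T H' x s := by
  induction s with
  | zero => rfl
  | succ s ih =>
    change (if s < T then H' else _) = if s < T then H' else _
    rw [ih]
    rfl

/-- Once the trips of a period factor through `θ`, so do its precision and signal, and hence the
information on which the next choices are factored. -/
theorem comap_liftInfo {x : Plan Ω} {a₀ : Ω → ℝ} (h : U.IsPullback U' θ T)
    (hx : AdaptedPlan E U T a₀ (H'.comap θ) x) (s : ℕ) :
    (liftInfo E U' θ T H' x s).comap θ = info E U x T (H'.comap θ) s := by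
  induction s with
  | zero => rfl
  | succ s ih =>
    rcases le_or_gt T s with hs | hs
    · have hb := hx.b s hs
      have hn := hx.n s hs
      rw [← ih] at hb hn
      rw [info_succ hs, ← ih]
      have e : precision E x s = (fun ω =>
          E.hbar (factorThrough θ (liftInfo E U' θ T H' x s) (x.b s) ω)
            (factorThrough θ (liftInfo E U' θ T H' x s) (x.n s) ω)) ∘ θ := by
        ext ω
        exact congrArg₂ E.hbar (congrFun (factorThrough_comp hb) ω)
          (congrFun (factorThrough_comp hn) ω)
      rw [e, h.learn hs]
      congr 1
      exact if_neg (not_lt.2 hs)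
    · rw [info_of_le (Nat.succ_le_of_lt hs)]
      congr 1
      exact if_pos hs

theorem adaptedPlan_liftPlan (x : Plan Ω) :
    AdaptedPlan E U' T a' H' (liftPlan E U' θ T a' H' x) where
  start := by simp [liftPlan]
  o s _ := by rw [info_liftPlan]; exact measurable_factorThrough _ _
  b s _ := by rw [info_liftPlan]; exact measurable_factorThrough _ _
  n s _ := by rw [info_liftPlan]; exact measurable_factorThrough _ _
  c s _ := by rw [info_liftPlan]; exact measurable_factorThrough _ _
  a s hs := by
    rw [info_liftPlan]
    simp only [liftPlan, Nat.add_sub_cancel, if_neg (not_le.2 (Nat.lt_succ_of_le hs))]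
    exact measurable_factorThrough _ _

/-- The two plans prescribe the same from period `T` on. -/
def Plan.AgreeFrom (T : ℕ) (x y : Plan Ω) : Prop :=
  ∀ s, T ≤ s → x.o s = y.o s ∧ x.b s = y.b s ∧ x.n s = y.n s ∧ x.c s = y.c s ∧ x.a s = y.a s

/-- Doob–Dynkin factorization, period by period: a plan adapted to pulled-back information is a
pulled-back plan from `T` on. -/
theorem AdaptedPlan.agreeFrom_lift {x : Plan Ω} (h : U.IsPullback U' θ T)
    (hx : AdaptedPlan E U T (a' ∘ θ) (H'.comap θ) x) :
    x.AgreeFrom T ((liftPlan E U' θ T a' H' x).comp θ) := by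
  have key : ∀ {s : ℕ} {f : Ω → ℝ}, Measurable[info E U x T (H'.comap θ) s] f →
      f = factorThrough θ (liftInfo E U' θ T H' x s) f ∘ θ := fun {s f} hf => by
    rw [← comap_liftInfo h hx] at hf
    exact factorThrough_comp hf
  intro s hs
  refine ⟨key (hx.o s hs), key (hx.b s hs), key (hx.n s hs), key (hx.c s hs), ?_⟩
  rcases hs.eq_or_lt with rfl | hs'
  · rw [hx.start]; simp [Plan.comp, liftPlan]
  · obtain ⟨r, rfl⟩ := Nat.exists_eq_succ_of_ne_zero (Nat.ne_zero_of_lt hs')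
    simp only [Plan.comp, liftPlan, if_neg (not_le.2 hs')]
    exact key (hx.a r (Nat.le_of_lt_succ hs'))

theorem Plan.AgreeFrom.utility {x y : Plan Ω} (h : x.AgreeFrom T y) {s : ℕ} (hs : T ≤ s) :
    utility E U x s = utility E U y s := by
  obtain ⟨h1, h2, h3, h4, -⟩ := h s hs
  unfold _root_.utility transport
  rw [h1, h2, h3, h4]

theorem Plan.AgreeFrom.admissible {x y : Plan Ω} (h : x.AgreeFrom T y) {s : ℕ} (hs : T ≤ s)
    {ω : Ω} (hx : Admissible E x s ω) : Admissible E y s ω := by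
  obtain ⟨h1, h2, h3, h4, h5⟩ := h s hs
  obtain ⟨-, -, -, -, h6⟩ := h (s + 1) (hs.trans (Nat.le_succ s))
  obtain ⟨k1, k2, k3, k4, k5, k6⟩ := hx
  rw [h1] at k1 k6
  rw [h2] at k2 k6
  rw [h3] at k3 k6
  rw [h4] at k4 k6
  rw [h5] at k6
  rw [h6] at k5 k6
  exact ⟨k1, k2, k3, k4, k5, k6⟩

theorem Uncertainty.IsPullback.utility (h : U.IsPullback U' θ T) (x : Plan Ω') (s : ℕ) :
    utility E U (x.comp θ) s = _root_.utility E U' x s ∘ θ := by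
  ext ω
  simp [_root_.utility, transport, Plan.comp, h.A]

theorem Uncertainty.IsPullback.lifetime (h : U.IsPullback U' θ T) (x : Plan Ω') (s : ℕ) :
    lifetime E U (x.comp θ) s = _root_.lifetime E U' x s ∘ θ := by
  ext ω
  simp [_root_.lifetime, h.utility]

theorem measurableSet_admissible {m : MeasurableSpace Ω} {x : Plan Ω} {s : ℕ}
    (ho : Measurable[m] (x.o s)) (hb : Measurable[m] (x.b s)) (hn : Measurable[m] (x.n s))
    (hc : Measurable[m] (x.c s)) (ha : Measurable[m] (x.a s)) (ha' : Measurable[m] (x.a (s + 1))) :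
    MeasurableSet[m] {ω | Admissible E x s ω} := by
  have e : {ω | Admissible E x s ω} = {ω | 0 ≤ x.o s ω} ∩ ({ω | 0 ≤ x.b s ω} ∩
      ({ω | 0 ≤ x.n s ω} ∩ ({ω | 0 ≤ x.c s ω} ∩ ({ω | E.alow (s + 1) ≤ x.a (s + 1) ω} ∩
      {ω | E.po s * x.o s ω + E.pb s * x.b s ω + E.pn s * x.n s ω + x.c s ω + x.a (s + 1) ω
        ≤ (1 + E.i s) * x.a s ω + E.w s})))) := by
    ext ω
    exact ⟨fun h => ⟨h.1, h.2, h.3, h.4, h.5, h.6⟩,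
      fun h => ⟨h.1, h.2.1, h.2.2.1, h.2.2.2.1, h.2.2.2.2.1, h.2.2.2.2.2⟩⟩
  rw [e]
  refine (measurableSet_le measurable_const ho).inter ((measurableSet_le measurable_const hb).inter
    ((measurableSet_le measurable_const hn).inter ((measurableSet_le measurable_const hc).inter
    ((measurableSet_le measurable_const ha').inter (measurableSet_le ?_ ?_)))))
  · exact ((((ho.const_mul _).add (hb.const_mul _)).add (hn.const_mul _)).add hc).add ha'
  · exact (ha.const_mul _).add_const _

theorem measurable_utility {m : MeasurableSpace Ω} {x : Plan Ω} {s : ℕ} (hA : Measurable[m] U.A)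
    (ho : Measurable[m] (x.o s)) (hb : Measurable[m] (x.b s)) (hn : Measurable[m] (x.n s))
    (hc : Measurable[m] (x.c s)) : Measurable[m] (utility E U x s) :=
  hc.sub ((((ho.add (((hA.pow_const _).const_mul _).mul hb)).add (hA.mul hn)).sub_const
    _).pow_const 2 |>.const_mul _)

end Lift

/-! ### Blackwell's comparison by garbling -/

section Garbling

variable {Ω Ω₀ : Type*}

/-- The uncertainty `U₀` with a free coordinate in place of the noise of period `t`. -/
def Uncertainty.freeNoise (U₀ : Uncertainty Ω₀) (t : ℕ) : Uncertainty (Ω₀ × ℝ) where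
  A p := U₀.A p.1
  supp := U₀.supp
  ψ := U₀.ψ
  V k p := if k = t then p.2 else U₀.V k p.1
  F := U₀.F

/-- `U` is the uncertainty `U₀` with a noise in period `t` that is independent of `U₀` and keeps
its law when independent noise is added in the proportions `r : s`. -/
structure GarblingModel {mΩ : MeasurableSpace Ω} (P : Measure Ω) [m₀ : MeasurableSpace Ω₀]
    (U : Uncertainty Ω) (U₀ : Uncertainty Ω₀) (π : Ω → Ω₀) (t : ℕ) (F : Measure ℝ) (r s : ℝ) :
    Prop where
  π_measurable : Measurable π
  A : U.A = U₀.A ∘ π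
  ψ : U.ψ = U₀.ψ
  V : ∀ k, t < k → U.V k = U₀.V k ∘ π
  A_measurable : Measurable U₀.A
  ψ_measurable : Measurable U₀.ψ
  V_measurable : ∀ k, t < k → Measurable (U₀.V k)
  noise_measurable : Measurable (U.V t)
  prob : IsProbabilityMeasure F
  law : P.map (U.V t) = F
  indep : IndepFun π (U.V t) P
  rotate : (F.prod F).map (fun z => r * z.1 + s * z.2) = F

namespace GarblingModel

variable {H₀ : MeasurableSpace Ω₀} {Hq : MeasurableSpace Ω} {mΩ : MeasurableSpace Ω} {P : Measure Ω}
  {m₀ : MeasurableSpace Ω₀} {U : Uncertainty Ω} {U₀ : Uncertainty Ω₀} {π : Ω → Ω₀} {t : ℕ}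
  {F : Measure ℝ} {r s : ℝ} {E : Economy}

theorem isPullback (M : GarblingModel P U U₀ π t F r s) (f : Ω → ℝ) :
    U.IsPullback (U₀.freeNoise t) (fun ω => (π ω, f ω)) (t + 1) where
  A := M.A
  ψ := M.ψ
  V k hk := by
    rw [M.V k hk]
    ext ω
    simp [Uncertainty.freeNoise, (Nat.lt_of_succ_le hk).ne']

/-- The information after a signal with precision `h` when the noise is the free coordinate. -/
@[reducible] def freeInfo (U₀ : Uncertainty Ω₀) (t : ℕ) (H₀ : MeasurableSpace Ω₀) (h : ℝ) :
    MeasurableSpace (Ω₀ × ℝ) :=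
  (U₀.freeNoise t).learn t (H₀.comap Prod.fst) fun _ => h

/-- Inserting the true noise in the free coordinate recovers the actual information. Other values of
that coordinate describe the same consumer facing different noise. -/
theorem comap_freeInfo (M : GarblingModel P U U₀ π t F r s) (h : ℝ) :
    (freeInfo U₀ t H₀ h).comap (fun ω => (π ω, U.V t ω)) =
      U.learn t (H₀.comap π) fun _ => h := by
  rw [freeInfo, Uncertainty.learn, Uncertainty.learn, MeasurableSpace.comap_sup,
    MeasurableSpace.comap_comp, MeasurableSpace.comap_comp]
  have e : (U₀.freeNoise t).signal t (fun _ => h) ∘ (fun ω => (π ω, U.V t ω)) =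
      U.signal t fun _ => h := by
    ext ω
    simp [Uncertainty.signal, Uncertainty.freeNoise, M.A, M.ψ]
  rw [e]
  rfl

/-- The signal with the lower precision is a garbling of the signal with the higher one. -/
theorem comap_freeInfo_le (M : GarblingModel P U U₀ π t F r s) {h h' : ℝ} (hh' : 0 < h')
    (hr : r = h / h') (e : ℝ) :
    (freeInfo U₀ t H₀ h).comap (fun ω => (π ω, r * U.V t ω + s * e)) ≤
      U.learn t (H₀.comap π) fun _ => h' := by
  rw [freeInfo, Uncertainty.learn, MeasurableSpace.comap_sup,
    MeasurableSpace.comap_comp, MeasurableSpace.comap_comp]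
  refine sup_le_sup le_rfl ?_
  -- At precision zero `r = 0`, so for frozen `e` the imitated signal is a constant and reveals
  -- nothing.
  rcases eq_or_ne h 0 with rfl | hh
  · have h1 : (U₀.freeNoise t).signal t (fun _ => (0 : ℝ)) ∘
        (fun ω => (π ω, r * U.V t ω + s * e)) = fun _ => s * e := by
      ext ω
      simp [Uncertainty.signal, Uncertainty.freeNoise, hr]
    rw [h1, MeasurableSpace.comap_const]
    exact bot_le
  -- Since `r / h = 1 / h'`, adding `s * e / h` to the precise signal gives the coarse one with
  -- noise `r V + s e`.
  · have h1 : (U₀.freeNoise t).signal t (fun _ => h) ∘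
        (fun ω => (π ω, r * U.V t ω + s * e)) =
        (fun y => y + 1 / h * (s * e)) ∘ U.signal t fun _ => h' := by
      ext ω
      simp only [Uncertainty.signal, Uncertainty.freeNoise, Function.comp, hh, hh'.ne', if_false,
        M.A, M.ψ, if_true, hr]
      field_simp
      ring
    rw [h1, ← MeasurableSpace.comap_comp]
    exact MeasurableSpace.comap_mono (measurable_id.add_const _).comap_le

theorem map_eq [IsProbabilityMeasure P] (M : GarblingModel P U U₀ π t F r s) :
    P.map (fun ω => (π ω, U.V t ω)) =
      (F.prod P).map fun p : ℝ × Ω => (π p.2, r * U.V t p.2 + s * p.1) :=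
  have := M.prob
  map_prodMk_eq_map_garbled M.π_measurable M.noise_measurable M.law M.indep M.rotate

theorem freeInfo_le (M : GarblingModel P U U₀ π t F r s) (hH₀ : H₀ ≤ m₀) (h : ℝ) :
    freeInfo U₀ t H₀ h ≤ Prod.instMeasurableSpace := by
  refine Uncertainty.learn_le M.ψ_measurable (M.A_measurable.comp measurable_fst) ?_
    measurable_const ((MeasurableSpace.comap_mono hH₀).trans measurable_fst.comap_le)
  simp only [Uncertainty.freeNoise, if_true]
  exact measurable_snd

theorem freeNoise_V_measurable (M : GarblingModel P U U₀ π t F r s) {k : ℕ} (hk : t < k) :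
    Measurable ((U₀.freeNoise t).V k) := by
  simp only [Uncertainty.freeNoise, hk.ne', if_false]
  exact (M.V_measurable k hk).comp measurable_fst

section Transfer

variable [IsProbabilityMeasure P] {a₀ : Ω₀ → ℝ} {h : ℝ} {x : Plan (Ω₀ × ℝ)}

/-- The garbled pair has the same law as `(π, V)`, so almost sure constraints survive the
replacement of noise. Fubini then yields them for almost every frozen `e`. -/
theorem ae_admissible (M : GarblingModel P U U₀ π t F r s)
    (hx : ∀ k, t < k → MeasurableSet {q | Admissible E x k q})
    (hadm : ∀ k, t < k → ∀ᵐ ω ∂P, Admissible E x k (π ω, U.V t ω)) :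
    ∀ᵐ e ∂F, ∀ k, t < k → ∀ᵐ ω ∂P, Admissible E x k (π ω, r * U.V t ω + s * e) := by
  have := M.prob
  have hπ := M.π_measurable
  have hV := M.noise_measurable
  refine ae_all_iff.2 fun k => ?_
  by_cases hk : t < k
  · have h1 := (ae_map_iff (by fun_prop) (hx k hk)).2 (hadm k hk)
    rw [M.map_eq, ae_map_iff (by fun_prop) (hx k hk)] at h1
    filter_upwards [Measure.ae_ae_of_ae_prod h1] with e he _ using he
  · exact ae_of_all _ fun e h => absurd h hk

/-- Total expected absolute utility, averaged over `e`, equals that of the original plan and is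
finite. It is therefore finite for almost every `e`. -/
theorem ae_finiteUtility (M : GarblingModel P U U₀ π t F r s) (hβ : 0 ≤ E.β)
    (hfin : FiniteUtility E (U₀.freeNoise t) (P.map fun ω => (π ω, U.V t ω)) (t + 1) x) :
    ∀ᵐ e ∂F, FiniteUtility E U P (t + 1) (x.comp fun ω => (π ω, r * U.V t ω + s * e)) := by
  have := M.prob
  have hπ := M.π_measurable
  have hV := M.noise_measurable
  obtain ⟨h1, h2⟩ := hfin
  set Θ : ℝ × Ω → Ω₀ × ℝ := fun p => (π p.2, r * U.V t p.2 + s * p.1)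
  have hΘ : Measurable Θ := by fun_prop
  rw [M.map_eq] at h1 h2
  have hi : ∀ k, t + 1 ≤ k →
      Integrable (utility E (U₀.freeNoise t) x k ∘ Θ) (F.prod P) := fun k hk =>
    (integrable_map_measure (h1 k hk).1 hΘ.aemeasurable).1 (h1 k hk)
  have hi' : ∀ k, Integrable (fun e => E.β ^ k *
      ∫ ω, |utility E (U₀.freeNoise t) x (t + 1 + k) (Θ (e, ω))| ∂P) F := fun k =>
    ((hi (t + 1 + k) (Nat.le_add_right _ k)).abs.integral_prod_left).const_mul _
  have hsum : Summable fun k => ∫ e, |E.β ^ k *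
      ∫ ω, |utility E (U₀.freeNoise t) x (t + 1 + k) (Θ (e, ω))| ∂P| ∂F := by
    refine h2.congr fun k => ?_
    have hk := hi (t + 1 + k) (Nat.le_add_right _ k)
    have e1 : ∀ e : ℝ, |E.β ^ k *
        ∫ ω, |utility E (U₀.freeNoise t) x (t + 1 + k) (Θ (e, ω))| ∂P| = E.β ^ k *
        ∫ ω, |utility E (U₀.freeNoise t) x (t + 1 + k) (Θ (e, ω))| ∂P := fun e =>
      abs_of_nonneg (mul_nonneg (pow_nonneg hβ k) (integral_nonneg fun ω => abs_nonneg _))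
    simp_rw [e1]
    rw [integral_const_mul]
    congr 1
    exact (integral_map hΘ.aemeasurable (h1 _ (Nat.le_add_right _ k)).1.norm).trans
      (integral_prod _ hk.abs)
  have hae := (ae_summable_of_summable_integral_abs hi' hsum).1
  have hint : ∀ᵐ e ∂F, ∀ k, t + 1 ≤ k →
      Integrable (fun ω => utility E (U₀.freeNoise t) x k (Θ (e, ω))) P := by
    refine ae_all_iff.2 fun k => ?_
    by_cases hk : t + 1 ≤ k
    · filter_upwards [(hi k hk).prod_right_ae] with e he _ using he
    · exact ae_of_all _ fun e h => absurd h hk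
  filter_upwards [hae, hint] with e h3 h4
  have hu := (M.isPullback fun ω => r * U.V t ω + s * e).utility (E := E) x
  refine ⟨fun k hk => by rw [hu]; exact h4 k hk, ?_⟩
  simp_rw [hu]
  exact summable_abs_iff.1 h3

/-- An informed consumer who imitates a garbled plan attains at most her value. -/
theorem setIntegral_lifetime_le (M : GarblingModel P U U₀ π t F r s) (hE : E.Regular)
    (hle : ∀ e, (freeInfo U₀ t H₀ h).comap (fun ω => (π ω, r * U.V t ω + s * e)) ≤ Hq)
    (hwp : WellPosed E U P (t + 1) (a₀ ∘ π) Hq) (hH₀ : H₀ ≤ m₀)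
    (hx : AdaptedPlan E (U₀.freeNoise t) (t + 1) (a₀ ∘ Prod.fst) (freeInfo U₀ t H₀ h) x)
    (hadm : ∀ᵐ e ∂F, ∀ k, t < k → ∀ᵐ ω ∂P, Admissible E x k (π ω, r * U.V t ω + s * e))
    (hfin : FiniteUtility E (U₀.freeNoise t) (P.map fun ω => (π ω, U.V t ω)) (t + 1) x)
    {C : Set (Ω₀ × ℝ)} (hC : MeasurableSet[freeInfo U₀ t H₀ h] C) :
    ∫ q in C, lifetime E (U₀.freeNoise t) x (t + 1) q ∂(P.map fun ω => (π ω, U.V t ω)) ≤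
      ∫ p in {p : ℝ × Ω | (π p.2, r * U.V t p.2 + s * p.1) ∈ C},
        value E U P (t + 1) (a₀ ∘ π) Hq p.2 ∂(F.prod P) := by
  have := M.prob
  have hπ := M.π_measurable
  have hV := M.noise_measurable
  have hβ := hE.standing.β_pos.le
  have hfin' := M.ae_finiteUtility hβ hfin
  have hL := hfin.integrable hβ
  have hC' := M.freeInfo_le hH₀ h _ hC
  set Θ : ℝ × Ω → Ω₀ × ℝ := fun p => (π p.2, r * U.V t p.2 + s * p.1)
  have hΘ : Measurable Θ := by fun_prop
  have hv := (hwp.value_spec hE).2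
  set v := value E U P (t + 1) (a₀ ∘ π) Hq
  rw [M.map_eq] at hL ⊢
  have hLΘ : Integrable (fun p : ℝ × Ω => lifetime E (U₀.freeNoise t) x (t + 1)
      (π p.2, r * U.V t p.2 + s * p.1)) (F.prod P) := (integrable_map_measure hL.1 hΘ.aemeasurable).1 hL
  rw [setIntegral_map hC' hL.1 hΘ.aemeasurable]
  change ∫ p in Θ ⁻¹' C, _ ∂(F.prod P) ≤ ∫ p in Θ ⁻¹' C, _ ∂(F.prod P)
  have hS : MeasurableSet (Θ ⁻¹' C) := hΘ hC'
  have hv2 : Integrable (fun p : ℝ × Ω => v p.2) (F.prod P) := hv.comp_snd F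
  rw [← integral_indicator hS, ← integral_indicator hS,
    integral_prod _ (hLΘ.indicator hS), integral_prod _ (hv2.indicator hS)]
  refine integral_mono_ae (hLΘ.indicator hS).integral_prod_left
    (hv2.indicator hS).integral_prod_left ?_
  -- For frozen `e` the imitating plan is adapted to `Hq` and competes with all plans of the
  -- informed consumer. Randomization enters only through the outer integral over `e`.
  filter_upwards [hadm, hfin'] with e h1 h2
  have hpb := M.isPullback fun ω => r * U.V t ω + s * e
  have hSe : MeasurableSet[Hq] ((fun ω => Θ (e, ω)) ⁻¹' C) := hle e _ ⟨C, hC, rfl⟩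
  have hfeas : Feasible E U P (t + 1) (a₀ ∘ π) Hq
      (x.comp fun ω => (π ω, r * U.V t ω + s * e)) :=
    Feasible.mono_left (feasible_iff.2 ⟨hx.comp hpb, fun k hk => (h1 k hk).mono fun ω hω =>
        ⟨hω.o, hω.b, hω.n, hω.c, hω.borrowing, hω.budget⟩⟩) (hle e)
  have key := hwp.setIntegral_lifetime_le hE hfeas h2 hSe
  rw [hpb.lifetime, ← integral_indicator (hwp.le _ hSe), ← integral_indicator (hwp.le _ hSe)] at key
  exact key

end Transfer

/-- **Blackwell's comparison**: on every event known beforehand, the value after the more precise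
signal is at least the value after the less precise one. -/
theorem setIntegral_value_le [IsProbabilityMeasure P] (M : GarblingModel P U U₀ π t F r s)
    (hE : E.Regular) {a₀ : Ω₀ → ℝ} {h h' : ℝ} (hh' : 0 < h') (hr : r = h / h') (hH₀ : H₀ ≤ m₀)
    (ha₀ : Measurable[H₀] a₀)
    (hp : WellPosed E U P (t + 1) (a₀ ∘ π) (U.learn t (H₀.comap π) fun _ => h))
    (hq : WellPosed E U P (t + 1) (a₀ ∘ π) (U.learn t (H₀.comap π) fun _ => h'))
    {B : Set Ω} (hB : MeasurableSet[H₀.comap π] B) :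
    ∫ ω in B, value E U P (t + 1) (a₀ ∘ π) (U.learn t (H₀.comap π) fun _ => h) ω ∂P ≤
      ∫ ω in B, value E U P (t + 1) (a₀ ∘ π) (U.learn t (H₀.comap π) fun _ => h') ω ∂P := by
  have := M.prob
  have hπ := M.π_measurable
  have hV := M.noise_measurable
  have hβ := hE.standing.β_pos.le
  have hvp := hp.value_spec hE
  have hvq := (hq.value_spec hE).2
  have hj := M.comap_freeInfo (H₀ := H₀) h
  have hG := M.freeInfo_le hH₀ h
  set v := value E U P (t + 1) (a₀ ∘ π) (U.learn t (H₀.comap π) fun _ => h)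
  set v' := value E U P (t + 1) (a₀ ∘ π) (U.learn t (H₀.comap π) fun _ => h')
  set j : Ω → Ω₀ × ℝ := fun ω => (π ω, U.V t ω)
  have hjm : Measurable j := by fun_prop
  set Θ : ℝ × Ω → Ω₀ × ℝ := fun p => (π p.2, r * U.V t p.2 + s * p.1)
  have hΘ : Measurable Θ := by fun_prop
  have hmap : P.map j = (F.prod P).map Θ := M.map_eq
  have hv2 : Integrable (fun p : ℝ × Ω => v' p.2) (F.prod P) := hvq.comp_snd F
  have hK : (freeInfo U₀ t H₀ h).comap Θ ≤ Prod.instMeasurableSpace :=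
    (MeasurableSpace.comap_mono hG).trans hΘ.comap_le
  -- Here `w ∘ Θ` is the informed value conditioned on what a less informed consumer sees in the
  -- garbled world. As a function on `Ω₀ × ℝ`, `w` can be transferred to the actual world through
  -- `j`, because `j` and `Θ` have the same law.
  obtain ⟨w, hw, hwΘ⟩ : ∃ w, Measurable[freeInfo U₀ t H₀ h] w ∧
      (F.prod P)[fun p : ℝ × Ω => v' p.2 | (freeInfo U₀ t H₀ h).comap Θ] = w ∘ Θ :=
    Measurable.exists_eq_measurable_comp (mY := freeInfo U₀ t H₀ h)
      stronglyMeasurable_condExp.measurable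
  have hw' : AEStronglyMeasurable w (P.map j) := (hw.mono hG le_rfl).aestronglyMeasurable
  have hwi : Integrable w (P.map j) := by
    rw [hmap] at hw' ⊢
    rw [integrable_map_measure hw' hΘ.aemeasurable, ← hwΘ]
    exact integrable_condExp
  have hwj : Integrable (w ∘ j) P := (integrable_map_measure hw' hjm.aemeasurable).1 hwi
  have hwC : ∀ C, MeasurableSet[freeInfo U₀ t H₀ h] C →
      ∫ ω in j ⁻¹' C, (w ∘ j) ω ∂P = ∫ p in Θ ⁻¹' C, v' p.2 ∂(F.prod P) := by
    intro C hC
    rw [← setIntegral_condExp hK hv2 ⟨C, hC, rfl⟩, hwΘ]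
    have e1 := setIntegral_map (hG _ hC) hw' hjm.aemeasurable
    rw [hmap] at hw' e1
    have e2 := setIntegral_map (hG _ hC) hw' hΘ.aemeasurable
    exact e1.symm.trans e2
  -- By minimality of the essential supremum it is enough to compare single plans. Each is rewritten
  -- as a plan `y` on `Ω₀ × ℝ`, so that its noise can be exchanged.
  have hvw : v ≤ᵐ[P] w ∘ j := by
    refine hvp.1.2.2 _ (by rw [← hj]; exact measurable_comp_of_comap hw j) ?_
    rintro _ ⟨x, hx, hx', rfl⟩
    refine ae_le_of_setIntegral_le_of_measurable hp.le stronglyMeasurable_condExp.measurable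
      (by rw [← hj]; exact measurable_comp_of_comap hw j) integrable_condExp hwj fun B hB => ?_
    rw [setIntegral_condExp hp.le (hx'.integrable hβ) hB]
    rw [← hj] at hB
    obtain ⟨C, hC, rfl⟩ := hB
    rw [hwC C hC]
    have hpb := M.isPullback (U.V t)
    have hxa : AdaptedPlan E U (t + 1) ((a₀ ∘ Prod.fst) ∘ j) ((freeInfo U₀ t H₀ h).comap j) x := by
      rw [hj]; exact hx.adapted
    set y := liftPlan E (U₀.freeNoise t) j (t + 1) (a₀ ∘ Prod.fst) (freeInfo U₀ t H₀ h) x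
    have hy : AdaptedPlan E (U₀.freeNoise t) (t + 1) (a₀ ∘ Prod.fst) (freeInfo U₀ t H₀ h) y :=
      adaptedPlan_liftPlan x
    have hagree : x.AgreeFrom (t + 1) (y.comp j) := hxa.agreeFrom_lift hpb
    have hinfo : ∀ k, info E (U₀.freeNoise t) y (t + 1) (freeInfo U₀ t H₀ h) k ≤
        Prod.instMeasurableSpace := fun k =>
      hy.info_le hE.standing.hbar_measurable M.ψ_measurable (M.A_measurable.comp measurable_fst)
        (fun i hi _ => M.freeNoise_V_measurable hi) hG
    have hya : ∀ k, t < k → Measurable (y.a k) := by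
      intro k hk
      rcases Nat.lt_or_ge (t + 1) k with h1 | h1
      · obtain ⟨i, rfl⟩ := Nat.exists_eq_succ_of_ne_zero (Nat.ne_zero_of_lt h1)
        exact (hy.a i (Nat.le_of_lt_succ h1)).mono (hinfo i) le_rfl
      · obtain rfl : k = t + 1 := le_antisymm h1 hk
        rw [hy.start]
        exact (ha₀.mono hH₀ le_rfl).comp measurable_fst
    have hu : ∀ k, t + 1 ≤ k → utility E U x k = utility E (U₀.freeNoise t) y k ∘ j :=
      fun k hk => by rw [hagree.utility hk, hpb.utility]
    have hum : ∀ k, t + 1 ≤ k → Measurable (utility E (U₀.freeNoise t) y k) := fun k hk =>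
      measurable_utility (M.A_measurable.comp measurable_fst) ((hy.o k hk).mono (hinfo k) le_rfl)
        ((hy.b k hk).mono (hinfo k) le_rfl) ((hy.n k hk).mono (hinfo k) le_rfl)
        ((hy.c k hk).mono (hinfo k) le_rfl)
    have hfin : FiniteUtility E (U₀.freeNoise t) (P.map j) (t + 1) y := by
      refine ⟨fun k hk => ?_, hx'.2.congr fun k => ?_⟩
      · rw [integrable_map_measure (hum k hk).aestronglyMeasurable hjm.aemeasurable, ← hu k hk]
        exact hx'.1 k hk
      · rw [integral_map hjm.aemeasurable
          (hum _ (Nat.le_add_right _ k)).abs.aestronglyMeasurable, hu _ (Nat.le_add_right _ k)]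
        rfl
    have hadm := M.ae_admissible (E := E) (x := y)
      (fun k hk => measurableSet_admissible ((hy.o k hk).mono (hinfo k) le_rfl)
        ((hy.b k hk).mono (hinfo k) le_rfl) ((hy.n k hk).mono (hinfo k) le_rfl)
        ((hy.c k hk).mono (hinfo k) le_rfl) (hya k hk) (hya _ (hk.trans (Nat.lt_succ_self k))))
      fun k hk => (hx.admissible hk).mono fun ω hω => by
        obtain ⟨k1, k2, k3, k4, k5, k6⟩ := hagree.admissible hk hω
        exact ⟨k1, k2, k3, k4, k5, k6⟩
    have key := M.setIntegral_lifetime_le hE (fun e => M.comap_freeInfo_le hh' hr e) hq hH₀ hy hadm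
      hfin hC
    have e1 := setIntegral_map (hG _ hC) (hfin.integrable hβ).1 hjm.aemeasurable
    have e2 : lifetime E U x (t + 1) = lifetime E (U₀.freeNoise t) y (t + 1) ∘ j := by
      ext ω
      simp only [lifetime, Function.comp]
      congr 1
      ext k
      rw [hu _ (Nat.le_add_right _ k)]
      rfl
    rw [e2]
    exact e1.symm.trans_le key
  -- An event known before the signal does not involve the noise coordinate, so on it the averaging
  -- over `e` disappears.
  obtain ⟨B₀, hB₀, rfl⟩ := hB
  have hC : MeasurableSet[freeInfo U₀ t H₀ h] (Prod.fst ⁻¹' B₀) :=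
    (le_sup_left : H₀.comap Prod.fst ≤ freeInfo U₀ t H₀ h) _ ⟨B₀, hB₀, rfl⟩
  have h1 : ∫ ω in π ⁻¹' B₀, v ω ∂P ≤ ∫ ω in j ⁻¹' (Prod.fst ⁻¹' B₀), (w ∘ j) ω ∂P :=
    setIntegral_mono_ae hvp.2.integrableOn hwj.integrableOn hvw
  rw [hwC _ hC] at h1
  refine h1.trans_eq ?_
  have e3 : Θ ⁻¹' (Prod.fst ⁻¹' B₀) = Prod.snd ⁻¹' (π ⁻¹' B₀) := rfl
  have hsnd : (F.prod P).map Prod.snd = P := measurePreserving_snd.map_eq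
  have e4 := setIntegral_map (μ := F.prod P) (g := Prod.snd) (f := v') (hπ (hH₀ _ hB₀))
    (by rw [hsnd]; exact hvq.1) measurable_snd.aemeasurable
  rw [hsnd] at e4
  rw [e3, e4]

end GarblingModel

end Garbling

/-! ### Value of precision and asymptotic learning -/

section Learning

variable {Ω : Type*} {F₁ mΩ : MeasurableSpace Ω} {P : Measure Ω} {E : Economy} {U : Uncertainty Ω}
  {x : Plan Ω} {a₀ : Ω → ℝ} {t : ℕ}

/-- Everything determined before the noise of period `t`. -/
@[reducible] def Uncertainty.past (U : Uncertainty Ω) (F₁ : MeasurableSpace Ω) (t : ℕ) :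
    MeasurableSpace Ω :=
  F₁ ⊔ MeasurableSpace.comap U.A inferInstance ⊔
    ⨆ s : {s : ℕ // s < t}, MeasurableSpace.comap (U.V s) inferInstance

/-- Everything but the noise of period `t`. -/
@[reducible] def Uncertainty.others (U : Uncertainty Ω) (F₁ : MeasurableSpace Ω) (t : ℕ) :
    MeasurableSpace Ω :=
  F₁ ⊔ MeasurableSpace.comap U.A inferInstance ⊔
    ⨆ s : {s : ℕ // s ≠ t}, MeasurableSpace.comap (U.V s) inferInstance

theorem Uncertainty.past_le_others : U.past F₁ t ≤ U.others F₁ t := by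
  refine sup_le le_sup_left (le_sup_of_le_right (iSup_le ?_))
  rintro ⟨s, hs⟩
  exact le_iSup (fun s : {s : ℕ // s ≠ t} => MeasurableSpace.comap (U.V s) inferInstance)
    ⟨s, hs.ne⟩

theorem Uncertainty.measurable_A_past : Measurable[U.past F₁ t] U.A :=
  Measurable.mono (comap_measurable U.A) (le_sup_of_le_left le_sup_right) le_rfl

theorem Uncertainty.measurable_V_past {r : ℕ} (h : r < t) : Measurable[U.past F₁ t] (U.V r) :=
  Measurable.mono (comap_measurable (U.V r)) (le_sup_of_le_right
    (le_iSup (fun s : {s : ℕ // s < t} => MeasurableSpace.comap (U.V s) inferInstance) ⟨r, h⟩))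
    le_rfl

theorem Uncertainty.measurable_V_others {r : ℕ} (h : r ≠ t) : Measurable[U.others F₁ t] (U.V r) :=
  Measurable.mono (comap_measurable (U.V r)) (le_sup_of_le_right
    (le_iSup (fun s : {s : ℕ // s ≠ t} => MeasurableSpace.comap (U.V s) inferInstance) ⟨r, h⟩))
    le_rfl

theorem Uncertainty.Standing.past_le (hU : U.Standing F₁ P) (hF : F₁ ≤ mΩ) : U.past F₁ t ≤ mΩ :=
  sup_le (sup_le hF hU.A_measurable.comap_le) (iSup_le fun s => (hU.V_measurable s).comap_le)

theorem Uncertainty.Standing.others_le (hU : U.Standing F₁ P) (hF : F₁ ≤ mΩ) :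
    U.others F₁ t ≤ mΩ :=
  sup_le (sup_le hF hU.A_measurable.comap_le) (iSup_le fun s => (hU.V_measurable s).comap_le)

/-- Continuation plans also use later signals, so the comparison needs the noise of period `t` to be
independent of future noise too, not only of the past. -/
theorem Uncertainty.Standing.indep_others [IsProbabilityMeasure P] (hU : U.Standing F₁ P)
    (hF : F₁ ≤ mΩ) (t : ℕ) :
    Indep (MeasurableSpace.comap (U.V t) inferInstance) (U.others F₁ t) P :=
  indep_others_of_indep_past (sup_le hF hU.A_measurable.comap_le)
    (m := fun t => MeasurableSpace.comap (U.V t) inferInstance)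
    (fun s => (hU.V_measurable s).comap_le) hU.V_indep t

theorem AdaptedPlan.info_le_past (hE : E.Standing) (hU : U.Standing F₁ P)
    (hx : AdaptedPlan E U 0 a₀ F₁ x) (t : ℕ) : info E U x 0 F₁ t ≤ U.past F₁ t :=
  hx.info_le hE.hbar_measurable hU.ψ_measurable Uncertainty.measurable_A_past
    (fun _ _ h => Uncertainty.measurable_V_past h) (le_sup_of_le_left le_sup_left)

theorem AdaptedPlan.info_le_ambient (hE : E.Standing) (hU : U.Standing F₁ P) (hF : F₁ ≤ mΩ)
    (hx : AdaptedPlan E U 0 a₀ F₁ x) (t : ℕ) : info E U x 0 F₁ t ≤ mΩ :=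
  (hx.info_le_past hE hU t).trans (hU.past_le hF)

theorem Uncertainty.Standing.learn_le (hU : U.Standing F₁ P) {H : MeasurableSpace Ω} (hH : H ≤ mΩ)
    {η : Ω → ℝ} (hη : Measurable[H] η) : U.learn t H η ≤ mΩ :=
  U.learn_le hU.ψ_measurable hU.A_measurable (hU.V_measurable t) (hη.mono hH le_rfl) hH

theorem Feasible.wellPosed_learn [IsProbabilityMeasure P] {H : MeasurableSpace Ω} (hE : E.Regular)
    (hU : U.Standing F₁ P) (hx : Feasible E U P t a₀ H x) (ha : ∃ C, ∀ᵐ ω ∂P, |a₀ ω| ≤ C)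
    (hH : H ≤ mΩ) {η : Ω → ℝ} (hη : Measurable[H] η) :
    WellPosed E U P (t + 1) (x.a (t + 1)) (U.learn t H η) := by
  have hm : Measurable[H] (x.a (t + 1)) := by
    have := hx.a_adapted t le_rfl
    rwa [info_self] at this
  exact (hx.tail (Nat.le_succ t)).wellPosed hE
    (hx.exists_wealth_bound hE.standing ha (Nat.le_succ t)) (hm.mono le_sup_left le_rfl)
    (hU.learn_le hH hη)

theorem Feasible.wellPosed_learn_info [IsProbabilityMeasure P] {a₁ : ℝ} (hE : E.Regular)
    (hU : U.Standing F₁ P) (hF : F₁ ≤ mΩ) (hx : Feasible E U P 0 (fun _ => a₁) F₁ x) (t : ℕ)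
    {η : Ω → ℝ} (hη : Measurable[info E U x 0 F₁ t] η) :
    WellPosed E U P (t + 1) (x.a (t + 1)) (U.learn t (info E U x 0 F₁ t) η) :=
  (hx.tail (Nat.zero_le t)).wellPosed_learn hE hU
    (hx.exists_wealth_bound hE.standing ⟨|a₁|, ae_of_all _ fun _ => le_rfl⟩ (Nat.zero_le t))
    (hx.adapted.info_le_ambient hE.standing hU hF t) hη

/-- A more precise signal never lowers the expected continuation value. -/
theorem Feasible.condExp_value_mono [IsProbabilityMeasure P] {a₁ : ℝ} (hE : E.Regular)
    (hU : U.Standing F₁ P) (hF : F₁ ≤ mΩ) (hx : Feasible E U P 0 (fun _ => a₁) F₁ x) (t : ℕ)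
    {h h' : ℝ} (h0 : 0 ≤ h) (hh' : h < h') :
    P[value E U P (t + 1) (x.a (t + 1))
        (U.learn t (info E U x 0 F₁ t) fun _ => h) | info E U x 0 F₁ t]
      ≤ᵐ[P]
    P[value E U P (t + 1) (x.a (t + 1))
        (U.learn t (info E U x 0 F₁ t) fun _ => h') | info E U x 0 F₁ t] := by
  have h'0 : 0 < h' := h0.trans_lt hh'
  set H := info E U x 0 F₁ t
  have hH : H ≤ mΩ := hx.adapted.info_le_ambient hE.standing hU hF t
  have hp := hx.wellPosed_learn_info hE hU hF t (η := fun _ => h) measurable_const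
  have hq := hx.wellPosed_learn_info hE hU hF t (η := fun _ => h') measurable_const
  -- The noise is scaled by `r = h / h'`; the weight of the fresh noise restores unit variance.
  have hr : (h / h') ^ 2 + √(1 - (h / h') ^ 2) ^ 2 = 1 := by
    rw [Real.sq_sqrt]
    · ring
    · have h1 : h / h' ≤ 1 := (div_le_one h'0).2 hh'.le
      have h2 : 0 ≤ h / h' := div_nonneg h0 h'0.le
      nlinarith
  -- The background space is `Ω` itself with the σ-algebra of everything except the noise of period
  -- `t`, and `π` is the identity. No product structure on `Ω` is needed.
  have M : @GarblingModel Ω Ω mΩ P (U.others F₁ t) U U id t U.F (h / h')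
      (√(1 - (h / h') ^ 2)) := by
    refine @GarblingModel.mk Ω Ω mΩ P (U.others F₁ t) U U id t U.F _ _ ?_ rfl rfl
      (fun _ _ => rfl) ?_ hU.ψ_measurable ?_ (hU.V_measurable t) hU.F_stable.prob (hU.V_law t) ?_
      (hU.F_stable.map_rotate hr)
    · exact measurable_id'' (hU.others_le hF)
    · exact Uncertainty.measurable_A_past.mono Uncertainty.past_le_others le_rfl
    · exact fun k hk => Uncertainty.measurable_V_others hk.ne'
    · have := (hU.indep_others hF t).symm
      rw [← MeasurableSpace.comap_id (m := U.others F₁ t)] at this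
      exact this
  have hm : Measurable[H] (x.a (t + 1)) := hx.a_adapted t (Nat.zero_le t)
  have key := @GarblingModel.setIntegral_value_le Ω Ω H mΩ P (U.others F₁ t) U U id t U.F _ _ E _ M
    hE (x.a (t + 1)) h h' h'0 rfl
    ((hx.adapted.info_le_past hE.standing hU t).trans Uncertainty.past_le_others) hm
  simp only [MeasurableSpace.comap_id, Function.comp_id] at key
  refine ae_le_of_setIntegral_le_of_measurable hH stronglyMeasurable_condExp.measurable
    stronglyMeasurable_condExp.measurable integrable_condExp integrable_condExp fun B hB => ?_
  rw [setIntegral_condExp hH (hp.value_spec hE).2 hB,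
    setIntegral_condExp hH (hq.value_spec hE).2 hB]
  exact key hp hq (by rw [MeasurableSpace.comap_id]; exact hB)

/-- The noise of period `j`, if the signal of that period is informative. -/
def effectiveNoise (E : Economy) (U : Uncertainty Ω) (x : Plan Ω) (j : ℕ) (ω : Ω) : ℝ :=
  if precision E x j ω = 0 then 0 else U.V j ω

theorem precision_mul_signal (j : ℕ) (ω : Ω) :
    precision E x j ω * U.signal j (precision E x j) ω =
      precision E x j ω * U.ψ (U.A ω) + effectiveNoise E U x j ω := by
  by_cases h : precision E x j ω = 0
  · simp [effectiveNoise, h]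
  · simp only [Uncertainty.signal, effectiveNoise, h, if_false]
    field_simp

theorem Uncertainty.Standing.memLp_V [IsProbabilityMeasure P] (hU : U.Standing F₁ P) (j : ℕ) :
    MemLp (U.V j) 2 P := by
  have h := hU.F_stable.memLp
  rw [← hU.V_law j] at h
  exact h.comp_of_map (hU.V_measurable j).aemeasurable

theorem Uncertainty.Standing.integral_V (hU : U.Standing F₁ P) (j : ℕ) :
    ∫ ω, U.V j ω ∂P = 0 := by
  rw [← hU.F_stable.mean, ← hU.V_law j]
  exact (integral_map (f := fun z : ℝ => z) (hU.V_measurable j).aemeasurable (by fun_prop)).symm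

theorem Uncertainty.Standing.integral_V_sq (hU : U.Standing F₁ P) (j : ℕ) :
    ∫ ω, U.V j ω ^ 2 ∂P = 1 := by
  rw [← hU.F_stable.variance, ← hU.V_law j,
    integral_map (hU.V_measurable j).aemeasurable (by fun_prop)]

theorem AdaptedPlan.measurable_precision (hE : E.Standing) (hx : AdaptedPlan E U 0 a₀ F₁ x)
    (j : ℕ) : Measurable[info E U x 0 F₁ j] (precision E x j) :=
  _root_.measurable_precision hE.hbar_measurable (hx.b j (Nat.zero_le j)) (hx.n j (Nat.zero_le j))

theorem AdaptedPlan.measurable_effectiveNoise (hE : E.Standing) (hU : U.Standing F₁ P)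
    (hx : AdaptedPlan E U 0 a₀ F₁ x) {i j : ℕ} (hij : i < j) :
    Measurable[U.past F₁ j] (effectiveNoise E U x i) := by
  have hp : Measurable[U.past F₁ j] (precision E x i) :=
    (hx.measurable_precision hE i).mono
      ((info_mono hij.le).trans (hx.info_le_past hE hU j)) le_rfl
  exact Measurable.ite (hp (measurableSet_singleton 0)) measurable_const
    (Uncertainty.measurable_V_past hij)

/-- The effective noise is uncorrelated over time. -/
theorem AdaptedPlan.integral_sum_effectiveNoise_sq_le [IsProbabilityMeasure P] (hE : E.Standing)
    (hU : U.Standing F₁ P) (hF : F₁ ≤ mΩ) (hx : AdaptedPlan E U 0 a₀ F₁ x) (N : ℕ) :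
    MemLp (fun ω => ∑ j ∈ Finset.range N, effectiveNoise E U x j ω) 2 P ∧
      ∫ ω, (∑ j ∈ Finset.range N, effectiveNoise E U x j ω) ^ 2 ∂P ≤ N := by
  have hem : ∀ j, Measurable (effectiveNoise E U x j) := fun j =>
    (hx.measurable_effectiveNoise hE hU (Nat.lt_succ_self j)).mono (hU.past_le hF) le_rfl
  have he : ∀ j, MemLp (effectiveNoise E U x j) 2 P := fun j =>
    (hU.memLp_V j).mono (hem j).aestronglyMeasurable <| ae_of_all _ fun ω => by
      simp only [effectiveNoise]
      split_ifs <;> simp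
  have hM : ∀ N, MemLp (fun ω => ∑ j ∈ Finset.range N, effectiveNoise E U x j ω) 2 P := fun N =>
    memLp_finsetSum _ fun j _ => he j
  refine ⟨hM N, ?_⟩
  induction N with
  | zero => simp
  | succ N ih =>
    set S : Ω → ℝ := fun ω => ∑ j ∈ Finset.range N, effectiveNoise E U x j ω
    have hS : MemLp S 2 P := hM N
    have hcross : ∫ ω, S ω * effectiveNoise E U x N ω ∂P = 0 := by
      -- Whether the signal of period `N` is informative is known beforehand. Moving that indicator
      -- into the past factor leaves `V N` times a variable independent of it.
      set T : Ω → ℝ := fun ω => if precision E x N ω = 0 then 0 else S ω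
      have hTm : Measurable[U.past F₁ N] T := by
        have hp : Measurable[U.past F₁ N] (precision E x N) :=
          (hx.measurable_precision hE N).mono (hx.info_le_past hE hU N) le_rfl
        exact Measurable.ite (hp (measurableSet_singleton 0)) measurable_const
          (Finset.measurable_fun_sum _ fun j hj =>
            hx.measurable_effectiveNoise hE hU (Finset.mem_range.1 hj))
      have hind : IndepFun T (U.V N) P :=
        (indep_of_indep_of_le_right (hU.V_indep N) hTm.comap_le).symm
      have e : ∀ ω, S ω * effectiveNoise E U x N ω = T ω * U.V N ω := fun ω => by
        simp only [effectiveNoise, T]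
        split_ifs <;> simp
      simp_rw [e]
      rw [hind.integral_fun_mul_eq_mul_integral
        (hTm.mono (hU.past_le hF) le_rfl).aestronglyMeasurable
        (hU.V_measurable N).aestronglyMeasurable, hU.integral_V, mul_zero]
    have hsq : ∫ ω, effectiveNoise E U x N ω ^ 2 ∂P ≤ 1 := by
      rw [← hU.integral_V_sq N]
      refine integral_mono (he N).integrable_sq (hU.memLp_V N).integrable_sq fun ω => ?_
      simp only [effectiveNoise]
      split_ifs
      · simpa using sq_nonneg _
      · exact le_rfl
    have hexp : ∀ ω, (∑ j ∈ Finset.range (N + 1), effectiveNoise E U x j ω) ^ 2 =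
        S ω ^ 2 + 2 * (S ω * effectiveNoise E U x N ω) + effectiveNoise E U x N ω ^ 2 := fun ω => by
      rw [Finset.sum_range_succ]; ring
    have hSe : Integrable (fun ω => S ω * effectiveNoise E U x N ω) P := hS.integrable_mul (he N)
    have i1 : Integrable (fun ω => S ω ^ 2 + 2 * (S ω * effectiveNoise E U x N ω)) P :=
      hS.integrable_sq.add (hSe.const_mul 2)
    simp_rw [hexp]
    rw [integral_add i1 (he N).integrable_sq, integral_add hS.integrable_sq (hSe.const_mul 2),
      integral_const_mul, hcross]
    push_cast
    linarith

/-- The average over `(k + 1) ^ 2` periods has second moment at most `1 / (k + 1) ^ 2`, which is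
summable. Squares suffice, since one subsequence of weighted averages already identifies `ψ(A)`. -/
theorem AdaptedPlan.ae_tendsto_effectiveNoise [IsProbabilityMeasure P] (hE : E.Standing)
    (hU : U.Standing F₁ P) (hF : F₁ ≤ mΩ) (hx : AdaptedPlan E U 0 a₀ F₁ x) :
    ∀ᵐ ω ∂P, Tendsto (fun k : ℕ => (∑ j ∈ Finset.range ((k + 1) ^ 2), effectiveNoise E U x j ω) /
      ((k + 1) ^ 2 : ℕ)) atTop (𝓝 0) := by
  set R : ℕ → Ω → ℝ := fun k ω =>
    (∑ j ∈ Finset.range ((k + 1) ^ 2), effectiveNoise E U x j ω) / ((k + 1) ^ 2 : ℕ)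
  have h1 : ∀ k, Integrable (fun ω => R k ω ^ 2) P := fun k => by
    simp only [R, div_pow]
    exact (hx.integral_sum_effectiveNoise_sq_le hE hU hF _).1.integrable_sq.div_const _
  have h2 : Summable fun k => ∫ ω, |R k ω ^ 2| ∂P := by
    have hs : Summable fun k : ℕ => 1 / ((k + 1 : ℕ) : ℝ) ^ 2 :=
      (summable_nat_add_iff 1).2 (Real.summable_one_div_nat_pow.2 one_lt_two)
    refine hs.of_nonneg_of_le (fun k => integral_nonneg fun ω => abs_nonneg _) fun k => ?_
    have := (hx.integral_sum_effectiveNoise_sq_le hE hU hF ((k + 1) ^ 2)).2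
    simp_rw [abs_sq]
    simp only [R, div_pow]
    rw [integral_div, div_le_div_iff₀ (by positivity) (by positivity)]
    push_cast at this ⊢
    nlinarith [sq_nonneg ((k : ℝ) + 1)]
  filter_upwards [(ae_summable_of_summable_integral_abs h1 h2).1] with ω hω
  have h3 := hω.tendsto_atTop_zero
  simp only [abs_sq] at h3
  have h4 := (Real.continuous_sqrt.tendsto 0).comp h3
  simp only [Function.comp_def, Real.sqrt_sq_eq_abs, Real.sqrt_zero] at h4
  exact (tendsto_zero_iff_abs_tendsto_zero _).2 h4

/-- With sufficient incentives to learn, the transformed quality is revealed in the limit. -/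
theorem Feasible.exists_measurable_ae_eq [IsProbabilityMeasure P] (hE : E.Standing)
    (hU : U.Standing F₁ P) (hF : F₁ ≤ mΩ) (hx : Feasible E U P 0 a₀ F₁ x)
    (hlim : ∀ᵐ ω ∂P, limsup (fun N : ℕ =>
      (N : ℝ≥0∞) / ENNReal.ofReal (∑ j ∈ Finset.range N, precision E x j ω)) atTop < ⊤) :
    ∃ A' : Ω → ℝ, Measurable[⨆ N, info E U x 0 F₁ N] A' ∧ U.A =ᵐ[P] A' := by
  set H := ⨆ N, info E U x 0 F₁ N
  have hle : ∀ N, info E U x 0 F₁ N ≤ H := fun N => le_iSup (info E U x 0 F₁) N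
  -- A measurable function on all of `ℝ` that inverts `ψ` on the possible qualities.
  obtain ⟨g, hg, hgψ⟩ := hU.ψ_embedding.exists_measurable_extend
    (g := fun y : U.supp => (y : ℝ)) measurable_subtype_coe fun _ => ⟨0⟩
  -- Precision-weighting cancels the factor `1 / η` of the noise, so the error is a plain sum of
  -- effective noises over total precision.
  set R : ℕ → Ω → ℝ := fun k ω =>
    (∑ j ∈ Finset.range ((k + 1) ^ 2), precision E x j ω * U.signal j (precision E x j) ω) /
      ∑ j ∈ Finset.range ((k + 1) ^ 2), precision E x j ω
  have hpm : ∀ j, Measurable[H] (precision E x j) := fun j =>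
    (hx.adapted.measurable_precision hE j).mono (hle j) le_rfl
  have hZm : ∀ j, Measurable[H] (U.signal j (precision E x j)) := fun j => by
    refine Measurable.mono (comap_measurable _) (le_trans ?_ (hle (j + 1))) le_rfl
    rw [info_succ (Nat.zero_le j)]
    exact le_sup_right
  have hRm : ∀ k, Measurable[H] (R k) := fun k =>
    (Finset.measurable_fun_sum _ fun j _ => (hpm j).mul (hZm j)).div
      (Finset.measurable_fun_sum _ fun j _ => hpm j)
  refine ⟨fun ω => g (limsup (fun k => R k ω) atTop), hg.comp (Measurable.limsup hRm), ?_⟩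
  have hbn : ∀ᵐ ω ∂P, ∀ j, 0 ≤ precision E x j ω := ae_all_iff.2 fun j =>
    (hx.admissible (Nat.zero_le j)).mono fun ω h => hE.hbar_nonneg _ _ h.b h.n
  filter_upwards [hlim, hx.adapted.ae_tendsto_effectiveNoise hE hU hF, hbn] with ω h1 h2 h3
  suffices h : Tendsto (fun k => R k ω) atTop (𝓝 (U.ψ (U.A ω))) by
    rw [h.limsup_eq]
    exact (congrFun hgψ ⟨U.A ω, hU.A_mem ω⟩).symm
  obtain ⟨c, hc1, hc2⟩ := exists_between h1
  have hev := eventually_lt_of_limsup_lt hc1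
  have hsub : Tendsto (fun k : ℕ => (k + 1) ^ 2) atTop atTop :=
    (tendsto_pow_atTop two_ne_zero).comp (tendsto_add_atTop_nat 1)
  have hev' := hsub.eventually hev
  have hbound : ∀ᶠ k : ℕ in atTop, 0 < ∑ j ∈ Finset.range ((k + 1) ^ 2), precision E x j ω ∧
      (((k + 1) ^ 2 : ℕ) : ℝ) ≤
        c.toReal * ∑ j ∈ Finset.range ((k + 1) ^ 2), precision E x j ω := by
    filter_upwards [hev'] with k hk
    set S := ∑ j ∈ Finset.range ((k + 1) ^ 2), precision E x j ω
    have hS : 0 ≤ S := Finset.sum_nonneg fun j _ => h3 j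
    have hN : (((k + 1) ^ 2 : ℕ) : ℝ≥0∞) ≠ 0 := by positivity
    -- In `ℝ≥0∞` a nonzero number divided by `0` is `⊤`, so a quotient below `c` excludes zero total
    -- precision.
    have hS0 : 0 < S := by
      refine lt_of_le_of_ne hS fun h0 => ?_
      rw [← h0, ENNReal.ofReal_zero, ENNReal.div_zero hN] at hk
      exact absurd hk (not_lt.2 le_top)
    refine ⟨hS0, ?_⟩
    have h4 := (ENNReal.div_le_iff (by simpa using hS0) ENNReal.ofReal_ne_top).1 hk.le
    have h5 := ENNReal.toReal_mono (ENNReal.mul_ne_top hc2.ne ENNReal.ofReal_ne_top) h4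
    rwa [ENNReal.toReal_natCast, ENNReal.toReal_mul, ENNReal.toReal_ofReal hS] at h5
  rw [tendsto_iff_dist_tendsto_zero]
  have h5 : Tendsto (fun k : ℕ => c.toReal *
      |(∑ j ∈ Finset.range ((k + 1) ^ 2), effectiveNoise E U x j ω) / ((k + 1) ^ 2 : ℕ)|) atTop
      (𝓝 0) := by
    simpa using h2.abs.const_mul c.toReal
  refine squeeze_zero' (Eventually.of_forall fun _ => dist_nonneg) ?_ h5
  filter_upwards [hbound] with k hk
  obtain ⟨hS, hk⟩ := hk
  have e : R k ω - U.ψ (U.A ω) = (∑ j ∈ Finset.range ((k + 1) ^ 2), effectiveNoise E U x j ω) /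
      ∑ j ∈ Finset.range ((k + 1) ^ 2), precision E x j ω := by
    simp only [R, precision_mul_signal, Finset.sum_add_distrib]
    rw [← Finset.sum_mul]
    field_simp
    ring
  have hN : (0 : ℝ) < ((k + 1) ^ 2 : ℕ) := by positivity
  rw [Real.dist_eq, e, abs_div, abs_div, abs_of_pos hS, abs_of_pos hN, ← mul_div_assoc,
    div_le_div_iff₀ hS hN]
  calc _ ≤ |∑ j ∈ Finset.range ((k + 1) ^ 2), effectiveNoise E U x j ω| *
        (c.toReal * ∑ j ∈ Finset.range ((k + 1) ^ 2), precision E x j ω) :=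
        mul_le_mul_of_nonneg_left hk (abs_nonneg _)
    _ = _ := by ring

/-- With sufficient incentives to learn, beliefs about the quality converge to the truth. -/
theorem Feasible.tendsto_condExp [IsProbabilityMeasure P] (hE : E.Standing)
    (hU : U.Standing F₁ P) (hF : F₁ ≤ mΩ) (hx : Feasible E U P 0 a₀ F₁ x)
    (hlim : ∀ᵐ ω ∂P, limsup (fun N : ℕ =>
      (N : ℝ≥0∞) / ENNReal.ofReal (∑ j ∈ Finset.range N, precision E x j ω)) atTop < ⊤)
    {g : ℝ → ℝ} (hg : Measurable g) (hgi : Integrable (fun ω => g (U.A ω)) P) :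
    (∀ᵐ ω ∂P, Tendsto (fun N => (P[fun ω => g (U.A ω) | info E U x 0 F₁ N]) ω) atTop
      (𝓝 (g (U.A ω)))) ∧
    Tendsto (fun N => ∫ ω, |(P[fun ω => g (U.A ω) | info E U x 0 F₁ N]) ω - g (U.A ω)| ∂P)
      atTop (𝓝 0) := by
  obtain ⟨A', hA', hAA'⟩ := hx.exists_measurable_ae_eq hE hU hF hlim
  let ℱ : Filtration ℕ mΩ :=
    ⟨info E U x 0 F₁, info_mono, hx.adapted.info_le_ambient hE hU hF⟩
  have hm : ⨆ N, ℱ N ≤ mΩ := iSup_le ℱ.le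
  have hgA : (fun ω => g (U.A ω)) =ᵐ[P] g ∘ A' := hAA'.fun_comp g
  -- Lévy's theorem gives convergence to this conditional expectation. It is `g(A)` because `A`
  -- agrees almost surely with a variable known in the limit.
  have hlimit : P[fun ω => g (U.A ω) | ⨆ N, ℱ N] =ᵐ[P] fun ω => g (U.A ω) := by
    refine (condExp_congr_ae hgA).trans ?_
    rw [condExp_of_stronglyMeasurable hm (hg.comp hA').stronglyMeasurable (hgi.congr hgA)]
    exact hgA.symm
  refine ⟨?_, ?_⟩
  · filter_upwards [MeasureTheory.tendsto_ae_condExp (ℱ := ℱ) (μ := P) fun ω => g (U.A ω), hlimit]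
      with ω h1 h2
    rw [h2] at h1
    exact h1
  · have h1 := MeasureTheory.tendsto_eLpNorm_condExp (ℱ := ℱ) (μ := P) fun ω => g (U.A ω)
    have h2 := (ENNReal.tendsto_toReal ENNReal.zero_ne_top).comp h1
    rw [ENNReal.toReal_zero] at h2
    refine h2.congr fun N => ?_
    have hi : Integrable (P[fun ω => g (U.A ω) | ℱ N] - fun ω => g (U.A ω)) P :=
      integrable_condExp.sub hgi
    simp only [Function.comp]
    rw [eLpNorm_congr_ae ((EventuallyEq.refl _ _).sub hlimit), eLpNorm_one_eq_lintegral_enorm,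
      ← integral_norm_eq_lintegral_enorm hi.1]
    rfl

end Learning

/-! ### Wealth differences absorbed by consumption -/

section WealthShift

variable {Ω : Type*} {E : Economy} {U : Uncertainty Ω} {a₀ a' : Ω → ℝ} {H mΩ : MeasurableSpace Ω}
  {P : Measure Ω} {x z : Plan Ω} {t T : ℕ}

/-- Enter period `T` with wealth `a'` instead of `x.a T`, and let consumption of that period absorb
the difference. -/
def Plan.shiftWealth (E : Economy) (T : ℕ) (a' : Ω → ℝ) (x : Plan Ω) : Plan Ω where
  o := x.o
  b := x.b
  n := x.n
  c := Function.update x.c T fun ω => x.c T ω + (1 + E.i T) * (a' ω - x.a T ω)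
  a := Function.update x.a T a'

theorem utility_shiftWealth_self :
    utility E U (x.shiftWealth E T a') T =
      fun ω => utility E U x T ω + (1 + E.i T) * (a' ω - x.a T ω) := by
  ext ω
  simp only [utility, transport, Plan.shiftWealth, Function.update_self]
  ring

theorem utility_shiftWealth_of_ne {s : ℕ} (h : s ≠ T) :
    utility E U (x.shiftWealth E T a') s = utility E U x s := by
  ext ω
  simp [utility, transport, Plan.shiftWealth, h]

theorem info_shiftWealth (s : ℕ) :
    info E U (x.shiftWealth E T a') t H s = info E U x t H s :=
  info_congr rfl fun _ _ _ => ⟨rfl, rfl⟩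

theorem Feasible.shiftWealth (hx : Feasible E U P T a₀ H x) (ha₀ : Measurable[H] a₀)
    (ha' : Measurable[H] a') (hc : ∀ᵐ ω ∂P, 0 ≤ x.c T ω + (1 + E.i T) * (a' ω - a₀ ω)) :
    Feasible E U P T a' H (x.shiftWealth E T a') := by
  obtain rfl := hx.start
  refine feasible_iff.2 ⟨⟨Function.update_self .., ?_, ?_, ?_, ?_, ?_⟩, fun s hs => ?_⟩
  · intro s hs; rw [info_shiftWealth]; exact hx.o_adapted s hs
  · intro s hs; rw [info_shiftWealth]; exact hx.b_adapted s hs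
  · intro s hs; rw [info_shiftWealth]; exact hx.n_adapted s hs
  · intro s hs
    rw [info_shiftWealth]
    rcases hs.eq_or_lt with rfl | hs'
    · simp only [Plan.shiftWealth, Function.update_self]
      exact (hx.c_adapted T le_rfl).add
        (((ha'.sub ha₀).const_mul (1 + E.i T)).mono (le_info T) le_rfl)
    · simp only [Plan.shiftWealth, Function.update_of_ne hs'.ne']
      exact hx.c_adapted s hs
  · intro s hs
    rw [info_shiftWealth]
    simp only [Plan.shiftWealth, Function.update_of_ne (Nat.lt_succ_of_le hs).ne']
    exact hx.a_adapted s hs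
  · filter_upwards [hc, hx.admissible hs] with ω h1 h2
    rcases hs.eq_or_lt with rfl | hs'
    · refine ⟨h2.o, h2.b, h2.n, ?_, ?_, ?_⟩
      · simpa only [Plan.shiftWealth, Function.update_self] using h1
      · simpa only [Plan.shiftWealth, Function.update_of_ne (Nat.lt_succ_self T).ne']
          using h2.borrowing
      · simp only [Plan.shiftWealth, Function.update_self,
          Function.update_of_ne (Nat.lt_succ_self T).ne']
        linarith [h2.budget]
    · refine ⟨h2.o, h2.b, h2.n, ?_, ?_, ?_⟩
      · simpa only [Plan.shiftWealth, Function.update_of_ne hs'.ne'] using h2.c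
      · simpa only [Plan.shiftWealth, Function.update_of_ne (Nat.lt_succ_of_le hs).ne']
          using h2.borrowing
      · simpa only [Plan.shiftWealth, Function.update_of_ne (Nat.lt_succ_of_le hs).ne',
          Function.update_of_ne hs'.ne'] using h2.budget

theorem FiniteUtility.shiftWealth (hβ : E.β ≠ 0) (hx : FiniteUtility E U P T x)
    (hd : Integrable (fun ω => (1 + E.i T) * (a' ω - x.a T ω)) P) :
    FiniteUtility E U P T (x.shiftWealth E T a') := by
  rw [finiteUtility_iff_tail hβ (Nat.le_succ T)] at hx ⊢
  refine ⟨fun s h1 h2 => ?_, (finiteUtility_congr fun s hs =>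
    utility_shiftWealth_of_ne (Nat.lt_of_succ_le hs).ne').2 hx.2⟩
  obtain rfl : s = T := le_antisymm (Nat.lt_succ_iff.1 h2) h1
  rw [utility_shiftWealth_self]
  exact (hx.1 s le_rfl h2).add hd

theorem FiniteUtility.lifetime_shiftWealth (hβ : 0 < E.β) (hx : FiniteUtility E U P T x)
    (hd : Integrable (fun ω => (1 + E.i T) * (a' ω - x.a T ω)) P) :
    lifetime E U (x.shiftWealth E T a') T =ᵐ[P]
      lifetime E U x T + fun ω => (1 + E.i T) * (a' ω - x.a T ω) := by
  filter_upwards [hx.lifetime_eq hβ.le 1, (hx.shiftWealth hβ.ne' hd).lifetime_eq hβ.le 1]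
    with ω h1 h2
  have e : lifetime E U (x.shiftWealth E T a') (T + 1) ω = lifetime E U x (T + 1) ω := by
    unfold lifetime
    refine tsum_congr fun k => ?_
    rw [utility_shiftWealth_of_ne (by omega)]
  rw [Pi.add_apply, h1, h2, e, Finset.sum_range_one, Finset.sum_range_one, add_zero,
    utility_shiftWealth_self]
  ring

/-- Marginal utility of wealth is constant, so a change of wealth that consumption can absorb does
not affect the demand for transportation. -/
theorem Best.shiftWealth [IsProbabilityMeasure P] (hβ : 0 < E.β) (hH : H ≤ mΩ)
    (hx : Best E U P T a₀ H x) (hz : Best E U P T a' H z)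
    (ha₀ : Measurable[H] a₀) (ha' : Measurable[H] a')
    (hi₀ : Integrable a₀ P) (hi' : Integrable a' P)
    (hcx : ∀ᵐ ω ∂P, 0 ≤ x.c T ω + (1 + E.i T) * (a' ω - a₀ ω))
    (hcz : ∀ᵐ ω ∂P, 0 ≤ z.c T ω + (1 + E.i T) * (a₀ ω - a' ω)) :
    Best E U P T a' H (x.shiftWealth E T a') := by
  obtain rfl := hx.feasible.start
  obtain rfl := hz.feasible.start
  have hd : Integrable (fun ω => (1 + E.i T) * (z.a T ω - x.a T ω)) P :=
    (hi'.sub hi₀).const_mul _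
  have hd' : Integrable (fun ω => (1 + E.i T) * (x.a T ω - z.a T ω)) P :=
    (hi₀.sub hi').const_mul _
  have hdm : StronglyMeasurable[H] fun ω => (1 + E.i T) * (z.a T ω - x.a T ω) :=
    ((ha'.sub ha₀).const_mul (1 + E.i T)).stronglyMeasurable
  have hdm' : StronglyMeasurable[H] fun ω => (1 + E.i T) * (x.a T ω - z.a T ω) :=
    ((ha₀.sub ha').const_mul (1 + E.i T)).stronglyMeasurable
  refine ⟨hx.feasible.shiftWealth ha₀ ha' hcx, hx.finite.shiftWealth hβ.ne' hd, fun y hy hy' => ?_⟩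
  -- Any `y` is at most `z`; `z` shifted to wealth `a₀` is at most `x`; and the shifts add opposite
  -- known amounts. Hence `y` is at most `x` plus the wealth difference, which is the shifted `x`.
  filter_upwards [hz.le y hy hy',
    hx.le _ (hz.feasible.shiftWealth ha' ha₀ hcz) (hz.finite.shiftWealth hβ.ne' hd'),
    condExp_congr_ae (m := H) (hx.finite.lifetime_shiftWealth hβ hd),
    condExp_congr_ae (m := H) (hz.finite.lifetime_shiftWealth hβ hd'),
    condExp_add (hx.finite.integrable hβ.le) hd H,
    condExp_add (hz.finite.integrable hβ.le) hd' H] with ω h1 h2 h3 h4 h5 h6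
  rw [h3, h5, Pi.add_apply, condExp_of_stronglyMeasurable hH hdm hd]
  rw [h4, h6, Pi.add_apply, condExp_of_stronglyMeasurable hH hdm' hd'] at h2
  linarith

theorem info_withBundlePrice {q : ℝ} (s : ℕ) :
    info (E.withBundlePrice t q) U x T H s = info E U x T H s :=
  info_congr rfl fun _ _ _ => ⟨rfl, rfl⟩

/-- The changed price enters only the budget of period `t`, and information does not depend on
prices. -/
theorem feasible_withBundlePrice {q : ℝ} (h : t < T) :
    Feasible (E.withBundlePrice t q) U P T a₀ H x ↔ Feasible E U P T a₀ H x := by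
  have e : info (E.withBundlePrice t q) U x T H = info E U x T H := funext info_withBundlePrice
  rw [feasible_iff, feasible_iff]
  refine and_congr ⟨?_, ?_⟩ (forall₂_congr fun s hs => ?_)
  · rintro ⟨h1, h2, h3, h4, h5, h6⟩
    rw [e] at h2 h3 h4 h5 h6
    exact ⟨h1, h2, h3, h4, h5, h6⟩
  · rintro ⟨h1, h2, h3, h4, h5, h6⟩
    constructor <;> (try rw [e]) <;> assumption
  · have e : (E.withBundlePrice t q).pb s = E.pb s :=
      Function.update_of_ne (h.trans_le hs).ne' _ _
    refine eventually_congr (ae_of_all _ fun ω => ⟨?_, ?_⟩)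
    · rintro ⟨h1, h2, h3, h4, h5, h6⟩
      rw [e] at h6
      exact ⟨h1, h2, h3, h4, h5, h6⟩
    · rintro ⟨h1, h2, h3, h4, h5, h6⟩
      rw [← e] at h6
      exact ⟨h1, h2, h3, h4, h5, h6⟩

theorem best_withBundlePrice {q : ℝ} (h : t < T) :
    Best (E.withBundlePrice t q) U P T a₀ H x ↔ Best E U P T a₀ H x := by
  constructor
  · rintro ⟨h1, h2, h3⟩
    exact ⟨(feasible_withBundlePrice h).1 h1, h2, fun y hy hy' =>
      h3 y ((feasible_withBundlePrice h).2 hy) hy'⟩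
  · rintro ⟨h1, h2, h3⟩
    exact ⟨(feasible_withBundlePrice h).2 h1, h2, fun y hy hy' =>
      h3 y ((feasible_withBundlePrice h).1 hy) hy'⟩

theorem Economy.Regular.withBundlePrice {q : ℝ} (hE : E.Regular) (hq : 0 < q) :
    (E.withBundlePrice t q).Regular := by
  obtain ⟨⟨h1, h2, h3, h4, h5, h6, h7, h8, h9, h10, h11, h12, h13, h14, h15⟩, hw, ht, hd, hl⟩ := hE
  refine ⟨⟨h1, h2, h3, h4, h5, h6, h7, h8, h9, h10, h11, h12, fun s => ?_, h14, h15⟩, hw, ht, hd,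
    hl⟩
  rcases eq_or_ne s t with rfl | hs
  · simpa [Economy.withBundlePrice] using hq
  · simpa [Economy.withBundlePrice, hs] using h13 s

end WealthShift

/-! ### Later effects of a price change -/

section LaterEffects

variable {Ω : Type*} {F₁ mΩ : MeasurableSpace Ω} {P : Measure Ω} {E : Economy} {U : Uncertainty Ω}
  {x y z : Plan Ω} {t : ℕ}

/-- Transportation demands do not respond to wealth as long as information is unchanged. -/
theorem Best.exists_shift [IsProbabilityMeasure P] {a₁ q : ℝ} (hE : E.Regular)
    (hU : U.Standing F₁ P) (hF : F₁ ≤ mΩ) (hx : Best E U P 0 (fun _ => a₁) F₁ x) (hq : 0 < q)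
    (hy : Feasible (E.withBundlePrice t q) U P t (x.a t) (info E U x 0 F₁ t) y)
    (hz : Best (E.withBundlePrice t q) U P (t + 1) (y.a (t + 1)) (info E U x 0 F₁ (t + 1)) z)
    (hc : ∀ᵐ ω ∂P,
      0 ≤ x.c (t + 1) ω + (1 + E.i (t + 1)) * (y.a (t + 1) ω - x.a (t + 1) ω) ∧
      0 ≤ z.c (t + 1) ω + (1 + E.i (t + 1)) * (x.a (t + 1) ω - y.a (t + 1) ω)) :
    Best (E.withBundlePrice t q) U P (t + 1) (y.a (t + 1)) (info E U x 0 F₁ (t + 1))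
        (x.shiftWealth E (t + 1) (y.a (t + 1))) ∧
      Best E U P (t + 1) (x.a (t + 1)) (info E U x 0 F₁ (t + 1))
        (z.shiftWealth E (t + 1) (x.a (t + 1))) := by
  have hβ := hE.standing.β_pos
  have hle := hx.feasible.adapted.info_le_ambient hE.standing hU hF
  have hxt := hx.tail hβ (Nat.zero_le (t + 1)) hF (hle (t + 1))
  rw [best_withBundlePrice (Nat.lt_succ_self t)] at hz ⊢
  have hbx := fun s => hx.feasible.exists_wealth_bound hE.standing
    ⟨|a₁|, ae_of_all _ fun _ => le_rfl⟩ (Nat.zero_le s)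
  have hby := hy.exists_wealth_bound (hE.withBundlePrice hq).standing (hbx t) (Nat.le_succ t)
  have hmx : Measurable[info E U x 0 F₁ (t + 1)] (x.a (t + 1)) :=
    (hx.feasible.a_adapted t (Nat.zero_le t)).mono (info_le_info_succ t) le_rfl
  have hmy : Measurable[info E U x 0 F₁ (t + 1)] (y.a (t + 1)) := by
    have := hy.a_adapted t le_rfl
    rw [info_self] at this
    exact this.mono (info_le_info_succ t) le_rfl
  have hint : ∀ f : Ω → ℝ, Measurable[info E U x 0 F₁ (t + 1)] f →
      (∃ C, ∀ᵐ ω ∂P, |f ω| ≤ C) → Integrable f P := fun f hf ⟨C, hC⟩ =>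
    Integrable.of_bound (hf.mono (hle _) le_rfl).aestronglyMeasurable C hC
  have hix := hint _ hmx (hbx (t + 1))
  have hiy := hint _ hmy hby
  exact ⟨hxt.shiftWealth hβ (hle _) hz hmx hmy hix hiy (hc.mono fun _ h => h.1)
      (hc.mono fun _ h => h.2),
    hz.shiftWealth hβ (hle _) hxt hmy hmx hiy hix (hc.mono fun _ h => h.2)
      (hc.mono fun _ h => h.1)⟩

end LaterEffects

/-! ### Expected utility through conditional moments -/

section Moments

variable {Ω : Type*} {F₁ H mΩ : MeasurableSpace Ω} {P : Measure Ω} {E : Economy}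
  {U : Uncertainty Ω} {x : Plan Ω} {t : ℕ}

/-- The powers of quality that enter the conditional moments. -/
def qualityPowers (E : Economy) (U : Uncertainty Ω) : Fin 5 → Ω → ℝ :=
  ![fun ω => U.A ω ^ E.φ, U.A, fun ω => U.A ω ^ (2 * E.φ), fun ω => U.A ω ^ (E.φ + 1),
    fun ω => U.A ω ^ 2]

theorem moments_apply (j : Fin 5) (ω : Ω) :
    moments E U P H ω j = (P[qualityPowers E U j | H]) ω := by
  fin_cases j <;> rfl

theorem Uncertainty.Standing.A_nonneg (hU : U.Standing F₁ P) (ω : Ω) : 0 ≤ U.A ω :=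
  hU.supp_nonneg _ (hU.A_mem ω)

theorem Real.rpow_le_one_add_sq {a s : ℝ} (ha : 0 ≤ a) (hs : 0 ≤ s) (hs' : s ≤ 2) :
    a ^ s ≤ 1 + a ^ 2 := by
  rcases le_total a 1 with h | h
  · exact (Real.rpow_le_one ha h hs).trans (by nlinarith)
  · calc a ^ s ≤ a ^ (2 : ℝ) := Real.rpow_le_rpow_of_exponent_le h hs'
      _ = a ^ 2 := Real.rpow_two a
      _ ≤ 1 + a ^ 2 := by linarith

theorem Uncertainty.Standing.integrable_rpow [IsProbabilityMeasure P] (hU : U.Standing F₁ P)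
    {s : ℝ} (hs : 0 ≤ s) (hs' : s ≤ 2) : Integrable (fun ω => U.A ω ^ s) P := by
  refine Integrable.mono' ((integrable_const (1 : ℝ)).add hU.A_sq.integrable_sq)
    (hU.A_measurable.pow_const s).aestronglyMeasurable (ae_of_all _ fun ω => ?_)
  rw [Real.norm_of_nonneg (Real.rpow_nonneg (hU.A_nonneg ω) s)]
  exact Real.rpow_le_one_add_sq (hU.A_nonneg ω) hs hs'

theorem integrable_qualityPowers [IsProbabilityMeasure P] (hE : E.Standing)
    (hU : U.Standing F₁ P) (j : Fin 5) : Integrable (qualityPowers E U j) P := by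
  have h1 := hE.φ_pos
  have h2 := hE.φ_lt
  fin_cases j
  · exact hU.integrable_rpow h1.le (by linarith)
  · exact hU.A_sq.integrable one_le_two
  · exact hU.integrable_rpow (by linarith) (by linarith)
  · exact hU.integrable_rpow (by linarith) (by linarith)
  · exact hU.A_sq.integrable_sq

/-- Conditional expectation of a linear combination with known bounded coefficients. -/
theorem condExp_sum_mul_of_bound {ι : Type*} [Fintype ι] [IsFiniteMeasure P] (hH : H ≤ mΩ)
    {X : ι → Ω → ℝ} (hX : ∀ j, Integrable (X j) P) {k₀ : Ω → ℝ} {k : ι → Ω → ℝ} {C : ℝ}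
    (hk₀ : Measurable[H] k₀) (hC₀ : ∀ᵐ ω ∂P, |k₀ ω| ≤ C)
    (hk : ∀ j, Measurable[H] (k j)) (hC : ∀ j, ∀ᵐ ω ∂P, |k j ω| ≤ C) :
    Integrable (fun ω => k₀ ω + ∑ j, k j ω * X j ω) P ∧
      P[fun ω => k₀ ω + ∑ j, k j ω * X j ω | H] =ᵐ[P]
        fun ω => k₀ ω + ∑ j, k j ω * (P[X j | H]) ω := by
  have h0 : Integrable k₀ P :=
    Integrable.of_bound (hk₀.mono hH le_rfl).aestronglyMeasurable C hC₀
  have h1 : ∀ j, Integrable (k j * X j) P := fun j =>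
    (hX j).bdd_mul ((hk j).mono hH le_rfl).aestronglyMeasurable (hC j)
  have h2 : Integrable (∑ j, k j * X j) P := integrable_finsetSum' _ fun j _ => h1 j
  have e : (fun ω => k₀ ω + ∑ j, k j ω * X j ω) = k₀ + ∑ j, k j * X j := by
    ext ω; simp
  rw [e]
  refine ⟨h0.add h2, ?_⟩
  have h3 : ∀ᵐ ω ∂P, ∀ j, (P[k j * X j | H]) ω = k j ω * (P[X j | H]) ω := ae_all_iff.2 fun j =>
    condExp_stronglyMeasurable_mul_of_bound hH (hk j).stronglyMeasurable (hX j) C (hC j)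
  filter_upwards [condExp_add h0 h2 H, condExp_finsetSum (m := H) (s := Finset.univ)
    (f := fun j => k j * X j) fun j _ => h1 j, h3] with ω k1 k2 k3
  rw [k1, Pi.add_apply, condExp_of_stronglyMeasurable hH hk₀.stronglyMeasurable h0, k2,
    Finset.sum_apply]
  congr 1
  exact Finset.sum_congr rfl fun j _ => k3 j

/-- Conditional expected utility of a period, given the conditional moments `m` of quality. -/
def expectedUtility (E : Economy) (t : ℕ) (m : Fin 5 → ℝ) (o b n c : ℝ) : ℝ :=
  c - E.lam / 2 * (o ^ 2 + E.γ ^ 2 * b ^ 2 * m 2 + n ^ 2 * m 4 + 2 * o * E.γ * b * m 0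
    + 2 * o * n * m 1 + 2 * E.γ * b * n * m 3
    - 2 * E.target t * (o + E.γ * b * m 0 + n * m 1) + E.target t ^ 2)

/-- Expanding the square gives a linear combination of five powers of quality with coefficients
known under `H`. These coefficients are bounded, so they can be pulled out of the conditional
expectation. -/
theorem condExp_utility [IsProbabilityMeasure P] (hE : E.Standing) (hU : U.Standing F₁ P)
    (hH : H ≤ mΩ) (ho : Measurable[H] (x.o t)) (hb : Measurable[H] (x.b t))
    (hn : Measurable[H] (x.n t)) (hc : Measurable[H] (x.c t)) {C : ℝ}
    (hC : ∀ᵐ ω ∂P, |x.o t ω| ≤ C ∧ |x.b t ω| ≤ C ∧ |x.n t ω| ≤ C ∧ |x.c t ω| ≤ C) :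
    Integrable (utility E U x t) P ∧
      P[utility E U x t | H] =ᵐ[P] fun ω =>
        expectedUtility E t (moments E U P H ω) (x.o t ω) (x.b t ω) (x.n t ω) (x.c t ω) := by
  set L := E.lam
  set g := E.γ
  set τ := E.target t
  set k₀ : Ω → ℝ := fun ω =>
    x.c t ω - L / 2 * (x.o t ω ^ 2 - 2 * τ * x.o t ω + τ ^ 2) with hk₀
  set k : Fin 5 → Ω → ℝ := ![
    fun ω => -(L / 2) * (2 * g * (x.o t ω * x.b t ω) - 2 * τ * g * x.b t ω),
    fun ω => -(L / 2) * (2 * (x.o t ω * x.n t ω) - 2 * τ * x.n t ω),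
    fun ω => -(L / 2) * (g ^ 2 * x.b t ω ^ 2),
    fun ω => -(L / 2) * (2 * g * (x.b t ω * x.n t ω)),
    fun ω => -(L / 2) * x.n t ω ^ 2] with hk
  -- The choices lie in a compact box, on which every continuous coefficient is bounded.
  have hbd : ∀ f : (Fin 4 → ℝ) → ℝ, Continuous f → ∃ D, ∀ᵐ ω ∂P,
      |f ![x.o t ω, x.b t ω, x.n t ω, x.c t ω]| ≤ D := by
    intro f hf
    obtain ⟨D, hD⟩ := (isCompact_univ_pi fun _ : Fin 4 =>
      isCompact_Icc (a := -C) (b := C)).exists_bound_of_continuousOn hf.continuousOn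
    refine ⟨D, ?_⟩
    filter_upwards [hC] with ω ⟨h1, h2, h3, h4⟩
    refine hD _ fun i _ => abs_le.1 ?_
    fin_cases i <;> assumption
  obtain ⟨D₀, hD₀⟩ := hbd (fun v => v 3 - L / 2 * (v 0 ^ 2 - 2 * τ * v 0 + τ ^ 2)) (by fun_prop)
  obtain ⟨D1, hD1⟩ := hbd (fun v => -(L / 2) * (2 * g * (v 0 * v 1) - 2 * τ * g * v 1))
    (by fun_prop)
  obtain ⟨D2, hD2⟩ := hbd (fun v => -(L / 2) * (2 * (v 0 * v 2) - 2 * τ * v 2)) (by fun_prop)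
  obtain ⟨D3, hD3⟩ := hbd (fun v => -(L / 2) * (g ^ 2 * v 1 ^ 2)) (by fun_prop)
  obtain ⟨D4, hD4⟩ := hbd (fun v => -(L / 2) * (2 * g * (v 1 * v 2))) (by fun_prop)
  obtain ⟨D5, hD5⟩ := hbd (fun v => -(L / 2) * v 2 ^ 2) (by fun_prop)
  set D := max D₀ (max (max D1 D2) (max (max D3 D4) D5))
  have key := condExp_sum_mul_of_bound (P := P) hH (X := qualityPowers E U) (k₀ := k₀) (k := k)
    (C := D) (integrable_qualityPowers hE hU) ?_ ?_ ?_ ?_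
  · have e : utility E U x t = fun ω => k₀ ω + ∑ j, k j ω * qualityPowers E U j ω := by
      ext ω
      have hA := hU.A_nonneg ω
      have e1 : U.A ω ^ (2 * E.φ) = (U.A ω ^ E.φ) ^ 2 := by
        rw [mul_comm, Real.rpow_mul hA, Real.rpow_two]
      have e2 : U.A ω ^ (E.φ + 1) = U.A ω ^ E.φ * U.A ω :=
        Real.rpow_add_one' hA (by linarith [hE.φ_pos])
      simp only [Fin.sum_univ_five, hk, qualityPowers, Matrix.cons_val, utility, transport, hk₀]
      rw [e1, e2]
      ring
    rw [e]
    refine ⟨key.1, key.2.trans (ae_of_all _ fun ω => ?_)⟩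
    simp only [← moments_apply]
    simp only [Fin.sum_univ_five, hk, Matrix.cons_val, expectedUtility, hk₀]
    ring
  · exact hc.sub ((((ho.pow_const 2).sub (ho.const_mul _)).add_const _).const_mul _)
  · exact hD₀.mono fun ω h => h.trans (by simp [D])
  · intro j
    fin_cases j
    · exact (((ho.mul hb).const_mul _).sub (hb.const_mul _)).const_mul _
    · exact (((ho.mul hn).const_mul _).sub (hn.const_mul _)).const_mul _
    · exact ((hb.pow_const 2).const_mul _).const_mul _
    · exact ((hb.mul hn).const_mul _).const_mul _
    · exact (hn.pow_const 2).const_mul _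
  · intro j
    fin_cases j
    · exact hD1.mono fun ω h => h.trans (by simp [D])
    · exact hD2.mono fun ω h => h.trans (by simp [D])
    · exact hD3.mono fun ω h => h.trans (by simp [D])
    · exact hD4.mono fun ω h => h.trans (by simp [D])
    · exact hD5.mono fun ω h => h.trans (by simp [D])

end Moments

/-! ### One-period deviations -/

section Deviations

variable {Ω : Type*} {F₁ H mΩ : MeasurableSpace Ω} {P : Measure Ω} {E : Economy}
  {U : Uncertainty Ω} {x : Plan Ω} {t : ℕ} {a₀ a' o b n c : Ω → ℝ}

/-- Choose `o, b, n, c` and next wealth `a'` in period `t`. -/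
def onePeriodPlan (t : ℕ) (a₀ a' o b n c : Ω → ℝ) : Plan Ω where
  o _ := o
  b _ := b
  n _ := n
  c _ := c
  a s := if s ≤ t then a₀ else a'

theorem adaptedPlan_onePeriodPlan (ha' : Measurable[H] a') (ho : Measurable[H] o)
    (hb : Measurable[H] b) (hn : Measurable[H] n) (hc : Measurable[H] c) :
    AdaptedPlan E U t a₀ H (onePeriodPlan t a₀ a' o b n c) where
  start := if_pos le_rfl
  o s _ := ho.mono (le_info s) le_rfl
  b s _ := hb.mono (le_info s) le_rfl
  n s _ := hn.mono (le_info s) le_rfl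
  c s _ := hc.mono (le_info s) le_rfl
  a s hs := by
    have e : (onePeriodPlan t a₀ a' o b n c).a (s + 1) = a' := if_neg (by omega)
    rw [e]
    exact ha'.mono (le_info s) le_rfl

/-- A deviation in period `t` only, with unchanged wealth at `t + 1`, is not profitable. -/
theorem Best.condExp_deviation_le [IsProbabilityMeasure P] (hE : E.Regular)
    (hU : U.Standing F₁ P) (hH : H ≤ mΩ) (hx : Best E U P t a₀ H x)
    (ha : ∃ C, ∀ᵐ ω ∂P, |a₀ ω| ≤ C) (ho : Measurable[H] o)
    (hb : Measurable[H] b) (hn : Measurable[H] n) (hc : Measurable[H] c)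
    (hadm : ∀ᵐ ω ∂P, Admissible E (onePeriodPlan t a₀ (x.a (t + 1)) o b n c) t ω)
    (hu : Integrable (utility E U (onePeriodPlan t a₀ (x.a (t + 1)) o b n c) t) P) :
    P[fun ω => utility E U (onePeriodPlan t a₀ (x.a (t + 1)) o b n c) t ω + E.β *
        value E U P (t + 1) (x.a (t + 1)) (U.learn t H fun ω => E.hbar (b ω) (n ω)) ω | H]
      ≤ᵐ[P]
    P[fun ω => utility E U x t ω + E.β *
        value E U P (t + 1) (x.a (t + 1)) (U.learn t H (precision E x t)) ω | H] := by
  have hβ := hE.standing.β_pos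
  set d := onePeriodPlan t a₀ (x.a (t + 1)) o b n c
  have hda : d.a (t + 1) = x.a (t + 1) := if_neg (by omega)
  have hm' : Measurable[H] (x.a (t + 1)) := by
    have := hx.feasible.a_adapted t le_rfl
    rwa [info_self] at this
  have hd : AdaptedPlan E U t a₀ H d := adaptedPlan_onePeriodPlan hm' ho hb hn hc
  have hηd : Measurable[H] fun ω => E.hbar (b ω) (n ω) :=
    hE.standing.hbar_measurable.comp (hb.prodMk hn)
  have hηx : Measurable[H] (precision E x t) := by
    have h1 := hx.feasible.b_adapted t le_rfl
    have h2 := hx.feasible.n_adapted t le_rfl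
    rw [info_self] at h1 h2
    exact measurable_precision hE.standing.hbar_measurable h1 h2
  have hid : info E U d t H (t + 1) = U.learn t H fun ω => E.hbar (b ω) (n ω) := by
    rw [info_succ le_rfl, info_self]; rfl
  have hix : info E U x t H (t + 1) = U.learn t H (precision E x t) := by
    rw [info_succ le_rfl, info_self]
  have hwd := hx.feasible.wellPosed_learn hE hU ha hH hηd
  have hwx := hx.feasible.wellPosed_learn hE hU ha hH hηx
  have hvd := (hwd.value_spec hE).2.const_mul E.β
  have hvx := (hwx.value_spec hE).2.const_mul E.β
  have hux := hx.finite.1 t le_rfl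
  have hud : Integrable (fun ω => utility E U d t ω + E.β * value E U P (t + 1) (x.a (t + 1))
      (U.learn t H fun ω => E.hbar (b ω) (n ω)) ω) P := hu.add hvd
  have huv : Integrable (fun ω => utility E U x t ω + E.β * value E U P (t + 1) (x.a (t + 1))
      (U.learn t H (precision E x t)) ω) P := hux.add hvx
  refine ae_le_of_setIntegral_le_of_measurable hH stronglyMeasurable_condExp.measurable
    stronglyMeasurable_condExp.measurable integrable_condExp integrable_condExp fun B hB => ?_
  rw [setIntegral_condExp hH hud hB, setIntegral_condExp hH huv hB,
    integral_add hu.integrableOn hvd.integrableOn, integral_add hux.integrableOn hvx.integrableOn,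
    integral_const_mul, integral_const_mul]
  have hstep : ∀ {y : Plan Ω}, FiniteUtility E U P t y →
      ∫ ω in B, lifetime E U y t ω ∂P =
        ∫ ω in B, utility E U y t ω ∂P + E.β * ∫ ω in B, lifetime E U y (t + 1) ω ∂P := by
    intro y hy
    have hy1 := ((hy.tail hβ.ne' (Nat.le_succ t)).integrable hβ.le).const_mul E.β
    rw [← integral_const_mul, ← integral_add (hy.1 t le_rfl).integrableOn hy1.integrableOn]
    refine setIntegral_congr_ae (hH _ hB) ?_
    filter_upwards [hy.lifetime_eq hβ.le 1] with ω h _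
    simpa using h
  have hxt : FiniteUtility E U P (t + 1) x := hx.finite.tail hβ.ne' (Nat.le_succ t)
  have h1 : ∫ ω in B, lifetime E U x (t + 1) ω ∂P ≤ _ :=
    hwx.setIntegral_lifetime_le hE (by rw [← hix]; exact hx.feasible.tail (Nat.le_succ t)) hxt
      (B := B) (le_sup_left (a := H) _ hB)
  -- The value after the deviation is bounded plan by plan: deviating in `t` and then following any
  -- feasible `z` of finite utility is no better than `x`.
  have h2 : ∫ ω in B, value E U P (t + 1) (x.a (t + 1))
      (U.learn t H fun ω => E.hbar (b ω) (n ω)) ω ∂P ≤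
        (∫ ω in B, lifetime E U x t ω ∂P - ∫ ω in B, utility E U d t ω ∂P) / E.β := by
    refine hwd.setIntegral_value_le hE (le_sup_left (a := H) _ hB) fun z hz hz' => ?_
    have hz1 : Feasible E U P (t + 1) (d.a (t + 1)) (info E U d t H (t + 1)) z := by
      rw [hid, hda]; exact hz
    have hcf := Feasible.concat hd (T := t + 1) (fun s h1 h2 => by
      obtain rfl : s = t := le_antisymm (Nat.lt_succ_iff.1 h2) h1
      exact hadm) hz1 (Nat.le_succ t)
    have hcu : FiniteUtility E U P t (Plan.concat (t + 1) d z) :=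
      FiniteUtility.concat hβ.ne' (Nat.le_succ t) (fun s h1 h2 => by
        obtain rfl : s = t := le_antisymm (Nat.lt_succ_iff.1 h2) h1
        exact hu) hz'
    have h3 := setIntegral_mono_ae (s := B) integrable_condExp.integrableOn
      integrable_condExp.integrableOn (hx.le _ hcf hcu)
    rw [setIntegral_condExp hH (hcu.integrable hβ.le) hB,
      setIntegral_condExp hH (hx.finite.integrable hβ.le) hB, hstep hcu, lifetime_concat,
      utility_concat_of_lt (Nat.lt_succ_self t)] at h3
    rw [le_div_iff₀ hβ]
    linarith
  rw [le_div_iff₀ hβ, hstep hx.finite] at h2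
  have := mul_le_mul_of_nonneg_left h1 hβ.le
  linarith

end Deviations

/-! ### First-order conditions -/

section FirstOrderConditions

variable {Ω : Type*} {F₁ H mΩ : MeasurableSpace Ω} {P : Measure Ω} {E : Economy}
  {U : Uncertainty Ω} {x : Plan Ω} {t : ℕ} {a₀ : Ω → ℝ} {W : ℝ → Ω → ℝ}

/-- Fermat's theorem for functions that are only compared along the rationals. -/
theorem HasDerivAt.eq_zero_of_rational_le {g : ℝ → ℝ} {g' : ℝ} (h : HasDerivAt g g' 0)
    (hle : ∀ᶠ ε in 𝓝 (0 : ℝ), ∀ r : ℚ, (r : ℝ) = ε → g ε ≤ g 0) : g' = 0 := by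
  have hu : Tendsto (fun k : ℕ => 1 / ((k : ℝ) + 1)) atTop (𝓝[>] 0) :=
    tendsto_nhdsWithin_iff.2 ⟨tendsto_one_div_add_atTop_nhds_zero_nat,
      Eventually.of_forall fun k => Set.mem_Ioi.2 (by positivity)⟩
  have hv : Tendsto (fun k : ℕ => -(1 / ((k : ℝ) + 1))) atTop (𝓝[<] 0) := by
    refine tendsto_nhdsWithin_iff.2 ⟨?_, Eventually.of_forall fun k => ?_⟩
    · simpa using tendsto_one_div_add_atTop_nhds_zero_nat (𝕜 := ℝ).neg
    · exact Set.mem_Iio.2 (neg_neg_of_pos (by positivity))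
  have h1 := h.tendsto_slope_zero_right.comp hu
  have h2 := h.tendsto_slope_zero_left.comp hv
  refine le_antisymm (le_of_tendsto h1 ?_) (ge_of_tendsto h2 ?_)
  · filter_upwards [(hu.mono_right nhdsWithin_le_nhds).eventually hle] with k hk
    have := hk (1 / ((k : ℚ) + 1)) (by push_cast; ring)
    simp only [Function.comp_apply, zero_add, smul_eq_mul]
    exact mul_nonpos_of_nonneg_of_nonpos (by positivity) (by linarith)
  · filter_upwards [(hv.mono_right nhdsWithin_le_nhds).eventually hle] with k hk
    have := hk (-(1 / ((k : ℚ) + 1))) (by push_cast; ring)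
    simp only [Function.comp_apply, zero_add, smul_eq_mul]
    refine mul_nonneg_of_nonpos_of_nonpos (inv_nonpos.2 (neg_nonpos.2 (by positivity)))
      (by linarith)

/-- Expected utility of `t` plus expected continuation value after changing the trips of `x` by
`d`, financed by consumption. -/
def deviationPayoff (E : Economy) (x : Plan Ω) (t : ℕ) (m : Fin 5 → ℝ) (W : ℝ → Ω → ℝ) (ω : Ω)
    (d : Fin 3 → ℝ) : ℝ :=
  expectedUtility E t m (x.o t ω + d 0) (x.b t ω + d 1) (x.n t ω + d 2)
      (x.c t ω - (E.po t * d 0 + E.pb t * d 1 + E.pn t * d 2))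
    + E.β * W (E.hbar (x.b t ω + d 1) (x.n t ω + d 2)) ω

/-- The fixed change `d` is made only on the event `B` where it keeps trips and consumption
nonnegative, and `x` is followed elsewhere. `B` is known in period `t`, so the deviation is
feasible. The exceptional null set depends on `d`. -/
theorem Best.ae_deviationPayoff_le [IsProbabilityMeasure P] (hE : E.Regular)
    (hU : U.Standing F₁ P) (hH : H ≤ mΩ) (hx : Best E U P t a₀ H x)
    (ha : ∃ C, ∀ᵐ ω ∂P, |a₀ ω| ≤ C) (hW : IsContinuationValue E U P t H (x.a (t + 1)) W)
    (d : Fin 3 → ℝ) :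
    ∀ᵐ ω ∂P, 0 ≤ x.o t ω + d 0 → 0 ≤ x.b t ω + d 1 → 0 ≤ x.n t ω + d 2 →
      0 ≤ x.c t ω - (E.po t * d 0 + E.pb t * d 1 + E.pn t * d 2) →
      deviationPayoff E x t (moments E U P H ω) W ω d ≤
        deviationPayoff E x t (moments E U P H ω) W ω 0 := by
  classical
  set κ := E.po t * d 0 + E.pb t * d 1 + E.pn t * d 2
  have hf := hx.feasible
  have ho := hf.o_adapted t le_rfl
  have hb := hf.b_adapted t le_rfl
  have hn := hf.n_adapted t le_rfl
  have hc := hf.c_adapted t le_rfl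
  rw [info_self] at ho hb hn hc
  set B : Set Ω := {ω | 0 ≤ x.o t ω + d 0} ∩ {ω | 0 ≤ x.b t ω + d 1} ∩ {ω | 0 ≤ x.n t ω + d 2} ∩
    {ω | 0 ≤ x.c t ω - κ}
  have hnn : ∀ {f : Ω → ℝ}, Measurable[H] f → MeasurableSet[H] {ω | 0 ≤ f ω} :=
    fun hf => hf measurableSet_Ici
  have hB : MeasurableSet[H] B :=
    MeasurableSet.inter (MeasurableSet.inter (MeasurableSet.inter (hnn (ho.add_const _))
      (hnn (hb.add_const _))) (hnn (hn.add_const _))) (hnn (hc.sub_const _))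
  have hind : ∀ r : ℝ, Measurable[H] (B.indicator fun _ => r) := fun r =>
    measurable_const.indicator hB
  set o : Ω → ℝ := fun ω => x.o t ω + B.indicator (fun _ => d 0) ω
  set b : Ω → ℝ := fun ω => x.b t ω + B.indicator (fun _ => d 1) ω
  set n : Ω → ℝ := fun ω => x.n t ω + B.indicator (fun _ => d 2) ω
  set c : Ω → ℝ := fun ω => x.c t ω - B.indicator (fun _ => κ) ω
  have ho' : Measurable[H] o := ho.add (hind _)
  have hb' : Measurable[H] b := hb.add (hind _)
  have hn' : Measurable[H] n := hn.add (hind _)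
  have hc' : Measurable[H] c := hc.sub (hind _)
  set y := onePeriodPlan t a₀ (x.a (t + 1)) o b n c
  have hadm : ∀ᵐ ω ∂P, Admissible E y t ω := by
    filter_upwards [hf.admissible le_rfl] with ω h
    have e1 : y.a t = x.a t := (if_pos le_rfl).trans hf.start.symm
    have e2 : y.a (t + 1) = x.a (t + 1) := if_neg (by omega)
    by_cases hω : ω ∈ B
    · have e : y.o t ω = x.o t ω + d 0 ∧ y.b t ω = x.b t ω + d 1 ∧ y.n t ω = x.n t ω + d 2 ∧
          y.c t ω = x.c t ω - κ := by
        simp [y, onePeriodPlan, o, b, n, c, hω]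
      obtain ⟨k1, k2, k3, k4⟩ := e
      obtain ⟨⟨⟨j1, j2⟩, j3⟩, j4⟩ := hω
      refine ⟨k1 ▸ j1, k2 ▸ j2, k3 ▸ j3, k4 ▸ j4, e2 ▸ h.borrowing, ?_⟩
      rw [k1, k2, k3, k4, e1, e2]
      simp only [κ]
      linarith [h.budget]
    · have e : y.o t ω = x.o t ω ∧ y.b t ω = x.b t ω ∧ y.n t ω = x.n t ω ∧
          y.c t ω = x.c t ω := by
        simp [y, onePeriodPlan, o, b, n, c, hω]
      obtain ⟨k1, k2, k3, k4⟩ := e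
      refine ⟨k1 ▸ h.o, k2 ▸ h.b, k3 ▸ h.n, k4 ▸ h.c, e2 ▸ h.borrowing, ?_⟩
      rw [k1, k2, k3, k4, e1, e2]
      exact h.budget
  obtain ⟨C, hC⟩ := hf.exists_consumption_bound hE.standing ha le_rfl
  have hindle : ∀ (r : ℝ) (ω : Ω), |B.indicator (fun _ => r) ω| ≤ |r| := fun r ω => by
    by_cases hω : ω ∈ B <;> simp [hω]
  have hux := condExp_utility hE.standing hU hH ho hb hn hc hC
  have huy := condExp_utility (x := y) (t := t) hE.standing hU hH ho' hb' hn' hc'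
    (C := C + (|d 0| + |d 1| + |d 2| + |κ|)) <| by
      filter_upwards [hC] with ω ⟨h1, h2, h3, h4⟩
      have p0 := abs_nonneg (d 0)
      have p1 := abs_nonneg (d 1)
      have p2 := abs_nonneg (d 2)
      have p3 := abs_nonneg κ
      refine ⟨(abs_add_le _ _).trans ?_, (abs_add_le _ _).trans ?_, (abs_add_le _ _).trans ?_,
        (abs_sub _ _).trans ?_⟩
      · linarith [hindle (d 0) ω]
      · linarith [hindle (d 1) ω]
      · linarith [hindle (d 2) ω]
      · linarith [hindle κ ω]
  have hηy : Measurable[H] fun ω => E.hbar (b ω) (n ω) :=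
    hE.standing.hbar_measurable.comp (hb'.prodMk hn')
  have hηx : Measurable[H] (precision E x t) :=
    measurable_precision hE.standing.hbar_measurable hb hn
  have hsplit : ∀ {u : Ω → ℝ} {η : Ω → ℝ}, Integrable u P → Measurable[H] η →
      (∀ᵐ ω ∂P, η ω ∈ E.precisions) →
      P[fun ω => u ω + E.β * value E U P (t + 1) (x.a (t + 1)) (U.learn t H η) ω | H] =ᵐ[P]
        fun ω => (P[u | H]) ω + E.β * W (η ω) ω := by
    intro u η hu hη hp
    have hv := ((hf.wellPosed_learn hE hU ha hH hη).value_spec hE).2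
    filter_upwards [condExp_add hu (hv.smul E.β) H,
      condExp_smul (μ := P) E.β (value E U P (t + 1) (x.a (t + 1)) (U.learn t H η)) H,
      hW η hη hp] with ω h1 h2 h3
    refine h1.trans ?_
    rw [Pi.add_apply, h2, Pi.smul_apply, h3, smul_eq_mul]
  have hdev := hx.condExp_deviation_le hE hU hH ha ho' hb' hn' hc' hadm huy.1
  filter_upwards [hdev, hsplit huy.1 hηy (hadm.mono fun ω h => ⟨_, _, h.b, h.n, rfl⟩),
    hsplit hux.1 hηx ((hf.admissible le_rfl).mono fun ω h => ⟨_, _, h.b, h.n, rfl⟩), hux.2, huy.2]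
    with ω h1 h2 h3 h4 h5 j1 j2 j3 j4
  have hω : ω ∈ B := ⟨⟨⟨j1, j2⟩, j3⟩, j4⟩
  rw [h2, h3, h4, h5] at h1
  simpa [deviationPayoff, y, onePeriodPlan, o, b, n, c, hω, precision, κ] using h1

/-- The first-order condition in the direction `v`. -/
theorem deviationPayoff_foc {m : Fin 5 → ℝ} {ω : Ω} {D f' : ℝ} (v : Fin 3 → ℚ)
    (hi : InteriorAt x t ω) (hD : HasMarginalValue E x t W D ω)
    (hh : HasDerivAt (fun ε : ℝ => E.hbar (x.b t ω + ε * v 1) (x.n t ω + ε * v 2)) f' 0)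
    (hle : ∀ d : Fin 3 → ℚ, 0 ≤ x.o t ω + d 0 → 0 ≤ x.b t ω + d 1 → 0 ≤ x.n t ω + d 2 →
      0 ≤ x.c t ω - (E.po t * d 0 + E.pb t * d 1 + E.pn t * d 2) →
      deviationPayoff E x t m W ω (fun j => (d j : ℝ)) ≤ deviationPayoff E x t m W ω 0) :
    E.lam * ∑ j, v j * ((momentMatrix E.γ m).mulVec (demand x t ω) j
        - E.target t * ![1, E.γ * m 0, m 1] j) =
      -(E.po t * v 0 + E.pb t * v 1 + E.pn t * v 2) + E.β * D * f' := by
  obtain ⟨io, ib, i_n, ic⟩ := hi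
  have hev : ∀ {p : ℝ} (r : ℝ), 0 < p → ∀ᶠ ε in 𝓝 (0 : ℝ), 0 < p + ε * r := fun {p} r hp => by
    have : Tendsto (fun ε : ℝ => p + ε * r) (𝓝 0) (𝓝 (p + 0 * r)) :=
      Continuous.tendsto (by fun_prop) 0
    rw [zero_mul, add_zero] at this
    exact this.eventually_const_lt hp
  have hWd : HasDerivAt (fun ε : ℝ => W (E.hbar (x.b t ω + ε * v 1) (x.n t ω + ε * v 2)) ω)
      (D * f') 0 := by
    -- The marginal value is a derivative within the attainable precisions only. Near `0` both kinds
    -- of trips stay positive, so the path of precisions remains in that set.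
    set S : Set ℝ := {ε | 0 < x.b t ω + ε * v 1 ∧ 0 < x.n t ω + ε * v 2}
    have hS : S ∈ 𝓝 (0 : ℝ) := (hev _ ib).and (hev _ i_n)
    have h0 : HasDerivWithinAt (fun h => W h ω) D E.precisions
        ((fun ε : ℝ => E.hbar (x.b t ω + ε * v 1) (x.n t ω + ε * v 2)) 0) := by
      simpa [HasMarginalValue, precision] using hD
    have hmaps : Set.MapsTo (fun ε : ℝ => E.hbar (x.b t ω + ε * v 1) (x.n t ω + ε * v 2)) S
        E.precisions := fun ε hε => ⟨_, _, hε.1.le, hε.2.le, rfl⟩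
    exact (h0.comp (0 : ℝ) (hh.hasDerivWithinAt (s := S)) hmaps).hasDerivAt hS
  have hlin : ∀ p r : ℝ, HasDerivAt (fun ε : ℝ => p + ε * r) r 0 := fun p r => by
    simpa using ((hasDerivAt_id (0 : ℝ)).mul_const r).const_add p
  have hquad : HasDerivAt (fun ε : ℝ => expectedUtility E t m (x.o t ω + ε * v 0)
      (x.b t ω + ε * v 1) (x.n t ω + ε * v 2)
      (x.c t ω + ε * -(E.po t * v 0 + E.pb t * v 1 + E.pn t * v 2)))
      (-(E.po t * v 0 + E.pb t * v 1 + E.pn t * v 2) - E.lam * ∑ j, v j *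
        ((momentMatrix E.γ m).mulVec (demand x t ω) j
        - E.target t * ![1, E.γ * m 0, m 1] j)) 0 := by
    have ho := hlin (x.o t ω) (v 0)
    have hb := hlin (x.b t ω) (v 1)
    have hn := hlin (x.n t ω) (v 2)
    have hc := hlin (x.c t ω) (-(E.po t * v 0 + E.pb t * v 1 + E.pn t * v 2))
    have key := hc.sub ((((((((ho.pow 2).add (((hb.pow 2).const_mul (E.γ ^ 2)).mul_const (m 2))).add
      ((hn.pow 2).mul_const (m 4))).add ((((ho.const_mul 2).mul_const E.γ).mul hb).mul_const (m 0))).add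
      (((ho.const_mul 2).mul hn).mul_const (m 1))).add
      (((hb.const_mul (2 * E.γ)).mul hn).mul_const (m 3))).sub
      (((ho.add ((hb.const_mul E.γ).mul_const (m 0))).add (hn.mul_const (m 1))).const_mul
        (2 * E.target t))).add_const (E.target t ^ 2) |>.const_mul (E.lam / 2))
    refine (key.congr_deriv ?_)
    simp only [Fin.sum_univ_three, Matrix.mulVec, dotProduct, momentMatrix, demand,
      Matrix.of_apply, Matrix.cons_val]
    push_cast
    ring
  have hzero := (hquad.add (hWd.const_mul E.β)).eq_zero_of_rational_le ?_
  · linarith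
  · filter_upwards [hev (v 0) io, hev (v 1) ib, hev (v 2) i_n,
      hev (-(E.po t * v 0 + E.pb t * v 1 + E.pn t * v 2)) ic] with ε k1 k2 k3 k4
    rintro r rfl
    have := hle (fun j => r * v j) (by push_cast; exact k1.le) (by push_cast; exact k2.le)
      (by push_cast; exact k3.le) (by push_cast; linarith)
    simp only [deviationPayoff, Pi.zero_apply, add_zero, mul_zero, sub_zero] at this
    push_cast at this
    simp only [zero_mul, add_zero, Pi.add_apply]
    convert this using 3
    ring

/-- The first-order conditions for interior demand. -/
theorem Best.ae_foc [IsProbabilityMeasure P] (hE : E.Regular)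
    (hU : U.Standing F₁ P) (hH : H ≤ mΩ) (hx : Best E U P t a₀ H x)
    (ha : ∃ C, ∀ᵐ ω ∂P, |a₀ ω| ≤ C) (hW : IsContinuationValue E U P t H (x.a (t + 1)) W) :
    ∀ᵐ ω ∂P, InteriorAt x t ω → ∀ D, HasMarginalValue E x t W D ω →
      E.lam • (momentMatrix E.γ (moments E U P H ω)).mulVec (demand x t ω) =
        (E.lam * E.target t) • ![1, E.γ * moments E U P H ω 0, moments E U P H ω 1]
          - ![E.po t, E.pb t, E.pn t]
          + ![0, marginalLearningB E x t D ω, marginalLearningN E x t D ω] := by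
  -- Restricting to rational deviations keeps the exceptional null sets countable in number;
  -- stationarity needs no more.
  have hall := ae_all_iff.2 fun d : Fin 3 → ℚ =>
    hx.ae_deviationPayoff_le hE hU hH ha hW fun j => (d j : ℝ)
  filter_upwards [hall] with ω hle hi D hD
  have hmem : (x.b t ω, x.n t ω) ∈ Set.Ioi (0 : ℝ) ×ˢ Set.Ioi (0 : ℝ) := ⟨hi.2.1, hi.2.2.1⟩
  have hdiff : DifferentiableAt ℝ (fun q : ℝ × ℝ => E.hbar q.1 q.2) (x.b t ω, x.n t ω) :=
    (hE.standing.hbar_smooth.differentiableOn (by simp) _ hmem).differentiableAt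
      ((isOpen_Ioi.prod isOpen_Ioi).mem_nhds hmem)
  have hb : HasDerivAt (fun y => E.hbar y (x.n t ω))
      (deriv (fun y => E.hbar y (x.n t ω)) (x.b t ω)) (x.b t ω) :=
    DifferentiableAt.hasDerivAt <| DifferentiableAt.comp (g := fun q : ℝ × ℝ => E.hbar q.1 q.2)
      (f := fun y => (y, x.n t ω)) (x.b t ω) hdiff
      (differentiableAt_id.prodMk (differentiableAt_const _))
  have hn : HasDerivAt (fun y => E.hbar (x.b t ω) y)
      (deriv (fun y => E.hbar (x.b t ω) y) (x.n t ω)) (x.n t ω) :=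
    DifferentiableAt.hasDerivAt <| DifferentiableAt.comp (g := fun q : ℝ × ℝ => E.hbar q.1 q.2)
      (f := fun y => (x.b t ω, y)) (x.n t ω) hdiff
      ((differentiableAt_const _).prodMk differentiableAt_id)
  -- Trips with the outside option do not affect precision, so this direction has no learning term.
  have f0 := deviationPayoff_foc (f' := 0) ![1, 0, 0] hi hD
    (by simpa using hasDerivAt_const (0 : ℝ) (E.hbar (x.b t ω) (x.n t ω))) hle
  have eb := HasDerivAt.comp_const_add (f := fun y => E.hbar y (x.n t ω)) (x.b t ω) (0 : ℝ)
    (by rw [add_zero]; exact hb)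
  have en := HasDerivAt.comp_const_add (f := fun y => E.hbar (x.b t ω) y) (x.n t ω) (0 : ℝ)
    (by rw [add_zero]; exact hn)
  have f1 := deviationPayoff_foc ![0, 1, 0] hi hD
    (by simpa only [Matrix.cons_val, Rat.cast_zero, Rat.cast_one, mul_zero, mul_one, add_zero]
      using eb) hle
  have f2 := deviationPayoff_foc ![0, 0, 1] hi hD
    (by simpa only [Matrix.cons_val, Rat.cast_zero, Rat.cast_one, mul_zero, mul_one, add_zero]
      using en) hle
  simp only [Fin.sum_univ_three, Matrix.cons_val] at f0 f1 f2
  push_cast at f0 f1 f2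
  ext j
  fin_cases j <;> simp [marginalLearningB, marginalLearningN] at f0 f1 f2 ⊢ <;> linarith

end FirstOrderConditions

/-! ### Comparative statics of demand -/

section PriceChange

/-- The price change and the changes in the marginal value of learning determine the change in
demand. -/
theorem demand_change {l τ po pb pn q by' bx ny nx : ℝ} {M : Matrix (Fin 3) (Fin 3) ℝ}
    {s qx qy : Fin 3 → ℝ} (hl : l ≠ 0) (hq : q ≠ pb) (hM : M.det ≠ 0)
    (hx : l • M.mulVec qx = (l * τ) • s - ![po, pb, pn] + ![0, bx, nx])
    (hy : l • M.mulVec qy = (l * τ) • s - ![po, q, pn] + ![0, by', ny]) :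
    (1 / (q - pb)) • (qy - qx) = (1 / l) • (-M⁻¹.mulVec ![0, 1, 0])
      + ((by' - bx) / (q - pb)) • (1 / l) • M⁻¹.mulVec ![0, 1, 0]
      + ((ny - nx) / (q - pb)) • (1 / l) • M⁻¹.mulVec ![0, 0, 1] := by
  have hd : q - pb ≠ 0 := sub_ne_zero.2 hq
  have hu : IsUnit M.det := hM.isUnit
  -- Both plans face the same moments and target, so subtraction leaves only the bundle price and
  -- the two learning terms.
  have h1 : l • M.mulVec (qy - qx) = -((q - pb) • ![0, 1, 0]) + (by' - bx) • ![0, 1, 0]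
      + (ny - nx) • ![0, 0, 1] := by
    rw [Matrix.mulVec_sub, smul_sub, hx, hy]
    ext j
    fin_cases j <;> simp
    ring
  have h2 := congrArg M⁻¹.mulVec h1
  rw [Matrix.mulVec_smul, Matrix.mulVec_mulVec, Matrix.nonsing_inv_mul _ hu, Matrix.one_mulVec,
    Matrix.mulVec_add, Matrix.mulVec_add, Matrix.mulVec_neg, Matrix.mulVec_smul,
    Matrix.mulVec_smul, Matrix.mulVec_smul] at h2
  ext j
  have h3 := congrFun h2 j
  simp only [Pi.add_apply, Pi.smul_apply, Pi.neg_apply, smul_eq_mul, Pi.sub_apply] at h3 ⊢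
  field_simp
  linarith

end PriceChange

end

/-! ### The proposition -/

theorem proposition1 :
    ∃ Φ₁ Φ₂ Φ₃ : ℝ → (Fin 5 → ℝ) → (Fin 3 → ℝ),
    ∀ (Ω : Type*) [mΩ : MeasurableSpace Ω] (P : Measure Ω) [IsProbabilityMeasure P]
      (E : Economy) (U : Uncertainty Ω) (F₁ : MeasurableSpace Ω) (a₁ : ℝ),
      F₁ ≤ mΩ → E.Standing → U.Standing F₁ P →
      (∃ C, ∀ t, |E.w t| ≤ C) → (∃ C, ∀ t, |E.target t| ≤ C) →
      (∀ t, E.β * (1 + E.i t) ≤ 1) → E.DebtLimits → E.alow 0 ≤ a₁ →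
      -- 1. a more precise signal never lowers the expected continuation value
      (∀ x : Plan Ω, Feasible E U P 0 (fun _ => a₁) F₁ x →
        ∀ t : ℕ,
          (∀ h ∈ E.precisions,
            IsEssentialSup P (U.learn t (info E U x 0 F₁ t) fun _ => h)
              (attainable E U P (t + 1) (x.a (t + 1)) (U.learn t (info E U x 0 F₁ t) fun _ => h))
              (value E U P (t + 1) (x.a (t + 1)) (U.learn t (info E U x 0 F₁ t) fun _ => h)) ∧
            Integrable
              (value E U P (t + 1) (x.a (t + 1)) (U.learn t (info E U x 0 F₁ t) fun _ => h)) P) ∧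
          ∀ h' ∈ E.precisions, ∀ h'' ∈ E.precisions, h' < h'' →
            P[value E U P (t + 1) (x.a (t + 1))
                (U.learn t (info E U x 0 F₁ t) fun _ => h') | info E U x 0 F₁ t]
              ≤ᵐ[P]
            P[value E U P (t + 1) (x.a (t + 1))
                (U.learn t (info E U x 0 F₁ t) fun _ => h'') | info E U x 0 F₁ t]) ∧
      -- 2. with sufficient incentives to learn, quality is learnt asymptotically
      (∀ x : Plan Ω, Feasible E U P 0 (fun _ => a₁) F₁ x →
        (∀ᵐ ω ∂P, limsup (fun N : ℕ =>
          (N : ℝ≥0∞) / ENNReal.ofReal (∑ j ∈ Finset.range N, precision E x j ω)) atTop < ⊤) →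
        ∀ g : ℝ → ℝ, Measurable g → Integrable (fun ω => g (U.A ω)) P →
          (∀ᵐ ω ∂P, Tendsto (fun N => (P[fun ω => g (U.A ω) | info E U x 0 F₁ N]) ω) atTop
            (𝓝 (g (U.A ω)))) ∧
          Tendsto (fun N => ∫ ω, |(P[fun ω => g (U.A ω) | info E U x 0 F₁ N]) ω - g (U.A ω)| ∂P)
            atTop (𝓝 0)) ∧
      -- 3(a). contemporaneous effect of a change of the period-`t` bundle price to `q`
      (∀ x : Plan Ω, Optimal E U P 0 (fun _ => a₁) F₁ x →
        ∀ (t : ℕ) (q : ℝ), 0 < q → q ≠ E.pb t →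
        ∀ y : Plan Ω,
          Optimal (E.withBundlePrice t q) U P t (x.a t) (info E U x 0 F₁ t) y →
        ∀ (Wx Wy : ℝ → Ω → ℝ) (Dx Dy : Ω → ℝ),
          IsContinuationValue E U P t (info E U x 0 F₁ t) (x.a (t + 1)) Wx →
          IsContinuationValue (E.withBundlePrice t q) U P t (info E U x 0 F₁ t)
            (y.a (t + 1)) Wy →
          ∀ᵐ ω ∂P, InteriorAt x t ω → InteriorAt y t ω →
            HasMarginalValue E x t Wx (Dx ω) ω → HasMarginalValue E y t Wy (Dy ω) ω →
            (momentMatrix E.γ (moments E U P (info E U x 0 F₁ t) ω)).det ≠ 0 →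
            (1 / (q - E.pb t)) • (demand y t ω - demand x t ω) =
              (1 / E.lam) • Φ₁ E.γ (moments E U P (info E U x 0 F₁ t) ω)
              + ((marginalLearningB E y t (Dy ω) ω - marginalLearningB E x t (Dx ω) ω)
                  / (q - E.pb t)) •
                (1 / E.lam) • Φ₂ E.γ (moments E U P (info E U x 0 F₁ t) ω)
              + ((marginalLearningN E y t (Dy ω) ω - marginalLearningN E x t (Dx ω) ω)
                  / (q - E.pb t)) •
                (1 / E.lam) • Φ₃ E.γ (moments E U P (info E U x 0 F₁ t) ω)) ∧
      -- 3(b). later effects: `y` is the plan after the price change, and `z` is what the consumer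
      -- does from `t + 1` on with the wealth left by `y` but the information set left by `x`
      (∀ x : Plan Ω, Optimal E U P 0 (fun _ => a₁) F₁ x →
        ∀ (t : ℕ) (q : ℝ), 0 < q →
        ∀ y : Plan Ω,
          Feasible (E.withBundlePrice t q) U P t (x.a t) (info E U x 0 F₁ t) y →
        ∀ z : Plan Ω,
          Optimal (E.withBundlePrice t q) U P (t + 1) (y.a (t + 1))
            (info E U x 0 F₁ (t + 1)) z →
          (∀ᵐ ω ∂P,
            0 ≤ x.c (t + 1) ω + (1 + E.i (t + 1)) * (y.a (t + 1) ω - x.a (t + 1) ω) ∧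
            0 ≤ z.c (t + 1) ω + (1 + E.i (t + 1)) * (x.a (t + 1) ω - y.a (t + 1) ω)) →
          (∃ x' : Plan Ω,
            Optimal (E.withBundlePrice t q) U P (t + 1) (y.a (t + 1))
              (info E U x 0 F₁ (t + 1)) x' ∧
            ∀ s, t < s → demand x' s = demand x s) ∧
          (∃ z' : Plan Ω,
            Optimal E U P (t + 1) (x.a (t + 1)) (info E U x 0 F₁ (t + 1)) z' ∧
            ∀ s, t < s → demand z' s = demand z s) ∧
          ((∀ x' : Plan Ω,
              Optimal E U P (t + 1) (x.a (t + 1)) (info E U x 0 F₁ (t + 1)) x' →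
              ∀ s, t < s → demand x' s =ᵐ[P] demand x s) →
            ∀ s, t < s → demand z s =ᵐ[P] demand x s)) := by
  -- The responses are columns of the inverse moment matrix: bundle and new mode are coordinates `1`
  -- and `2`, and the price enters the first-order condition with a minus sign.
  refine ⟨fun γ m => -(momentMatrix γ m)⁻¹.mulVec ![0, 1, 0],
    fun γ m => (momentMatrix γ m)⁻¹.mulVec ![0, 1, 0],
    fun γ m => (momentMatrix γ m)⁻¹.mulVec ![0, 0, 1], ?_⟩
  intro Ω mΩ P _ E U F₁ a₁ hF hEs hU hw hτ hd hl _
  have hE : E.Regular := ⟨hEs, hw, hτ, hd, hl⟩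
  refine ⟨fun x hx t => ⟨fun h _ => ?_, fun h' hh' h'' _ hlt => ?_⟩,
    fun x hx hlim g hg hgi => hx.tendsto_condExp hEs hU hF hlim hg hgi, ?_, ?_⟩
  · exact (hx.wellPosed_learn_info hE hU hF t measurable_const).value_spec hE
  · obtain ⟨b, n, hb, hn, rfl⟩ := hh'
    exact hx.condExp_value_mono hE hU hF t (hEs.hbar_nonneg b n hb hn) hlt
  · intro x hx t q hq hqne y hy Wx Wy Dx Dy hWx hWy
    rw [optimal_iff_best] at hx hy
    have hle := hx.feasible.adapted.info_le_ambient hEs hU hF t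
    have hb := hx.feasible.exists_wealth_bound hEs ⟨|a₁|, ae_of_all _ fun _ => le_rfl⟩
      (Nat.zero_le t)
    have hE' : (E.withBundlePrice t q).Regular := hE.withBundlePrice hq
    filter_upwards [(hx.tail hEs.β_pos (Nat.zero_le t) hF hle).ae_foc hE hU hle hb hWx,
      hy.ae_foc hE' hU hle hb hWy] with ω h1 h2 hix hiy hDx hDy hdet
    have k1 := h1 hix _ hDx
    have k2 := h2 hiy _ hDy
    have e : (E.withBundlePrice t q).pb t = q := Function.update_self ..
    rw [e] at k2
    exact demand_change hEs.lam_pos.ne' hqne hdet k1 k2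
  · intro x hx t q hq y hy z hz hc
    rw [optimal_iff_best] at hx hz
    obtain ⟨h1, h2⟩ := hx.exists_shift hE hU hF hq hy hz hc
    refine ⟨⟨_, optimal_iff_best.2 h1, fun s _ => rfl⟩, ⟨_, optimal_iff_best.2 h2, fun s _ => rfl⟩,
      fun huniq s hs => ?_⟩
    -- The shifted `z` is optimal at the original wealth and has the trips of `z`, so uniqueness
    -- there identifies them with those of `x`.
    exact huniq _ (optimal_iff_best.2 h2) s hs
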